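/- Let $q>2$ be a prime power and let all matroids be finite and simple (so every contraction is followed by a simplification). For matroids $M_1,M_2$ whose ground sets meet in a modular flat $T$ of $M_1$ with $M_1|T=M_2|T$, the generalized parallel connection $P_T(M_1,M_2)$ is the matroid on $E(M_1)\cup E(M_2)$ whose flats are the sets $X$ such that $X\cap E(M_i)$ is a flat of $M_i$ for $i=1,2$. Let $\mathcal{M}_q$ be the class of $GF(q)$-representable matroids that can be built from projective geometries $PG(r-1,q)$, $r\ge 0$, by a sequence of generalized parallel connections across projective geometries over $GF(q)$ (including the empty one). An induced minor of $M$ is a matroid obtained from $M$ by a sequence of restrictions to flats and contractions, each contraction being followed by a simplification; it is proper if it is not $M$ itself. Then the set of forbidden induced minors for $\mathcal{M}_q$ is $\mathcal{N}=\{U_{2,k}: 2<k\le q\}\cup\{U_{3,q+2}\}$, in the following sense. (i) Each member of $\mathcal{N}$ is not in $\mathcal{M}_q$, while all its proper induced minors are in $\mathcal{M}_q$. (ii) A matroid $M$ is in $\mathcal{M}_q$ if and only if $M$ is $GF(q)$-representable and no induced minor of $M$ is isomorphic to a member of $\mathcal{N}$. (iii) The $GF(q)$-representable matroids that are not in $\mathcal{M}_q$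 but all of whose proper induced minors are in $\mathcal{M}_q$ are, up to isomorphism, exactly the $GF(q)$-representable members of $\mathcal{N}$, namely the lines $U_{2,k}$ with $2<k\le q$ and, when $q$ is even, also $U_{3,q+2}$ (which is not $GF(q)$-representable when $q$ is odd). -/

import Mathlib

open scoped Matroid

namespace Matroid

/-- A matroid is simple if it has no loops and no two distinct parallel elements. -/
def IsSimple {α : Type*} (M : Matroid α) : Prop :=
  ∀ x ∈ M.E, ∀ y ∈ M.E, M.Indep {x, y}

/-- `M` is (a copy of) the uniform matroid `U_{r,n}`. -/
def IsUniform {α : Type*} (M : Matroid α) (r n : ℕ) : Prop :=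
  M.E.encard = n ∧ ∀ I ⊆ M.E, M.Indep I ↔ I.encard ≤ r

/-- `M` is representable over the field `F` (by vectors in some finite-dimensional space). -/
def IsRepresentable {α : Type*} (F : Type*) [Field F] (M : Matroid α) : Prop :=
  ∃ (n : ℕ) (v : α → Fin n → F), ∀ I ⊆ M.E, M.Indep I ↔ LinearIndepOn F v I

/-- `M` is (a copy of) the projective geometry `PG(n-1, F)` of rank `n`: its elements are the
points of the projective space of `F ^ n`, its independent sets the linearly independent sets of
points. For `n = 0` this is the empty matroid. -/
def IsProjectiveGeometry {α : Type*} (F : Type*) [Field F] (n : ℕ) (M : Matroid α) : Prop :=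
  ∃ φ : M.E ≃ Projectivization F (Fin n → F), ∀ I : Set M.E,
    M.Indep (Subtype.val '' I) ↔ Projectivization.Independent (fun x : I => φ x)

/-- `T` is a modular flat of `M`. -/
def IsModularFlat {α : Type*} (M : Matroid α) (T : Set α) : Prop :=
  M.IsFlat T ∧ ∀ X, M.IsFlat X → M.eRk T + M.eRk X = M.eRk (T ∪ X) + M.eRk (T ∩ X)

/-- `M` is the generalized parallel connection `P_T(M₁, M₂)`: the ground sets of `M₁` and `M₂`
meet in `T`, which is a modular flat of `M₁`, `M₁` and `M₂` agree on `T`, and the flats of `M`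
are the subsets of `E(M₁) ∪ E(M₂)` that meet each `E(Mᵢ)` in a flat of `Mᵢ`. -/
structure IsGenParallelConnection {α : Type*} (M M₁ M₂ : Matroid α) (T : Set α) : Prop where
  inter_eq : M₁.E ∩ M₂.E = T
  modular : M₁.IsModularFlat T
  restrict_eq : M₁ ↾ T = M₂ ↾ T
  ground_eq : M.E = M₁.E ∪ M₂.E
  isFlat_iff : ∀ X ⊆ M.E, M.IsFlat X ↔ M₁.IsFlat (X ∩ M₁.E) ∧ M₂.IsFlat (X ∩ M₂.E)

/-- The matroids that can be built from projective geometries over `F` by repeated generalized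
parallel connections across projective geometries over `F`. -/
inductive IsBuilt {α : Type*} (F : Type*) [Field F] : Matroid α → Prop
  | projective (M : Matroid α) (n : ℕ) (hM : M.IsProjectiveGeometry F n) : IsBuilt F M
  | glue (M M₁ M₂ : Matroid α) (T : Set α) (n : ℕ) (h₁ : IsBuilt F M₁) (h₂ : IsBuilt F M₂)
      (hT : (M₁ ↾ T).IsProjectiveGeometry F n) (hM : M.IsGenParallelConnection M₁ M₂ T) :
      IsBuilt F M

/-- The class `M_q` of `F`-chordal matroids: the `F`-representable matroids that can be built from
projective geometries over `F` by generalized parallel connections across projective geometries.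
(Such matroids are automatically simple.) -/
def IsChordal {α : Type*} (F : Type*) [Field F] (M : Matroid α) : Prop :=
  M.IsRepresentable F ∧ M.IsBuilt F

/-- `N` is a simplification of `M`: a simple restriction of `M` that meets every parallel class. -/
def IsSimplification {α : Type*} (N M : Matroid α) : Prop :=
  ∃ S ⊆ M.E, N = M ↾ S ∧ N.IsSimple ∧
    ∀ e, M.IsNonloop e → ∃ s ∈ S, M.closure {s} = M.closure {e}

/-- `M.HasInducedMinor N`: `N` is obtained from `M` by a sequence of restrictions to flats and contractions, each
contraction being followed by a simplification. -/
inductive HasInducedMinor {α : Type*} (M : Matroid α) : Matroid α → Prop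
  | refl : HasInducedMinor M M
  | restrict (N : Matroid α) (X : Set α) (hN : HasInducedMinor M N) (hX : N.IsFlat X) :
      HasInducedMinor M (N ↾ X)
  | contract (N N' : Matroid α) (C : Set α) (hN : HasInducedMinor M N) (hC : C ⊆ N.E)
      (hN' : N'.IsSimplification (N ／ C)) : HasInducedMinor M N'

/-- `M` is not `F`-chordal, but every proper induced minor of `M` is. -/
def IsMinimalNonChordal {α : Type*} (F : Type*) [Field F] (M : Matroid α) : Prop :=
  ¬ M.IsChordal F ∧ ∀ N, M.HasInducedMinor N → N ≠ M → N.IsChordal F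

/-- `M` is (a copy of) a member of `{U_{2,k} : 2 < k ≤ q} ∪ {U_{3,q+2}}`. -/
def IsObstruction {α : Type*} (q : ℕ) (M : Matroid α) : Prop :=
  (∃ k, 2 < k ∧ k ≤ q ∧ M.IsUniform 2 k) ∨ M.IsUniform 3 (q + 2)

end Matroid

/-! Fix a representation over `F` and replace the matroid by its cone, the set `S` of all multiples
of the representing vectors. Restricting to a flat intersects `S` with a subspace. Contracting and
simplifying replaces `S` by its image under a linear map whose kernel is spanned by vectors of `S`.
Excluding `U_{2,k}` for `2 < k ≤ q` thus says that, modulo every subspace spanned by `S`, a line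
with three points is full. A plane with a four-element circuit and no three collinear points would
be some `U_{3,n+1}`; contracting a point gives `U_{2,n}` with `3 ≤ n ≤ q+1`, so only `n = q+1` is
left once short lines are excluded, and this is ruled out by excluding `U_{3,q+2}`. `IsChordalCone`
records the two resulting conditions.

The heart is `exists_separation`, an analogue of Dirac's theorem that minimal separators of a
chordal graph are cliques. Call two points nonadjacent if their line has no third point. Choose a
separation of `S` whose separator `U` is spanned by `S` and minimal. If `U` is not contained in `S`,
it contains nonadjacent `c` and `d`, and a contraction reduces `U` to these two points
(`exists_two_point_quotient`). Minimality forces each side to link `c` and `d`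
(`linked_or_separated`). Contract one side until `c` and `d` have a common neighbour `x` but are
still nonadjacent, and the other side until they become adjacent. The triangle `c`, `d`, `x` now has
full sides, which forces an inner point; that point can only come from the side of `x`, where it
makes `c` and `d` adjacent, a contradiction (`false_of_connected_sides`). The arguments inside
triangles need a scalar avoiding two values, hence `q > 2`. Induction on the number of elements then
builds the matroid from projective geometries (`Represents.isBuilt`).

Conversely, a projective geometry fills its span in every representation, by counting. The two parts
of a represented generalized parallel connection span subspaces meeting exactly in the common
geometry (`inf_span_le`), and chordal cones amalgamate along a common subspace
(`IsChordalCone.union`). Hence matroids in the class have chordal cones, chordality passes to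
induced minors, and no obstruction has a chordal cone. Minimality of the obstructions follows from
the short list of induced minors of `U_{2,k}` and `U_{3,q+2}`; the parity condition for `U_{3,q+2}`
is the classical existence criterion for hyperovals. -/

namespace ConeGeometry

open Submodule

/-! ### Chordal cones and subspaces spanned by them -/

section

variable {F V : Type*} [Field F] [AddCommGroup V] [Module F V]

/-- `W` is spanned by vectors of `S`. -/
def Spanned (S : Set V) (W : Submodule F V) : Prop := W ≤ span F (S ∩ W)

/-- `a` and `b` are linearly independent modulo `W`. -/
def IndepMod (W : Submodule F V) (a b : V) : Prop :=
  ∀ r s : F, r • a + s • b ∈ W → r = 0 ∧ s = 0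

/-- `a`, `b`, `c` are linearly independent modulo `W`. -/
def IndepModThree (W : Submodule F V) (a b c : V) : Prop :=
  ∀ r s t : F, r • a + s • b + t • c ∈ W → r = 0 ∧ s = 0 ∧ t = 0

/-- A set of vectors closed under scaling is a chordal cone if, modulo each subspace that it spans,
a line with three points is full and a plane with a four-element circuit has three collinear
points. -/
structure IsChordalCone (F : Type*) {V : Type*} [Field F] [AddCommGroup V] [Module F V]
    (S : Set V) : Prop where
  zero_mem : (0 : V) ∈ S
  smul_mem : ∀ (t : F), ∀ x ∈ S, t • x ∈ S
  line : ∀ W : Submodule F V, Spanned S W → ∀ a ∈ S, ∀ b ∈ S, ∀ c ∈ S, a + b - c ∈ W →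
    ∀ t : F, ∃ d ∈ S, a + t • b - d ∈ W
  plane : ∀ W : Submodule F V, Spanned S W → ∀ a ∈ S, ∀ b ∈ S, ∀ c ∈ S, ∀ d ∈ S,
    a + b + c - d ∈ W → IndepModThree W a b c →
    ∃ x ∈ S, ∃ y ∈ S, ∃ z ∈ S, (∃ r s t : F, x - (r • a + s • b + t • c) ∈ W) ∧
      (∃ r s t : F, y - (r • a + s • b + t • c) ∈ W) ∧ x + y - z ∈ W ∧ IndepMod W x y

/-- The line through `a` and `b` has no point of `S` besides `a` and `b`. -/
def Nonadj (F : Type*) {V : Type*} [Field F] [AddCommGroup V] [Module F V]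
    (S : Set V) (a b : V) : Prop := ∀ t : F, t ≠ 0 → a + t • b ∉ S

/-- The line through `a` and `b` is contained in `S`. -/
def FullLine (F : Type*) {V : Type*} [Field F] [AddCommGroup V] [Module F V]
    (S : Set V) (a b : V) : Prop := ∀ r s : F, r • a + s • b ∈ S

lemma IndepMod.symm {W : Submodule F V} {a b : V} (h : IndepMod W a b) : IndepMod W b a :=
  fun r s hrs => (h s r (by rwa [add_comm])).symm

lemma IndepMod.comap_iff {W : Submodule F V} {f : V →ₗ[F] V} {a b : V} :
    IndepMod (W.comap f) a b ↔ IndepMod W (f a) (f b) := by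
  simp [IndepMod]

lemma IndepMod.ker_iff {f : V →ₗ[F] V} {a b : V} :
    IndepMod (LinearMap.ker f) a b ↔ IndepMod (⊥ : Submodule F V) (f a) (f b) := by
  simp [IndepMod]

lemma spanned_bot (S : Set V) : Spanned S (⊥ : Submodule F V) := by simp [Spanned]

lemma Spanned.mono {S S' : Set V} {W : Submodule F V} (h : Spanned S W) (hS : S ⊆ S') :
    Spanned S' W := h.trans (span_mono (Set.inter_subset_inter_left _ hS))

lemma Spanned.le {S : Set V} {W U : Submodule F V} (h : Spanned S W) (hS : S ⊆ U) : W ≤ U :=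
  h.trans (span_le.2 (Set.inter_subset_left.trans hS))

lemma spanned_span {S C : Set V} (h : C ⊆ S) : Spanned S (span F C) :=
  span_mono fun _ hx => ⟨h hx, subset_span hx⟩

lemma spanned_singleton {S : Set V} {x : V} (h : x ∈ S) : Spanned S (span F {x}) :=
  spanned_span (by simpa)

lemma Spanned.sup {S : Set V} {W W' : Submodule F V} (h : Spanned S W) (h' : Spanned S W') :
    Spanned S (W ⊔ W') :=
  sup_le (h.trans (span_mono fun _ hx => ⟨hx.1, le_sup_left (a := W) (b := W') hx.2⟩))
    (h'.trans (span_mono fun _ hx => ⟨hx.1, le_sup_right (a := W) (b := W') hx.2⟩))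

/-- Lift a spanning combination of `f x` to `S`. The error lies in the kernel, which is itself
spanned by `S` and contained in `W.comap f`. This is why conditions modulo all spanned subspaces
survive iterated contraction. -/
lemma mem_span_of_map_mem {S : Set V} {f : V →ₗ[F] V} (hf : Spanned S (LinearMap.ker f))
    {W : Submodule F V} (hW : Spanned (f '' S) W) {x : V} (hx : f x ∈ W) :
    x ∈ span F (S ∩ W.comap f) := by
  have h1 : f x ∈ (span F (S ∩ W.comap f)).map f := by
    rw [map_span]
    refine span_mono ?_ (hW hx)
    rintro _ ⟨⟨y, hy, rfl⟩, hyW⟩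
    exact ⟨y, ⟨hy, hyW⟩, rfl⟩
  obtain ⟨y, hy, hyx⟩ := h1
  have h2 : x - y ∈ span F (S ∩ W.comap f) := by
    refine span_mono ?_ (hf (x := x - y) (by simp [hyx]))
    rintro z ⟨hz, hz'⟩
    refine ⟨hz, ?_⟩
    have : f z = 0 := hz'
    simp [this]
  simpa using add_mem h2 hy

lemma Spanned.comap {S : Set V} {f : V →ₗ[F] V} (hf : Spanned S (LinearMap.ker f))
    {W : Submodule F V} (hW : Spanned (f '' S) W) : Spanned S (W.comap f) :=
  fun _ hx => mem_span_of_map_mem hf hW hx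

lemma Spanned.ker_comp {S : Set V} {f g : V →ₗ[F] V} (hf : Spanned S (LinearMap.ker f))
    (hg : Spanned (f '' S) (LinearMap.ker g)) : Spanned S (LinearMap.ker (g ∘ₗ f)) := by
  rw [LinearMap.ker_comp]; exact hf.comap hg

/-- Contractions are realised by endomorphisms of `V` instead of quotient maps, so that the ambient
space stays fixed in every induction. -/
lemma exists_ker_eq (W : Submodule F V) : ∃ f : V →ₗ[F] V, LinearMap.ker f = W := by
  obtain ⟨q, hq⟩ := Submodule.exists_isCompl W
  exact ⟨_, ker_projection hq.symm⟩

/-! ### Contraction, restriction and common neighbours in a plane -/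

namespace IsChordalCone

variable {S : Set V}

lemma map (h : IsChordalCone F S) {f : V →ₗ[F] V} (hf : Spanned S (LinearMap.ker f)) :
    IsChordalCone F (f '' S) where
  zero_mem := ⟨0, h.zero_mem, map_zero f⟩
  smul_mem := by
    rintro t _ ⟨x, hx, rfl⟩
    exact ⟨t • x, h.smul_mem t x hx, map_smul f t x⟩
  line := by
    rintro W hW _ ⟨a, ha, rfl⟩ _ ⟨b, hb, rfl⟩ _ ⟨c, hc, rfl⟩ habc t
    obtain ⟨d, hd, hd'⟩ := h.line _ (hf.comap hW) a ha b hb c hc (by simpa using habc) t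
    exact ⟨f d, ⟨d, hd, rfl⟩, by simpa using hd'⟩
  plane := by
    rintro W hW _ ⟨a, ha, rfl⟩ _ ⟨b, hb, rfl⟩ _ ⟨c, hc, rfl⟩ _ ⟨d, hd, rfl⟩ habc hI
    obtain ⟨x, hx, y, hy, z, hz, ⟨r, s, t, h1⟩, ⟨r', s', t', h2⟩, h3, h4⟩ :=
      h.plane _ (hf.comap hW) a ha b hb c hc d hd (by simpa using habc)
        (fun r s t hrst => hI r s t (by simpa using hrst))
    refine ⟨f x, ⟨x, hx, rfl⟩, f y, ⟨y, hy, rfl⟩, f z, ⟨z, hz, rfl⟩, ⟨r, s, t, ?_⟩,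
      ⟨r', s', t', ?_⟩, ?_, IndepMod.comap_iff.1 h4⟩
    · simpa using h1
    · simpa using h2
    · simpa using h3

/-- A subspace spanned by `S ∩ U` lies in `U`, and the points supplied by the conditions for `S`
agree modulo it with elements of `U`, so they lie in `U` themselves. -/
lemma inter (h : IsChordalCone F S) (U : Submodule F V) : IsChordalCone F (S ∩ U) where
  zero_mem := ⟨h.zero_mem, U.zero_mem⟩
  smul_mem t x hx := ⟨h.smul_mem t x hx.1, U.smul_mem t hx.2⟩
  line := by
    rintro W hW a ha b hb c hc habc t
    have hWU : W ≤ U := hW.le Set.inter_subset_right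
    obtain ⟨d, hd, hd'⟩ := h.line W (hW.mono Set.inter_subset_left) a ha.1 b hb.1 c hc.1 habc t
    refine ⟨d, ⟨hd, ?_⟩, hd'⟩
    have := U.sub_mem (U.add_mem ha.2 (U.smul_mem t hb.2)) (hWU hd')
    simpa using this
  plane := by
    rintro W hW a ha b hb c hc d hd habc hI
    have hWU : W ≤ U := hW.le Set.inter_subset_right
    have key : ∀ x, (∃ r s t : F, x - (r • a + s • b + t • c) ∈ W) → x ∈ U := by
      rintro x ⟨r, s, t, hx⟩
      have := U.add_mem (hWU hx) (U.add_mem (U.add_mem (U.smul_mem r ha.2) (U.smul_mem s hb.2))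
        (U.smul_mem t hc.2))
      simpa using this
    obtain ⟨x, hx, y, hy, z, hz, h1, h2, h3, h4⟩ := h.plane W (hW.mono Set.inter_subset_left)
      a ha.1 b hb.1 c hc.1 d hd.1 habc hI
    refine ⟨x, ⟨hx, key x h1⟩, y, ⟨hy, key y h2⟩, z, ⟨hz, ?_⟩, h1, h2, h3, h4⟩
    have := U.sub_mem (U.add_mem (key x h1) (key y h2)) (hWU h3)
    simpa using this

lemma of_submodule (U : Submodule F V) : IsChordalCone F (U : Set V) where
  zero_mem := U.zero_mem
  smul_mem t _ hx := U.smul_mem t hx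
  line W _ a ha b hb _ _ _ t := ⟨a + t • b, U.add_mem ha (U.smul_mem t hb), by simp⟩
  plane W _ a ha b hb c hc _ _ _ hI := by
    refine ⟨a, ha, b, hb, a + b, U.add_mem ha hb, ⟨1, 0, 0, by simp⟩, ⟨0, 1, 0, by simp⟩,
      by simp, fun r s hrs => ?_⟩
    have := hI r s 0 (by simpa using hrs)
    exact ⟨this.1, this.2.1⟩

lemma fullLine (h : IsChordalCone F S) {a b : V} (ha : a ∈ S) (hb : b ∈ S) {r s : F}
    (hr : r ≠ 0) (hs : s ≠ 0) (hab : r • a + s • b ∈ S) : FullLine F S a b := by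
  intro r' s'
  obtain rfl | hr' := eq_or_ne r' 0
  · simpa using h.smul_mem s' b hb
  -- The parameter makes the new point equal to `(r * r'⁻¹) • (r' • a + s' • b)`.
  obtain ⟨d, hd, hd'⟩ := h.line ⊥ (spanned_bot S) (r • a) (h.smul_mem r a ha) (s • b)
    (h.smul_mem s b hb) _ hab (by simp) (r * r'⁻¹ * s' * s⁻¹)
  rw [mem_bot, sub_eq_zero] at hd'
  rw [← hd'] at hd
  have := h.smul_mem (r' * r⁻¹) _ hd
  convert this using 1
  match_scalars <;> field_simp

lemma not_nonadj (h : IsChordalCone F S) {a b : V} (ha : a ∈ S) (hb : b ∈ S)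
    (hab : ¬ Nonadj F S a b) : FullLine F S a b := by
  simp only [Nonadj, not_forall, not_not] at hab
  obtain ⟨t, ht, hab⟩ := hab
  exact h.fullLine ha hb one_ne_zero ht (by simpa using hab)

lemma nonadj_apply (h : IsChordalCone F S) {a b : V} (hab : Nonadj F S a b) {r s : F}
    (hm : r • a + s • b ∈ S) : r = 0 ∨ s = 0 := by
  by_contra! hc
  refine hab (r⁻¹ * s) (mul_ne_zero (inv_ne_zero hc.1) hc.2) ?_
  have := h.smul_mem r⁻¹ _ hm
  rwa [smul_add, smul_smul, smul_smul, inv_mul_cancel₀ hc.1, one_smul] at this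

/-- If two sides of a triangle are full and there is a point off them in its plane, then the third
side has a third point. -/
lemma exists_mem_third_side (h : IsChordalCone F S) (hF : ∀ t : F, ∃ u : F, u ≠ 0 ∧ u ≠ t)
    {a b x : V} (hax : FullLine F S a x) (hbx : FullLine F S b x) {r s : F} (hr : r ≠ 0)
    (hs : s ≠ 0) (hm : a + r • b + s • x ∈ S) : ¬ Nonadj F S a b := by
  -- The given point lies on the line joining `(r - u) • b + s • x` to `((u - r) / u) • a + s • x`,
  -- which are points of the two full sides. That line is therefore full, and its combination
  -- without `x` is `a + u • b`. Both `u ≠ 0` and `u ≠ r` are needed, hence more than two scalars.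
  obtain ⟨u, hu0, hur⟩ := hF r
  have h1 : r - u ≠ 0 := sub_ne_zero.2 (Ne.symm hur)
  have h1' : u - r ≠ 0 := sub_ne_zero.2 hur
  have h2 := h.fullLine (hbx (r - u) s) (hax ((u - r) / u) s) (r := r / (r - u))
    (s := u / (u - r)) (div_ne_zero hr h1) (div_ne_zero hu0 h1') (by
      convert hm using 1
      match_scalars
      · field_simp
      · field_simp
        rw [← neg_sub r u]; field_simp; ring
      · field_simp)
  have h3 := h2 (r / (r - u) - 1) (u / (u - r))
  intro hab
  refine hab u hu0 ?_
  convert h3 using 1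
  match_scalars
  · field_simp
  · field_simp; ring
  · field_simp
    rw [← neg_sub r u]; field_simp; ring

/-- A full line from `a` meets the line of `b` and `e` in `e + u • b`. If `u ≠ 0`, this point is the
neighbour, since its line with `b` also contains `e`. If `u = 0`, take `a + t • e`, whose line with
`b` contains the point `a + s • b + t • e`. -/
lemma exists_common_neighbour_of_fullLine (h : IsChordalCone F S) {a b e : V}
    (hb : b ∈ S) (he : e ∈ S) (hI : IndepModThree (⊥ : Submodule F V) a b e)
    {s t : F} (hs : s ≠ 0) (ht : t ≠ 0) (hm : a + s • b + t • e ∈ S) {u : F}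
    (hz : FullLine F S a (e + u • b)) :
    ∃ x ∈ S, IndepModThree (⊥ : Submodule F V) a b x ∧ FullLine F S a x ∧ FullLine F S b x := by
  obtain rfl | hu := eq_or_ne u 0
  · have hx : a + t • e ∈ S := by simpa using hz 1 t
    refine ⟨a + t • e, hx, ?_, fun r v => ?_, ?_⟩
    · intro r v w hrvw
      obtain ⟨h1, h2, h3⟩ := hI (r + w) v (w * t) (by
        convert hrvw using 1; module)
      have : w = 0 := by simpa [ht] using h3
      exact ⟨by simpa [this] using h1, h2, this⟩
    · convert hz (r + v) (v * t) using 1; module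
    · refine h.fullLine hb hx hs one_ne_zero ?_
      convert hm using 1; module
  · have hx : e + u • b ∈ S := by simpa using hz 0 1
    refine ⟨e + u • b, hx, ?_, hz, ?_⟩
    · intro r v w hrvw
      obtain ⟨h1, h2, h3⟩ := hI r (v + w * u) w (by
        convert hrvw using 1; module)
      exact ⟨h1, by simpa [h3] using h2, h3⟩
    · refine h.fullLine hb hx (r := -u) (s := 1) (neg_ne_zero.2 hu) one_ne_zero ?_
      convert he using 1; module

/-- Since `a` and `b` are nonadjacent, the point `y` on their line is a multiple of one of them. So
the full line `xy` passes through `a` or `b`, and the previous lemma applies, with the roles of `a`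
and `b` exchanged in the second case. -/
lemma exists_common_neighbour_aux (h : IsChordalCone F S) {a b e x y : V}
    (ha : a ∈ S) (hb : b ∈ S) (he : e ∈ S) (hI : IndepModThree (⊥ : Submodule F V) a b e)
    (hab : Nonadj F S a b)
    {s t : F} (hs : s ≠ 0) (ht : t ≠ 0) (hm : a + s • b + t • e ∈ S) (hxy : FullLine F S x y)
    {r₁ s₁ t₁ r₂ s₂ : F} (hx : x = r₁ • a + s₁ • b + t₁ • e) (ht₁ : t₁ ≠ 0)
    (hy : y = r₂ • a + s₂ • b) (hy0 : y ≠ 0) :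
    ∃ x ∈ S, IndepModThree (⊥ : Submodule F V) a b x ∧ FullLine F S a x ∧ FullLine F S b x := by
  have hyS : r₂ • a + s₂ • b ∈ S := by simpa [hy] using hxy 0 1
  obtain h0 | h0 := h.nonadj_apply hab hyS
  · have hs₂ : s₂ ≠ 0 := by rintro rfl; simp [hy, h0] at hy0
    obtain ⟨z, hz, hz1, hz2, hz3⟩ := h.exists_common_neighbour_of_fullLine (a := b) (b := a) (e := e)
      (s := s⁻¹) (t := s⁻¹ * t) (u := r₁ / t₁) ha he
      (fun r s t hrst => by
        have := hI s r t (by convert hrst using 1; module)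
        tauto) (inv_ne_zero hs) (mul_ne_zero (inv_ne_zero hs) ht) (by
        convert h.smul_mem s⁻¹ _ hm using 1
        match_scalars <;> field_simp) (fun r v => by
        convert hxy (v / t₁) ((r - v * s₁ / t₁) / s₂) using 1
        rw [hx, hy, h0]
        match_scalars <;> field_simp <;> ring)
    refine ⟨z, hz, fun r s t hrst => ?_, hz3, hz2⟩
    have := hz1 s r t (by convert hrst using 1; module)
    tauto
  · have hr₂ : r₂ ≠ 0 := by rintro rfl; simp [hy, h0] at hy0
    refine h.exists_common_neighbour_of_fullLine hb he hI hs ht hm (u := s₁ / t₁) (fun r v => ?_)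
    convert hxy (v / t₁) ((r - v * r₁ / t₁) / r₂) using 1
    rw [hx, hy, h0]
    match_scalars <;> field_simp <;> ring

/-- If `a` and `b` are nonadjacent but become adjacent when `e` is contracted, then they have a
common neighbour in the plane spanned by `a`, `b` and `e`. -/
lemma exists_common_neighbour (h : IsChordalCone F S) {a b e : V}
    (ha : a ∈ S) (hb : b ∈ S) (he : e ∈ S) (hI : IndepModThree (⊥ : Submodule F V) a b e)
    (hab : Nonadj F S a b) {s t : F} (hs : s ≠ 0) (hm : a + s • b + t • e ∈ S) :
    ∃ x ∈ S, IndepModThree (⊥ : Submodule F V) a b x ∧ FullLine F S a x ∧ FullLine F S b x := by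
  have ht : t ≠ 0 := by rintro rfl; exact hab s hs (by simpa using hm)
  obtain ⟨x, hx, y, hy, z, hz, ⟨r₁, s₁, t₁, h1⟩, ⟨r₂, s₂, t₂, h2⟩, h3, h4⟩ :=
    h.plane ⊥ (spanned_bot S) a ha (s • b) (h.smul_mem s b hb) (t • e) (h.smul_mem t e he)
      _ hm (by simp) (fun r v w hrvw => by
        have := hI r (v * s) (w * t) (by convert hrvw using 1; module)
        simpa [hs, ht] using this)
  rw [mem_bot, sub_eq_zero] at h1 h2 h3
  have hxy : FullLine F S x y := h.fullLine hx hy one_ne_zero one_ne_zero (by simpa [h3] using hz)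
  have hx0 : x ≠ 0 := fun h0 => one_ne_zero (h4 1 0 (by simp [h0])).1
  have hy0 : y ≠ 0 := fun h0 => one_ne_zero (h4 0 1 (by simp [h0])).2
  by_cases ht₁ : t₁ = 0
  · by_cases ht₂ : t₂ = 0
    · exfalso
      have e1 : x = r₁ • a + (s₁ * s) • b := by rw [h1, ht₁]; module
      have e2 : y = r₂ • a + (s₂ * s) • b := by rw [h2, ht₂]; module
      have n1 := h.nonadj_apply hab (e1 ▸ hx)
      have n2 := h.nonadj_apply hab (e2 ▸ hy)
      have n3 := h.nonadj_apply hab (r := r₁ + r₂) (s := s₁ * s + s₂ * s) (by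
        convert hxy 1 1 using 1; rw [e1, e2]; module)
      have n4 := h4 r₂ (-r₁)
      have n5 := h4 s₂ (-s₁)
      simp only [e1, e2, mem_bot, ne_eq] at hx0 hy0 n4 n5
      simp only [mul_eq_zero, hs, or_false, ← add_mul] at n1 n2 n3
      obtain n1 | n1 := n1 <;> obtain n2 | n2 := n2 <;> simp_all
      · exact n5 (by module)
      · exact n4 (by module)
    -- The second point is where the full line meets the line of `a` and `b`: the `e`-coordinate has
    -- been eliminated.
    · refine h.exists_common_neighbour_aux ha hb he hI hab hs ht hm
        (x := y) (y := x - (t₁ / t₂) • y) (fun r v => ?_) (r₁ := r₂) (s₁ := s₂ * s) (t₁ := t₂ * t)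
        (r₂ := r₁ - (t₁ / t₂) * r₂) (s₂ := (s₁ - (t₁ / t₂) * s₂) * s) (by rw [h2]; module)
        (mul_ne_zero ht₂ ht) ?_ ?_
      · convert hxy v (r - v * (t₁ / t₂)) using 1; module
      · rw [h1, h2]
        match_scalars <;> field_simp <;> ring
      · intro h0
        exact one_ne_zero (h4 1 (-(t₁ / t₂)) (by rw [mem_bot, ← h0]; module)).1
  · refine h.exists_common_neighbour_aux ha hb he hI hab hs ht hm
      (x := x) (y := y - (t₂ / t₁) • x) (fun r v => ?_) (r₁ := r₁) (s₁ := s₁ * s) (t₁ := t₁ * t)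
      (r₂ := r₂ - (t₂ / t₁) * r₁) (s₂ := (s₂ - (t₂ / t₁) * s₁) * s) (by rw [h1]; module)
      (mul_ne_zero ht₁ ht) ?_ ?_
    · convert hxy (r - v * (t₂ / t₁)) v using 1; module
    · rw [h1, h2]
      match_scalars <;> field_simp <;> ring
    · intro h0
      exact one_ne_zero (h4 (-(t₂ / t₁)) 1 (by rw [mem_bot, ← h0]; module)).2

/-- Contracting a common neighbour of two nonadjacent points keeps them nonadjacent. -/
lemma sub_notMem_span_of_common_neighbour (h : IsChordalCone F S)
    (hF : ∀ t : F, ∃ u : F, u ≠ 0 ∧ u ≠ t) {a b x : V} (hab : Nonadj F S a b)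
    (hax : FullLine F S a x) (hbx : FullLine F S b x) {t : F} (ht : t ≠ 0) {y : V} (hy : y ∈ S) :
    a + t • b - y ∉ span F {x} := by
  rw [mem_span_singleton]
  rintro ⟨r, hr⟩
  have hy' : y = a + t • b + (-r) • x := by rw [neg_smul, hr]; abel
  rw [hy'] at hy
  obtain rfl | hr0 := eq_or_ne r 0
  · exact hab t ht (by simpa using hy)
  · exact h.exists_mem_third_side hF hax hbx ht (neg_ne_zero.2 hr0) hy hab

end IsChordalCone

end

/-! ### Contracting to two points, and the two-sided contradiction -/

section

variable {F V : Type*} [Field F] [AddCommGroup V] [Module F V] {S : Set V}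

lemma IndepMod.three {W : Submodule F V} {a b c : V} (h : IndepMod W a b)
    (hc : c ∉ W ⊔ span F {a, b}) : IndepModThree W a b c := by
  intro r s t hm
  obtain rfl | ht := eq_or_ne t 0
  · simpa using h r s (by simpa using hm)
  · refine absurd ?_ hc
    have h1 : r • a + s • b ∈ span F {a, b} := mem_span_pair.2 ⟨r, s, rfl⟩
    have h2 := smul_mem (W ⊔ span F {a, b}) t⁻¹ (sub_mem
      ((le_sup_left : W ≤ W ⊔ span F {a, b}) hm) ((le_sup_right : _ ≤ W ⊔ span F {a, b}) h1))
    convert h2 using 1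
    match_scalars <;> field_simp <;> ring

namespace IsChordalCone

/-- Two nonadjacent points that do not span stay nonadjacent after a suitable contraction. -/
lemma exists_nonadj_contraction (h : IsChordalCone F S)
    (hF : ∀ t : F, ∃ u : F, u ≠ 0 ∧ u ≠ t) {a b e : V} (ha : a ∈ S) (hb : b ∈ S) (he : e ∈ S)
    (hI : IndepModThree (⊥ : Submodule F V) a b e) (hab : Nonadj F S a b) :
    ∃ x ∈ S, IndepModThree (⊥ : Submodule F V) a b x ∧
      ∀ t : F, t ≠ 0 → ∀ y ∈ S, a + t • b - y ∉ span F {x} := by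
  -- Either `e` itself can be contracted, or contracting it makes `a` and `b` adjacent; then they
  -- have a common neighbour, whose contraction is harmless.
  by_cases hx : ∀ t : F, t ≠ 0 → ∀ y ∈ S, a + t • b - y ∉ span F {e}
  · exact ⟨e, he, hI, hx⟩
  push Not at hx
  obtain ⟨t, ht, y, hy, hm⟩ := hx
  obtain ⟨r, hr⟩ := mem_span_singleton.1 hm
  have hy' : y = a + t • b + (-r) • e := by rw [neg_smul, hr]; abel
  obtain ⟨x, hx, hIx, hax, hbx⟩ := h.exists_common_neighbour ha hb he hI hab ht (hy' ▸ hy)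
  exact ⟨x, hx, hIx, fun t ht y hy => h.sub_notMem_span_of_common_neighbour hF hab hax hbx ht hy⟩

/-- Two nonadjacent points are all that is left after contracting a suitable spanned subspace. -/
lemma exists_two_point_quotient [FiniteDimensional F V] (h : IsChordalCone F S)
    (hF : ∀ t : F, ∃ u : F, u ≠ 0 ∧ u ≠ t) {c d : V} (hc : c ∈ S) (hd : d ∈ S)
    (hI : IndepMod (⊥ : Submodule F V) c d) (hcd : Nonadj F S c d) :
    ∃ f : V →ₗ[F] V, Spanned S (LinearMap.ker f) ∧ IndepMod (LinearMap.ker f) c d ∧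
      ∀ s ∈ S, f s ∈ span F {f c} ∨ f s ∈ span F {f d} := by
  -- Take a maximal spanned kernel keeping `c` and `d` distinct and nonadjacent. A point left
  -- outside their line would allow one more contraction.
  obtain ⟨W, ⟨f, rfl, hS, hIf, hn⟩, hmax⟩ := (wellFounded_gt (α := Submodule F V)).has_min
    {W | ∃ f : V →ₗ[F] V, LinearMap.ker f = W ∧ Spanned S W ∧ IndepMod W c d ∧
      Nonadj F (f '' S) (f c) (f d)}
    ⟨⊥, LinearMap.id, by simp [LinearMap.ker_id], spanned_bot S, hI, by simpa using hcd⟩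
  refine ⟨f, hS, hIf, fun s hs => ?_⟩
  have h' := h.map hS
  have hI' := IndepMod.ker_iff.1 hIf
  have hc' : f c ∈ f '' S := ⟨c, hc, rfl⟩
  have hd' : f d ∈ f '' S := ⟨d, hd, rfl⟩
  have hs' : f s ∈ f '' S := ⟨s, hs, rfl⟩
  by_cases hsp : f s ∈ span F {f c, f d}
  · obtain ⟨r, t, hrt⟩ := mem_span_pair.1 hsp
    obtain h0 | h0 := h'.nonadj_apply hn (hrt ▸ hs')
    · exact .inr (mem_span_singleton.2 ⟨t, by simpa [h0] using hrt⟩)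
    · exact .inl (mem_span_singleton.2 ⟨r, by simpa [h0] using hrt⟩)
  exfalso
  obtain ⟨x, hx, hIx, hnx⟩ := h'.exists_nonadj_contraction hF hc' hd' hs'
    (hI'.three (by simpa using hsp)) hn
  obtain ⟨g, hg⟩ := exists_ker_eq (span F {x})
  refine hmax (LinearMap.ker (g ∘ₗ f)) ⟨_, rfl, hS.ker_comp (hg ▸ spanned_singleton hx), ?_, ?_⟩ ?_
  · rw [LinearMap.ker_comp, IndepMod.comap_iff, hg]
    intro r s hm
    obtain ⟨t, ht⟩ := mem_span_singleton.1 hm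
    have := hIx r s (-t) (by rw [mem_bot, ← ht]; module)
    exact ⟨this.1, this.2.1⟩
  · rintro t ht ⟨y, hy, hyt⟩
    refine hnx t ht (f y) ⟨y, hy, rfl⟩ ?_
    rw [← hg, LinearMap.mem_ker]
    simpa [sub_eq_zero] using hyt.symm
  · rw [LinearMap.ker_comp, SetLike.lt_iff_le_and_exists]
    obtain ⟨y, hy, rfl⟩ := hx
    refine ⟨fun z hz => ?_, y, ?_, fun hy0 => ?_⟩
    · have : f z = 0 := hz
      simp [this]
    · rw [mem_comap, hg]; exact mem_span_singleton_self _
    · have : f y = 0 := hy0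
      exact one_ne_zero (hIx 0 0 1 (by simp [this])).2.2

/-- If nonadjacent points become adjacent modulo `W`, then along the way they acquire a common
neighbour. -/
lemma exists_common_neighbour_quotient [FiniteDimensional F V] (h : IsChordalCone F S) {c d : V}
    (hc : c ∈ S) (hd : d ∈ S) (hcd : Nonadj F S c d) {W : Submodule F V} (hW : Spanned S W)
    (hI : IndepMod W c d) {r t : F} (hr : r ≠ 0) (ht : t ≠ 0) {s : V} (hs : s ∈ S)
    (hm : r • c + t • d - s ∈ W) :
    ∃ g : V →ₗ[F] V, Spanned S (LinearMap.ker g) ∧ LinearMap.ker g ≤ W ∧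
      Nonadj F (g '' S) (g c) (g d) ∧ ∃ x ∈ S, IndepModThree (LinearMap.ker g) c d x ∧
      FullLine F (g '' S) (g c) (g x) ∧ FullLine F (g '' S) (g d) (g x) := by
  -- Contract as much of `W` as possible while `c` and `d` stay nonadjacent. Not all of `W` can be
  -- contracted, and by maximality the next element `e` makes them adjacent, which yields a common
  -- neighbour.
  obtain ⟨W', ⟨g, rfl, hS, hle, hn⟩, hmax⟩ := (wellFounded_gt (α := Submodule F V)).has_min
    {W' | ∃ f : V →ₗ[F] V, LinearMap.ker f = W' ∧ Spanned S W' ∧ W' ≤ W ∧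
      Nonadj F (f '' S) (f c) (f d)}
    ⟨⊥, LinearMap.id, by simp [LinearMap.ker_id], spanned_bot S, bot_le, by simpa using hcd⟩
  have h' := h.map hS
  have hc' : g c ∈ g '' S := ⟨c, hc, rfl⟩
  have hd' : g d ∈ g '' S := ⟨d, hd, rfl⟩
  have hne : ¬ W ≤ LinearMap.ker g := by
    intro hle'
    have h1 : r • g c + t • g d ∈ g '' S := by
      have := hle' hm
      rw [LinearMap.mem_ker, map_sub, sub_eq_zero] at this
      exact ⟨s, hs, by simpa using this.symm⟩
    obtain h0 | h0 := h'.nonadj_apply hn h1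
    · exact hr h0
    · exact ht h0
  obtain ⟨e, ⟨he, heW⟩, heg⟩ : ∃ e ∈ S ∩ W, e ∉ LinearMap.ker g := by
    by_contra! hcon
    exact hne (hW.trans (span_le.2 hcon))
  have he' : g e ∈ g '' S := ⟨e, he, rfl⟩
  have hI3 : IndepModThree (⊥ : Submodule F V) (g c) (g d) (g e) := by
    intro r s t hm
    have h1 : r • c + s • d + t • e ∈ LinearMap.ker g := by simpa using hm
    have h2 := sub_mem (hle h1) (W.smul_mem t heW)
    obtain ⟨rfl, rfl⟩ := hI r s (by simpa using h2)
    refine ⟨rfl, rfl, ?_⟩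
    by_contra ht
    exact heg (by simpa [ht] using h1)
  have hadj : ∃ u : F, u ≠ 0 ∧ ∃ y ∈ g '' S, g c + u • g d - y ∈ span F {g e} := by
    by_contra! hcon
    obtain ⟨k, hk⟩ := exists_ker_eq (span F {g e})
    refine hmax (LinearMap.ker (k ∘ₗ g)) ⟨_, rfl, hS.ker_comp (hk ▸ spanned_singleton he'), ?_, ?_⟩
      ?_
    · rw [LinearMap.ker_comp, hk]
      intro z hz
      obtain ⟨t, ht⟩ := mem_span_singleton.1 (mem_comap.1 hz)
      have h1 : z - t • e ∈ LinearMap.ker g := by simp [ht]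
      simpa using W.add_mem (hle h1) (W.smul_mem t heW)
    · rintro t ht ⟨y, hy, hyt⟩
      refine hcon t ht (g y) ⟨y, hy, rfl⟩ ?_
      rw [← hk, LinearMap.mem_ker]
      simpa [sub_eq_zero] using hyt.symm
    · rw [LinearMap.ker_comp, SetLike.lt_iff_le_and_exists]
      refine ⟨fun z hz => ?_, e, ?_, heg⟩
      · have : g z = 0 := hz
        simp [this]
      · rw [mem_comap, hk]; exact mem_span_singleton_self _
  obtain ⟨u, hu, y, hy, hm⟩ := hadj
  obtain ⟨v, hv⟩ := mem_span_singleton.1 hm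
  have hy' : y = g c + u • g d + (-v) • g e := by rw [neg_smul, hv]; abel
  obtain ⟨_, ⟨x, hx, rfl⟩, hIx, hax, hbx⟩ :=
    h'.exists_common_neighbour hc' hd' he' hI3 hn hu (hy' ▸ hy)
  exact ⟨g, hS, hle, hn, x, hx, fun r s t hm => hIx r s t (by simpa using hm), hax, hbx⟩

/-- Two points spanning the intersection of a separation cannot be nonadjacent when both sides
connect them. -/
lemma false_of_connected_sides [FiniteDimensional F V] (h : IsChordalCone F S)
    (hF : ∀ t : F, ∃ u : F, u ≠ 0 ∧ u ≠ t) {V₁ V₂ : Submodule F V} (hS : S ⊆ V₁ ∪ V₂) {c d : V}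
    (hc : c ∈ S) (hd : d ∈ S) (hV : V₁ ⊓ V₂ = span F {c, d}) (hcd : Nonadj F S c d)
    {W₁ W₂ : Submodule F V} (hW₁ : Spanned (S ∩ V₁) W₁) (hW₂ : Spanned (S ∩ V₂) W₂)
    (hI₁ : IndepMod W₁ c d) (hI₂ : IndepMod W₂ c d) {r₁ t₁ r₂ t₂ : F} (hr₁ : r₁ ≠ 0)
    (ht₁ : t₁ ≠ 0) (hr₂ : r₂ ≠ 0) (ht₂ : t₂ ≠ 0) {s₁ s₂ : V} (hs₁ : s₁ ∈ S ∩ V₁)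
    (hs₂ : s₂ ∈ S ∩ V₂) (hm₁ : r₁ • c + t₁ • d - s₁ ∈ W₁) (hm₂ : r₂ • c + t₂ • d - s₂ ∈ W₂) :
    False := by
  have hcV : c ∈ V₁ ⊓ V₂ := hV ▸ subset_span (by simp)
  have hdV : d ∈ V₁ ⊓ V₂ := hV ▸ subset_span (by simp)
  have h2 := h.inter V₂
  obtain ⟨g, hgS, hgW, hgn, x, ⟨hxS, hxV⟩, hIx, hcx, hdx⟩ := h2.exists_common_neighbour_quotient
    ⟨hc, hcV.2⟩ ⟨hd, hdV.2⟩ (fun t ht hm => hcd t ht hm.1) hW₂ hI₂ hr₂ ht₂ hs₂ hm₂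
  have hLV : LinearMap.ker g ≤ V₂ := hgS.le Set.inter_subset_right
  have hWV : W₁ ≤ V₁ := hW₁.le Set.inter_subset_right
  -- Contracting `W₁` changes nothing more on the second side: `W₁` meets `V₂` inside the span of
  -- `c` and `d`, where it is trivial.
  have key : ∀ y ∈ V₂, y ∈ W₁ ⊔ LinearMap.ker g → y ∈ LinearMap.ker g := by
    intro y hy hyW
    obtain ⟨w, hw, l, hl, rfl⟩ := mem_sup.1 hyW
    have hw2 : w ∈ V₁ ⊓ V₂ := ⟨hWV hw, by simpa using sub_mem hy (hLV hl)⟩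
    rw [hV] at hw2
    obtain ⟨r, s, rfl⟩ := mem_span_pair.1 hw2
    obtain ⟨rfl, rfl⟩ := hI₁ r s hw
    simpa using hl
  obtain ⟨k, hk⟩ := exists_ker_eq (W₁ ⊔ LinearMap.ker g)
  have hkeq : ∀ a b, a - b ∈ W₁ ⊔ LinearMap.ker g → k a = k b := by
    intro a b hab
    rw [← hk, LinearMap.mem_ker, map_sub, sub_eq_zero] at hab
    exact hab
  have hkS : Spanned S (LinearMap.ker k) := hk ▸
    (hW₁.mono Set.inter_subset_left).sup (hgS.mono Set.inter_subset_left)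
  have hfull : ∀ a, FullLine F (g '' (S ∩ V₂)) (g a) (g x) → FullLine F (k '' S) (k a) (k x) := by
    intro a ha r s
    obtain ⟨y, hy, hyg⟩ := ha r s
    refine ⟨y, hy.1, ?_⟩
    rw [hkeq y (r • a + s • x)]
    · simp
    · exact mem_sup_right (by simp [hyg])
  have hkc := hfull c hcx
  have hkd := hfull d hdx
  have h' := h.map hkS
  have hkcd : FullLine F (k '' S) (k c) (k d) := by
    refine h'.fullLine ⟨c, hc, rfl⟩ ⟨d, hd, rfl⟩ hr₁ ht₁ ⟨s₁, hs₁.1, ?_⟩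
    rw [← hkeq _ _ (mem_sup_left hm₁)]
    simp
  obtain ⟨u, hu0, hu1⟩ := hF 1
  have hu1' : 1 - u ≠ 0 := sub_ne_zero.2 (Ne.symm hu1)
  -- After contracting both sides the triangle has full sides. The points `k c + k x` and `k d - k
  -- x` have sum `k c + k d` in the cone, so their line is full, and it contains an inner point
  -- because `u` differs from `0` and `1`.
  have h3 : k c + u • k d + (1 - u) • k x ∈ k '' S := by
    have := h'.fullLine (hkc 1 1) (hkd 1 (-1)) one_ne_zero one_ne_zero
      (by convert hkcd 1 1 using 1; module) 1 u
    convert this using 1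
    module
  obtain ⟨s, hs, hsk⟩ := h3
  have hsW : s - (c + u • d + (1 - u) • x) ∈ W₁ ⊔ LinearMap.ker g := by
    rw [← hk, LinearMap.mem_ker]
    simp [hsk]
  -- A preimage in `V₁` would put `x` into the span of `c` and `d` modulo `ker g`. A preimage in
  -- `V₂` gives an inner point already modulo `ker g`, where two sides are full and the third has no
  -- further point.
  obtain hs1 | hs2 := hS hs
  · obtain ⟨w, hw, l, hl, hwl⟩ := mem_sup.1 hsW
    have e1 : s - c - u • d - w = (1 - u) • x + l := by
      rw [eq_sub_iff_add_eq] at hwl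
      rw [← hwl]; module
    have h4 : (1 - u) • x + l ∈ V₁ ⊓ V₂ := by
      refine ⟨?_, add_mem (V₂.smul_mem _ hxV) (hLV hl)⟩
      have := sub_mem (sub_mem (sub_mem hs1 hcV.1) (V₁.smul_mem u hdV.1)) (hWV hw)
      rw [e1] at this
      exact this
    rw [hV] at h4
    obtain ⟨p, q, hpq⟩ := mem_span_pair.1 h4
    refine hu1' (neg_eq_zero.1 (hIx p q (-(1 - u)) ?_).2.2)
    convert hl using 1
    rw [hpq]; module
  · have h4 := key _ (sub_mem hs2 (add_mem (add_mem hcV.2 (V₂.smul_mem u hdV.2))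
      (V₂.smul_mem _ hxV))) hsW
    have h5 : g c + u • g d + (1 - u) • g x ∈ g '' (S ∩ V₂) := by
      refine ⟨s, ⟨hs, hs2⟩, ?_⟩
      rw [LinearMap.mem_ker, map_sub, sub_eq_zero] at h4
      simpa using h4
    exact (h2.map hgS).exists_mem_third_side hF hcx hdx hu0 hu1' h5 hgn

end IsChordalCone

end

/-! ### Connectivity: linked or separated points -/

section

variable {F V : Type*} [Field F] [AddCommGroup V] [Module F V]

lemma finrank_span_image_lt [FiniteDimensional F V] {S : Set V} {e : V} (he : e ∈ S) (he0 : e ≠ 0)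
    {f : V →ₗ[F] V} (hf : f e = 0) :
    Module.finrank F (span F (f '' S)) < Module.finrank F (span F S) := by
  rw [← map_span, ← LinearMap.range_domRestrict]
  have h1 := LinearMap.finrank_range_add_finrank_ker (f.domRestrict (span F S))
  have h2 : 0 < Module.finrank F (LinearMap.ker (f.domRestrict (span F S))) := by
    rw [Module.finrank_pos_iff_exists_ne_zero]
    exact ⟨⟨⟨e, subset_span he⟩, by simpa using hf⟩, by simpa [Subtype.ext_iff] using he0⟩
  omega

lemma finrank_span_inter_lt [FiniteDimensional F V] {S : Set V} {X : Submodule F V} {d : V}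
    (hd : d ∈ S) (hdX : d ∉ X) :
    Module.finrank F (span F (S ∩ X)) < Module.finrank F (span F S) := by
  refine finrank_lt_finrank_of_lt (SetLike.lt_iff_le_and_exists.2
    ⟨span_mono Set.inter_subset_left, d, subset_span hd, fun h => hdX ?_⟩)
  exact (span_le.2 Set.inter_subset_right : span F (S ∩ X) ≤ X) h

/-- `S` is a direct sum with `c` and `d` in different summands. -/
def Separated (F : Type*) {V : Type*} [Field F] [AddCommGroup V] [Module F V]
    (S : Set V) (c d : V) : Prop :=
  ∃ X Y : Submodule F V, S ⊆ X ∪ Y ∧ X ⊓ Y = ⊥ ∧ c ∈ X ∧ d ∈ Y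

lemma Separated.symm {S : Set V} {c d : V} (h : Separated F S c d) : Separated F S d c := by
  obtain ⟨X, Y, h1, h2, h3, h4⟩ := h
  exact ⟨Y, X, by rwa [Set.union_comm], by rwa [inf_comm], h4, h3⟩

/-- The summand of `S ∩ X` containing `e` is moved over to `Y`. The overlap of `X` and `Y` consists
of multiples of `e`, so the summand containing `c` still meets the enlarged `Y` trivially. -/
lemma Separated.of_inter {S : Set V} {X Y : Submodule F V} {c d e : V} (hS : S ⊆ X ∪ Y)
    (hXY : X ⊓ Y ≤ span F {e}) (hc : c ∈ X) (hd : d ∈ Y)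
    (h : Separated F (S ∩ X) c e) : Separated F S c d := by
  obtain ⟨P, Q, h1, h2, h3, h4⟩ := h
  refine ⟨P ⊓ X, (Q ⊓ X) ⊔ Y, fun s hs => ?_, ?_, ⟨h3, hc⟩,
    (le_sup_right : Y ≤ (Q ⊓ X) ⊔ Y) hd⟩
  · obtain hX | hY := hS hs
    · obtain hP | hQ := h1 ⟨hs, hX⟩
      · exact .inl ⟨hP, hX⟩
      · exact .inr ((le_sup_left : _ ≤ (Q ⊓ X) ⊔ Y) ⟨hQ, hX⟩)
    · exact .inr ((le_sup_right : Y ≤ (Q ⊓ X) ⊔ Y) hY)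
  · rw [eq_bot_iff]
    rintro x ⟨⟨hxP, hxX⟩, hx⟩
    obtain ⟨q, ⟨hq, hqX⟩, y, hy, rfl⟩ := mem_sup.1 hx
    have hyX : y ∈ X := by simpa using sub_mem hxX hqX
    obtain ⟨r, rfl⟩ := mem_span_singleton.1 (hXY ⟨hyX, hy⟩)
    rw [← h2]
    exact ⟨hxP, add_mem hq (Q.smul_mem r h4)⟩

/-- `c` and `d` are connected by `S`: after contracting a suitable subspace spanned by `S`, they are
still distinct points and there is a third point on their line. -/
def Linked (F : Type*) {V : Type*} [Field F] [AddCommGroup V] [Module F V]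
    (S : Set V) (c d : V) : Prop :=
  ∃ W : Submodule F V, Spanned S W ∧ IndepMod W c d ∧
    ∃ r t : F, r ≠ 0 ∧ t ≠ 0 ∧ ∃ s ∈ S, r • c + t • d - s ∈ W

/-- Contract both subspaces together with the third point `x` on the line of `c` and `e`. This makes
`e` a nonzero multiple of `c`, so the third point `y` on the line of `d` and `e` becomes one on the
line of `c` and `d`. -/
lemma Linked.trans {S : Set V} {X Y : Submodule F V} {c d e : V}
    (hXY : X ⊓ Y ≤ span F {e}) (hc : c ∈ X) (hd : d ∈ Y)
    (h₁ : Linked F (S ∩ X) c e) (h₂ : Linked F (S ∩ Y) d e) : Linked F S c d := by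
  obtain ⟨W₁, hW₁, hI₁, r₁, t₁, hr₁, ht₁, x, hx, hm₁⟩ := h₁
  obtain ⟨W₂, hW₂, hI₂, r₂, t₂, hr₂, ht₂, y, hy, hm₂⟩ := h₂
  have hWX : W₁ ≤ X := hW₁.le Set.inter_subset_right
  have hWY : W₂ ≤ Y := hW₂.le Set.inter_subset_right
  refine ⟨(W₁ ⊔ W₂) ⊔ span F {x}, ((hW₁.mono Set.inter_subset_left).sup
    (hW₂.mono Set.inter_subset_left)).sup (spanned_singleton hx.1), ?_,
    -(t₂ * r₁ / t₁), r₂, by simp [ht₂, hr₁, ht₁], hr₂, y, hy.1, ?_⟩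
  · intro a b hab
    obtain ⟨w, hw, z, hz, hwz⟩ := mem_sup.1 hab
    obtain ⟨w₁, hw₁, w₂, hw₂, rfl⟩ := mem_sup.1 hw
    obtain ⟨k, rfl⟩ := mem_span_singleton.1 hz
    have e1 : a • c - w₁ - k • x = w₂ - b • d := by
      rw [sub_sub, sub_eq_sub_iff_add_eq_add, ← hwz]; module
    have h3 : w₂ - b • d ∈ X ⊓ Y :=
      ⟨e1 ▸ sub_mem (sub_mem (X.smul_mem a hc) (hWX hw₁)) (X.smul_mem k hx.2),
        sub_mem (hWY hw₂) (Y.smul_mem b hd)⟩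
    obtain ⟨u, hu⟩ := mem_span_singleton.1 (hXY h3)
    obtain ⟨rfl, rfl⟩ := hI₂ b u (by rw [hu]; simpa using hw₂)
    have h4 : (a - k * r₁) • c + (-(k * t₁)) • e ∈ W₁ := by
      have := add_mem hw₁ (W₁.smul_mem (-k) hm₁)
      rw [← hu, zero_smul, sub_sub, sub_eq_zero] at e1
      have e2 : a • c = w₁ + k • x := e1
      convert this using 1
      rw [sub_smul, e2]; module
    obtain ⟨h5, h6⟩ := hI₁ _ _ h4
    have hk : k = 0 := by simpa [ht₁] using h6
    exact ⟨by simpa [hk] using h5, rfl⟩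
  · have h1 : r₂ • d + t₂ • e - y - (t₂ / t₁) • (r₁ • c + t₁ • e - x) ∈ W₁ ⊔ W₂ :=
      sub_mem (mem_sup_right hm₂) (smul_mem _ _ (mem_sup_left hm₁))
    have h2 : (t₂ / t₁) • x ∈ span F {x} := mem_span_singleton.2 ⟨_, rfl⟩
    have := sub_mem ((le_sup_left : _ ≤ (W₁ ⊔ W₂) ⊔ span F {x}) h1)
      ((le_sup_right : _ ≤ (W₁ ⊔ W₂) ⊔ span F {x}) h2)
    convert this using 1
    match_scalars <;> field_simp <;> ring

/-- Induction on rank. Contract a point `e` off the line of `c` and `d`. A link lifts back. A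
separation lifts to two subspaces meeting in the span of `e`, and induction applies to `c`, `e` on
one side and `d`, `e` on the other: two links compose, and one separation extends to all of `S`. -/
lemma linked_or_separated [FiniteDimensional F V] {S : Set V} {c d : V} (hc : c ∈ S) (hd : d ∈ S)
    (hI : IndepMod (⊥ : Submodule F V) c d) : Linked F S c d ∨ Separated F S c d := by
  obtain ⟨n, hn⟩ : ∃ n, Module.finrank F (span F S) = n := ⟨_, rfl⟩
  induction n using Nat.strong_induction_on generalizing S c d with
  | _ n ih =>
  subst hn
  by_cases hS : S ⊆ span F {c, d}
  · by_cases hs : ∃ r t : F, r ≠ 0 ∧ t ≠ 0 ∧ ∃ s ∈ S, r • c + t • d - s ∈ (⊥ : Submodule F V)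
    · exact .inl ⟨⊥, spanned_bot S, hI, hs⟩
    · refine .inr ⟨span F {c}, span F {d}, fun s hsS => ?_, ?_, mem_span_singleton_self c,
        mem_span_singleton_self d⟩
      · obtain ⟨r, t, rfl⟩ := mem_span_pair.1 (hS hsS)
        obtain rfl | hr := eq_or_ne r 0
        · exact .inr (mem_span_singleton.2 ⟨t, by simp⟩)
        obtain rfl | ht := eq_or_ne t 0
        · exact .inl (mem_span_singleton.2 ⟨r, by simp⟩)
        exact absurd ⟨r, t, hr, ht, _, hsS, by simp⟩ hs
      · rw [eq_bot_iff]
        rintro x ⟨h1, h2⟩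
        obtain ⟨r, rfl⟩ := mem_span_singleton.1 h1
        obtain ⟨t, ht⟩ := mem_span_singleton.1 h2
        have := hI r (-t) (by rw [neg_smul, ht]; simp)
        simp [this.1]
  obtain ⟨e, he, hecd⟩ := Set.not_subset.1 hS
  have hI3 : IndepModThree ⊥ c d e := hI.three (by simpa using hecd)
  have he0 : e ≠ 0 := by rintro rfl; exact hecd (zero_mem _)
  obtain ⟨f, hf⟩ := exists_ker_eq (span F {e})
  have hfe : f e = 0 := by rw [← LinearMap.mem_ker, hf]; exact mem_span_singleton_self e
  have hfS : Spanned S (LinearMap.ker f) := hf ▸ spanned_singleton he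
  have hIf : IndepMod (LinearMap.ker f) c d := by
    rw [hf]
    intro r s hrs
    obtain ⟨t, ht⟩ := mem_span_singleton.1 hrs
    have := hI3 r s (-t) (by rw [mem_bot, ← ht]; module)
    exact ⟨this.1, this.2.1⟩
  obtain ⟨W, hW, hIW, r, t, hr, ht, _, ⟨s, hs, rfl⟩, hm⟩ | ⟨X, Y, hXY, hinf, hcX, hdY⟩ :=
    ih _ (finrank_span_image_lt he he0 hfe) (S := f '' S) ⟨c, hc, rfl⟩ ⟨d, hd, rfl⟩
      (IndepMod.ker_iff.1 hIf) rfl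
  · exact .inl ⟨W.comap f, hfS.comap hW, IndepMod.comap_iff.2 hIW, r, t, hr, ht, s, hs,
      by simpa using hm⟩
  have hXY' : S ⊆ (X.comap f : Set V) ∪ Y.comap f := fun s hs => hXY ⟨s, hs, rfl⟩
  have hinf' : X.comap f ⊓ Y.comap f ≤ span F {e} := by
    rw [← comap_inf, hinf, ← hf]; exact le_rfl
  have heX : e ∈ X.comap f := by simp [hfe]
  have heY : e ∈ Y.comap f := by simp [hfe]
  have hce : IndepMod (⊥ : Submodule F V) c e := fun r s hrs => by
    have := hI3 r 0 s (by simpa using hrs); tauto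
  have hde : IndepMod (⊥ : Submodule F V) d e := fun r s hrs => by
    have := hI3 0 r s (by simpa using hrs); tauto
  have hdX : d ∉ X.comap f := fun h => by
    obtain ⟨u, hu⟩ := mem_span_singleton.1 (hinf' ⟨h, hdY⟩)
    exact one_ne_zero (hde 1 (-u) (by simp [hu])).1
  have hcY : c ∉ Y.comap f := fun h => by
    obtain ⟨u, hu⟩ := mem_span_singleton.1 (hinf' ⟨hcX, h⟩)
    exact one_ne_zero (hce 1 (-u) (by simp [hu])).1
  obtain h1 | h1 := ih _ (finrank_span_inter_lt hd hdX) (S := S ∩ X.comap f) ⟨hc, hcX⟩ ⟨he, heX⟩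
    hce rfl
  · obtain h2 | h2 := ih _ (finrank_span_inter_lt hc hcY) (S := S ∩ Y.comap f) ⟨hd, hdY⟩ ⟨he, heY⟩
      hde rfl
    · exact .inl (h1.trans hinf' hcX hdY h2)
    · exact .inr (Separated.of_inter (X := Y.comap f) (Y := X.comap f)
        (by rwa [Set.union_comm]) (by rwa [inf_comm]) hdY hcX
        h2).symm
  · exact .inr (Separated.of_inter hXY' hinf' hcX hdY h1)

/-! ### Minimal separators lie in the cone -/

namespace IsChordalCone

variable {S : Set V}

lemma span_subset (h : IsChordalCone F S) (hS : ∀ a ∈ S, ∀ b ∈ S, a + b ∈ S) :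
    (span F S : Set V) ⊆ S := fun x hx => by
  induction hx using span_induction with
  | mem x hx => exact hx
  | zero => exact h.zero_mem
  | add x y _ _ hx hy => exact hS x hx y hy
  | smul t x _ hx => exact h.smul_mem t x hx

lemma nonadj_of_add_notMem (h : IsChordalCone F S) {a b : V} (ha : a ∈ S) (hb : b ∈ S)
    (hab : a + b ∉ S) : Nonadj F S a b ∧ IndepMod (⊥ : Submodule F V) a b := by
  have hn : Nonadj F S a b := by
    by_contra hc
    exact hab (by simpa using h.not_nonadj ha hb hc 1 1)
  refine ⟨hn, fun r s hrs => ?_⟩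
  rw [mem_bot] at hrs
  by_contra! hc
  by_cases hr : r = 0
  · have hs := hc hr
    refine hab ?_
    have : b = 0 := by simpa [hr, hs] using hrs
    simpa [this] using ha
  · refine hab ?_
    have e1 : a = (-(s / r)) • b := by
      have := congrArg (r⁻¹ • ·) hrs
      simp only [smul_add, smul_smul, inv_mul_cancel₀ hr, one_smul, smul_zero] at this
      rw [eq_neg_of_add_eq_zero_left this]; module
    have : a + b = (1 - s / r) • b := by rw [e1]; module
    rw [this]
    exact h.smul_mem _ b hb

/-- A chordal cone that is not a subspace is a union of two smaller parts whose spans meet inside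
it. -/
theorem exists_separation [FiniteDimensional F V] (h : IsChordalCone F S)
    (hF : ∀ t : F, ∃ u : F, u ≠ 0 ∧ u ≠ t) (hS : ¬ ∀ a ∈ S, ∀ b ∈ S, a + b ∈ S) :
    ∃ V₁ V₂ : Submodule F V, S ⊆ V₁ ∪ V₂ ∧ ¬ S ⊆ V₁ ∧ ¬ S ⊆ V₂ ∧ (↑(V₁ ⊓ V₂) : Set V) ⊆ S := by
  -- Separations exist: contract to two nonadjacent points and pull back their two lines through the
  -- origin.
  have hne : {U : Submodule F V | Spanned S U ∧ ∃ V₁ V₂ : Submodule F V, S ⊆ V₁ ∪ V₂ ∧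
      ¬ S ⊆ V₁ ∧ ¬ S ⊆ V₂ ∧ V₁ ⊓ V₂ = U}.Nonempty := by
    push Not at hS
    obtain ⟨a, ha, b, hb, hab⟩ := hS
    obtain ⟨hn, hI⟩ := h.nonadj_of_add_notMem ha hb hab
    obtain ⟨f, hfS, hIf, hf⟩ := h.exists_two_point_quotient hF ha hb hI hn
    refine ⟨LinearMap.ker f, hfS, (span F {f a}).comap f, (span F {f b}).comap f, hf,
      fun hc => ?_, fun hc => ?_, ?_⟩
    · obtain ⟨r, hr⟩ := mem_span_singleton.1 (mem_comap.1 (hc hb))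
      exact one_ne_zero (hIf (-r) 1 (by simp [hr])).2
    · obtain ⟨r, hr⟩ := mem_span_singleton.1 (mem_comap.1 (hc ha))
      exact one_ne_zero (hIf 1 (-r) (by simp [hr])).1
    · refine le_antisymm ?_ (fun x hx => ?_)
      · rintro x ⟨hx1, hx2⟩
        obtain ⟨r, hr⟩ := mem_span_singleton.1 (mem_comap.1 hx1)
        obtain ⟨t, ht⟩ := mem_span_singleton.1 (mem_comap.1 hx2)
        obtain ⟨rfl, -⟩ := hIf r (-t) (by simp [hr, ht])
        rw [LinearMap.mem_ker, ← hr, zero_smul]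
      · rw [LinearMap.mem_ker] at hx
        exact ⟨by simp [hx], by simp [hx]⟩
  obtain ⟨U, ⟨hUS, V₁, V₂, hV, hV₁, hV₂, hU⟩, hmin⟩ :=
    (wellFounded_lt (α := Submodule F V)).has_min _ hne
  refine ⟨V₁, V₂, hV, hV₁, hV₂, ?_⟩
  rw [hU]
  by_contra hUn
  have hT := h.inter U
  obtain ⟨c, hc, d, hd, hcd⟩ : ∃ c ∈ S ∩ U, ∃ d ∈ S ∩ U, c + d ∉ S ∩ U := by
    by_contra! hcon
    exact hUn fun x hx => (hT.span_subset hcon (hUS hx)).1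
  obtain ⟨hn, hI⟩ := hT.nonadj_of_add_notMem hc hd hcd
  -- The contraction is carried out inside `S ∩ U`, so its kernel lies in `U` and the separator
  -- becomes the plane of `f c` and `f d`, holding no points of the contracted cone off these two.
  obtain ⟨f, hfT, hIf, hf⟩ := hT.exists_two_point_quotient hF hc hd hI hn
  have hfS : Spanned S (LinearMap.ker f) := hfT.mono Set.inter_subset_left
  have hfU : LinearMap.ker f ≤ U := hfT.le Set.inter_subset_right
  have hIf' := IndepMod.ker_iff.1 hIf
  have hS' := h.map hfS
  have hc' : f c ∈ f '' S := ⟨c, hc.1, rfl⟩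
  have hd' : f d ∈ f '' S := ⟨d, hd.1, rfl⟩
  have hmemU : ∀ (a : V), a ∈ U → ∀ x : V, f x ∈ span F {f a} → x ∈ U := by
    intro a ha x hx
    obtain ⟨r, hr⟩ := mem_span_singleton.1 hx
    have : x - r • a ∈ LinearMap.ker f := by simp [hr]
    simpa using add_mem (hfU this) (U.smul_mem r ha)
  have hnn : Nonadj F (f '' S) (f c) (f d) := by
    rintro t ht ⟨s, hs, hst⟩
    have hsU : s ∈ U := by
      have : s - c - t • d ∈ LinearMap.ker f := by simp [hst]
      have := add_mem (add_mem (hfU this) (U.smul_mem t hd.2)) hc.2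
      simpa using this
    obtain h1 | h1 := hf s ⟨hs, hsU⟩
    · obtain ⟨r, hr⟩ := mem_span_singleton.1 h1
      exact ht (hIf' (1 - r) t (by rw [sub_smul, hr, hst, mem_bot]; module)).2
    · obtain ⟨r, hr⟩ := mem_span_singleton.1 h1
      exact one_ne_zero (hIf' 1 (t - r) (by rw [sub_smul, hr, hst, mem_bot]; module)).1
  have hspan : ∀ x ∈ U, f x ∈ span F {f c, f d} := by
    intro x hx
    have h1 : U ≤ (span F {f c, f d}).comap f := by
      refine hUS.trans (span_le.2 fun y hy => ?_)
      obtain h2 | h2 := hf y hy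
      · exact span_mono (by simp) h2
      · exact span_mono (by simp) h2
    exact h1 hx
  -- A decomposition of one side would give a separation across a smaller subspace.
  have hsep : ∀ V₁ V₂ : Submodule F V, S ⊆ V₁ ∪ V₂ → V₁ ⊓ V₂ = U → ∀ c d : V, c ∈ S ∩ U →
      d ∈ S ∩ U → U.map f ≤ span F {f c, f d} → IndepMod (LinearMap.ker f) c d → ∀ X Y : Submodule F V,
      X ⊓ Y = ⊥ → f '' S ∩ V₁.map f ⊆ X ∪ Y → f c ∈ X → f d ∈ Y →
      ∀ s ∈ S ∩ V₁, f s ∈ X → s ∈ U := by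
    intro V₁ V₂ hV hU c d hc hd hspan hI X Y hinf hXY hcX hdY s hs hsX
    by_contra hsU
    have hUV₁ : U ≤ V₁ := hU ▸ inf_le_left
    have hUV₂ : U ≤ V₂ := hU ▸ inf_le_right
    -- Attach the `Y`-part of the first side to the second side. What it shares with the `X`-part is
    -- only the line of `f c`, because `X` and `Y` are independent and the two sides meet in the
    -- plane of `f c` and `f d`.
    have hcore : ∀ x, f x ∈ X → x ∈ V₁ → f x ∈ Y ⊓ V₁.map f ⊔ V₂.map f → f x ∈ span F {f c} := by
      intro x hx hxV hx2
      obtain ⟨y, ⟨hy, y', hy'V, rfl⟩, _, ⟨z, hz, rfl⟩, hyz⟩ := mem_sup.1 hx2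
      have hzU : z ∈ U := by
        rw [← hU]
        refine ⟨?_, hz⟩
        have h1 : z - (x - y') ∈ LinearMap.ker f := by simp [← hyz]
        have := add_mem (hUV₁ (hfU h1)) (sub_mem hxV hy'V)
        simpa using this
      obtain ⟨r, t, hrt⟩ := mem_span_pair.1 (hspan (mem_map_of_mem hzU))
      have h2 : f x - r • f c ∈ X ⊓ Y := by
        refine ⟨sub_mem hx (X.smul_mem r hcX), ?_⟩
        have : f x - r • f c = f y' + t • f d := by rw [← hyz, ← hrt]; module
        rw [this]
        exact add_mem hy (Y.smul_mem t hdY)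
      rw [hinf, mem_bot, sub_eq_zero] at h2
      exact mem_span_singleton.2 ⟨r, h2.symm⟩
    -- The new separator does not contain `d`, so it is strictly smaller than `U`. The separation is
    -- proper because the first part misses `d` and the second misses `s`.
    refine hmin ((span F {f c}).comap f) ⟨hfS.comap (spanned_singleton ⟨c, hc.1, rfl⟩),
      (X ⊓ V₁.map f).comap f, (Y ⊓ V₁.map f ⊔ V₂.map f).comap f, ?_, ?_, ?_, ?_⟩ ?_
    · intro x hx
      obtain hx1 | hx2 := hV hx
      · have hx1' : f x ∈ V₁.map f := mem_map_of_mem hx1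
        obtain hx3 | hx3 := hXY ⟨⟨x, hx, rfl⟩, hx1'⟩
        · exact .inl ⟨hx3, hx1'⟩
        · exact .inr (mem_sup_left ⟨hx3, hx1'⟩)
      · exact .inr (mem_sup_right (mem_map_of_mem hx2))
    · intro hcon
      have : f d ∈ X ⊓ Y := ⟨(hcon hd.1).1, hdY⟩
      rw [hinf, mem_bot] at this
      exact one_ne_zero (hI 0 1 (by simp [this])).2
    · intro hcon
      exact hsU (hmemU c hc.2 s (hcore s hsX hs.2 (hcon hs.1)))
    · refine le_antisymm ?_ ?_
      · rintro x ⟨⟨hx1, x', hx', hxx⟩, hx2⟩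
        have hxV : x ∈ V₁ := by
          have : x - x' ∈ LinearMap.ker f := by simp [hxx]
          simpa using add_mem (hUV₁ (hfU this)) hx'
        exact hcore x hx1 hxV hx2
      · intro x hx
        obtain ⟨r, hr⟩ := mem_span_singleton.1 (mem_comap.1 hx)
        refine ⟨⟨?_, ?_⟩, ?_⟩
        · rw [← hr]; exact X.smul_mem r hcX
        · rw [← hr]; exact (V₁.map f).smul_mem r (mem_map_of_mem (hUV₁ hc.2))
        · change f x ∈ Y ⊓ V₁.map f ⊔ V₂.map f
          rw [← hr]
          exact (Y ⊓ V₁.map f ⊔ V₂.map f).smul_mem r (mem_sup_right (mem_map_of_mem (hUV₂ hc.2)))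
    · refine SetLike.lt_iff_le_and_exists.2 ⟨fun x hx => hmemU c hc.2 x hx, d, hd.2, fun hx => ?_⟩
      obtain ⟨r, hr⟩ := mem_span_singleton.1 (mem_comap.1 hx)
      exact one_ne_zero (hI (-r) 1 (by simp [hr])).2
  have hside : ∀ V₁ V₂ : Submodule F V, S ⊆ V₁ ∪ V₂ → ¬ S ⊆ V₂ → V₁ ⊓ V₂ = U →
      Linked F (f '' S ∩ V₁.map f) (f c) (f d) := by
    intro V₁ V₂ hV hV₂ hU
    have hUV₁ : U ≤ V₁ := hU ▸ inf_le_left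
    obtain h1 | ⟨X, Y, hXY, hinf, hcX, hdY⟩ := linked_or_separated (S := f '' S ∩ V₁.map f)
      ⟨hc', mem_map_of_mem (hUV₁ hc.2)⟩ ⟨hd', mem_map_of_mem (hUV₁ hd.2)⟩ hIf'
    · exact h1
    -- If `c` and `d` were separated on this side, both summands would consist of points of `U`, and
    -- all of `S` would lie in the other side.
    · refine absurd (fun s hs => ?_) hV₂
      have hspan' : U.map f ≤ span F {f c, f d} := map_le_iff_le_comap.2 hspan
      obtain hs1 | hs2 := hV hs
      · have hsU : s ∈ U := by
          obtain h2 | h2 := hXY ⟨⟨s, hs, rfl⟩, mem_map_of_mem hs1⟩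
          · exact hsep V₁ V₂ hV hU c d hc hd hspan' hIf X Y hinf hXY hcX hdY s ⟨hs, hs1⟩ h2
          · exact hsep V₁ V₂ hV hU d c hd hc (by rwa [Set.pair_comm]) hIf.symm Y X
              (by rwa [inf_comm]) (by rwa [Set.union_comm]) hdY hcX s ⟨hs, hs1⟩ h2
        rw [← hU] at hsU
        exact hsU.2
      · exact hs2
  obtain ⟨W₁, hW₁, hI₁, r₁, t₁, hr₁, ht₁, s₁, hs₁, hm₁⟩ := hside V₁ V₂ hV hV₂ hU
  obtain ⟨W₂, hW₂, hI₂, r₂, t₂, hr₂, ht₂, s₂, hs₂, hm₂⟩ :=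
    hside V₂ V₁ (by rwa [Set.union_comm]) hV₁ (by rwa [inf_comm])
  refine hS'.false_of_connected_sides hF (V₁ := V₁.map f) (V₂ := V₂.map f) ?_ hc' hd' ?_ hnn
    hW₁ hW₂ hI₁ hI₂ hr₁ ht₁ hr₂ ht₂ hs₁ hs₂ hm₁ hm₂
  · rintro _ ⟨s, hs, rfl⟩
    exact (hV hs).imp (fun h => mem_map_of_mem h) (fun h => mem_map_of_mem h)
  · refine le_antisymm ?_ (span_le.2 ?_)
    · rintro _ ⟨⟨x, hx, rfl⟩, y, hy, hyx⟩
      refine hspan x ?_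
      rw [← hU]
      refine ⟨hx, ?_⟩
      have : x - y ∈ LinearMap.ker f := by simp [hyx]
      have h2 := (hU ▸ hfU this : x - y ∈ V₁ ⊓ V₂).2
      simpa using add_mem h2 hy
    · have h1 : c ∈ V₁ ⊓ V₂ := hU ▸ hc.2
      have h2 : d ∈ V₁ ⊓ V₂ := hU ▸ hd.2
      rintro _ (rfl | rfl)
      · exact ⟨mem_map_of_mem h1.1, mem_map_of_mem h1.2⟩
      · exact ⟨mem_map_of_mem h2.1, mem_map_of_mem h2.2⟩

end IsChordalCone

end

/-! ### Amalgamating chordal cones along a common subspace -/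

section

variable {F V : Type*} [Field F] [AddCommGroup V] [Module F V]

/-- Chordal cones are closed under amalgamation along a common subspace. -/
lemma IsChordalCone.union {S₁ S₂ : Set V} {V₁ V₂ : Submodule F V} (h₁ : IsChordalCone F S₁)
    (h₂ : IsChordalCone F S₂) (hS₁ : S₁ ⊆ V₁) (hS₂ : S₂ ⊆ V₂)
    (hV₁ : (↑(V₁ ⊓ V₂) : Set V) ⊆ S₁) (hV₂ : (↑(V₁ ⊓ V₂) : Set V) ⊆ S₂) :
    IsChordalCone F (S₁ ∪ S₂) := by
  have split : ∀ W : Submodule F V, Spanned (S₁ ∪ S₂) W → ∀ x ∈ W,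
      ∃ y ∈ span F (S₁ ∩ W), ∃ z ∈ span F (S₂ ∩ W), x = y + z := by
    intro W hW x hx
    have h := hW hx
    rw [Set.union_inter_distrib_right, span_union] at h
    obtain ⟨y, hy, z, hz, rfl⟩ := mem_sup.1 h
    exact ⟨y, hy, z, hz, rfl⟩
  have hspan : ∀ W : Submodule F V, ∀ S : Set V, ∀ U : Submodule F V, S ⊆ U →
      span F (S ∩ W) ≤ U ⊓ W := fun W S U hS =>
    span_le.2 fun x hx => ⟨hS hx.1, hx.2⟩
  -- The `S₂`-component of a vector of `W ⊓ V₁` lies in `V₁ ⊓ V₂`, hence is itself a vector of `S₁`.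
  have res₁ : ∀ W : Submodule F V, Spanned (S₁ ∪ S₂) W → Spanned S₁ (W ⊓ V₁) := by
    rintro W hW x ⟨hxW, hxV⟩
    obtain ⟨y, hy, z, hz, rfl⟩ := split W hW x hxW
    have hy' := hspan W S₁ V₁ hS₁ hy
    have hz' := hspan W S₂ V₂ hS₂ hz
    have hzV : z ∈ V₁ := by simpa using sub_mem hxV hy'.1
    refine add_mem (span_mono (fun u hu => show u ∈ S₁ ∩ ↑(W ⊓ V₁) from
      ⟨hu.1, hu.2, hS₁ hu.1⟩) hy)
      (subset_span (show z ∈ S₁ ∩ ↑(W ⊓ V₁) from ⟨hV₁ (show z ∈ V₁ ⊓ V₂ from ⟨hzV, hz'.1⟩), hz'.2, hzV⟩))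
  have res₂ : ∀ W : Submodule F V, Spanned (S₁ ∪ S₂) W → Spanned S₂ (W ⊓ V₂) := by
    rintro W hW x ⟨hxW, hxV⟩
    obtain ⟨y, hy, z, hz, rfl⟩ := split W hW x hxW
    have hy' := hspan W S₁ V₁ hS₁ hy
    have hz' := hspan W S₂ V₂ hS₂ hz
    have hyV : y ∈ V₂ := by simpa using sub_mem hxV hz'.1
    refine add_mem (subset_span (show y ∈ S₂ ∩ ↑(W ⊓ V₂) from ⟨hV₂ (show y ∈ V₁ ⊓ V₂ from ⟨hy'.1, hyV⟩), hy'.2, hyV⟩))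
      (span_mono (fun u hu => show u ∈ S₂ ∩ ↑(W ⊓ V₂) from ⟨hu.1, hu.2, hS₂ hu.1⟩) hz)
  -- Modulo `W`, the two sides meet in the common subspace.
  have meet : ∀ W : Submodule F V, Spanned (S₁ ∪ S₂) W → ∀ x ∈ V₁, ∀ y ∈ V₂, x - y ∈ W →
      ∃ z ∈ V₁ ⊓ V₂, x - z ∈ W ∧ y - z ∈ W := by
    intro W hW x hx y hy hxy
    obtain ⟨p, hp, q, hq, hpq⟩ := split W hW _ hxy
    have hp' := hspan W S₁ V₁ hS₁ hp
    have hq' := hspan W S₂ V₂ hS₂ hq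
    have e : x - p = y + q := by rw [sub_eq_iff_eq_add] at hpq; rw [hpq]; abel
    refine ⟨x - p, ⟨sub_mem hx hp'.1, ?_⟩, by simpa using hp'.2, ?_⟩
    · rw [e]; exact add_mem hy hq'.1
    · rw [e]; simpa using hq'.2
  have hz : (0 : V) ∈ S₁ := h₁.zero_mem
  refine ⟨.inl hz, fun t x hx => hx.imp (h₁.smul_mem t x) (h₂.smul_mem t x), ?_, ?_⟩
  · intro W hW a ha b hb c hc habc t
    have fin : ∀ (S' : Set V) (U : Submodule F V), IsChordalCone F S' → S' ⊆ U → S' ⊆ S₁ ∪ S₂ →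
        Spanned S' (W ⊓ U) → ∀ a' ∈ S', ∀ b' ∈ S', ∀ c' ∈ S', a - a' ∈ W → b - b' ∈ W →
        c - c' ∈ W → ∃ d ∈ S₁ ∪ S₂, a + t • b - d ∈ W := by
      intro S' U hS' hU hS hW' a' ha' b' hb' c' hc' haa hbb hcc
      obtain ⟨d, hd, hd'⟩ := hS'.line _ hW' a' ha' b' hb' c' hc'
        ⟨show a' + b' - c' ∈ W by convert add_mem (sub_mem habc (add_mem haa hbb)) hcc using 1; abel,
          sub_mem (add_mem (hU ha') (hU hb')) (hU hc')⟩ t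
      refine ⟨d, hS hd, ?_⟩
      convert add_mem hd'.1 (add_mem haa (W.smul_mem t hbb)) using 1
      module
    have fin₁ := fin S₁ V₁ h₁ hS₁ Set.subset_union_left (res₁ W hW)
    have fin₂ := fin S₂ V₂ h₂ hS₂ Set.subset_union_right (res₂ W hW)
    have hr : ∀ x : V, x - x ∈ W := fun x => by simp
    -- If one of the three points is alone on its side, it agrees modulo `W` with a point of the
    -- common subspace and can be moved to the other side.
    obtain ha | ha := ha <;> obtain hb | hb := hb <;> obtain hc | hc := hc
    · exact fin₁ a ha b hb c hc (hr a) (hr b) (hr c)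
    · obtain ⟨z, hz, h3, h4⟩ := meet W hW (a + b) (add_mem (hS₁ ha) (hS₁ hb)) c (hS₂ hc) habc
      exact fin₁ a ha b hb z (hV₁ hz) (hr a) (hr b) h4
    · obtain ⟨z, hz, h3, h4⟩ := meet W hW (c - a) (sub_mem (hS₁ hc) (hS₁ ha)) b (hS₂ hb)
        (by convert neg_mem habc using 1; abel)
      exact fin₁ a ha z (hV₁ hz) c hc (hr a) h4 (hr c)
    · obtain ⟨z, hz, h3, h4⟩ := meet W hW a (hS₁ ha) (c - b) (sub_mem (hS₂ hc) (hS₂ hb))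
        (by convert habc using 1; abel)
      exact fin₂ z (hV₂ hz) b hb c hc h3 (hr b) (hr c)
    · obtain ⟨z, hz, h3, h4⟩ := meet W hW (c - b) (sub_mem (hS₁ hc) (hS₁ hb)) a (hS₂ ha)
        (by convert neg_mem habc using 1; abel)
      exact fin₁ z (hV₁ hz) b hb c hc h4 (hr b) (hr c)
    · obtain ⟨z, hz, h3, h4⟩ := meet W hW b (hS₁ hb) (c - a) (sub_mem (hS₂ hc) (hS₂ ha))
        (by convert habc using 1; abel)
      exact fin₂ a ha z (hV₂ hz) c hc (hr a) h3 (hr c)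
    · obtain ⟨z, hz, h3, h4⟩ := meet W hW c (hS₁ hc) (a + b) (add_mem (hS₂ ha) (hS₂ hb))
        (by convert neg_mem habc using 1; abel)
      exact fin₂ a ha b hb z (hV₂ hz) (hr a) (hr b) h3
    · exact fin₂ a ha b hb c hc (hr a) (hr b) (hr c)
  · intro W hW a ha b hb c hc d hd habc hI
    have fin : ∀ (S' : Set V) (U : Submodule F V), IsChordalCone F S' → S' ⊆ U → S' ⊆ S₁ ∪ S₂ →
        Spanned S' (W ⊓ U) → ∀ a' ∈ S', ∀ b' ∈ S', ∀ c' ∈ S', ∀ d' ∈ S', a - a' ∈ W → b - b' ∈ W →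
        c - c' ∈ W → d - d' ∈ W → ∃ x ∈ S₁ ∪ S₂, ∃ y ∈ S₁ ∪ S₂, ∃ z ∈ S₁ ∪ S₂,
        (∃ r s t : F, x - (r • a + s • b + t • c) ∈ W) ∧
        (∃ r s t : F, y - (r • a + s • b + t • c) ∈ W) ∧ x + y - z ∈ W ∧ IndepMod W x y := by
      intro S' U hS' hU hS hW' a' ha' b' hb' c' hc' d' hd' haa hbb hcc hdd
      have hmem : ∀ r s t : F, r • (a - a') + s • (b - b') + t • (c - c') ∈ W := fun r s t =>
        add_mem (add_mem (W.smul_mem r haa) (W.smul_mem s hbb)) (W.smul_mem t hcc)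
      obtain ⟨x, hx, y, hy, z, hz, ⟨r, s, t, h1⟩, ⟨r', s', t', h2⟩, h3, h4⟩ :=
        hS'.plane _ hW' a' ha' b' hb' c' hc' d' hd'
        ⟨show a' + b' + c' - d' ∈ W by
            convert add_mem (sub_mem habc (hmem 1 1 1)) hdd using 1; module,
          sub_mem (add_mem (add_mem (hU ha') (hU hb')) (hU hc')) (hU hd')⟩ (fun r s t hrst =>
            hI r s t (by convert add_mem hrst.1 (hmem r s t) using 1; module))
      refine ⟨x, hS hx, y, hS hy, z, hS hz, ⟨r, s, t, ?_⟩, ⟨r', s', t', ?_⟩, h3.1, fun p q hpq =>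
        h4 p q ⟨hpq, add_mem (U.smul_mem p (hU hx)) (U.smul_mem q (hU hy))⟩⟩
      · convert sub_mem h1.1 (hmem r s t) using 1; module
      · convert sub_mem h2.1 (hmem r' s' t') using 1; module
    have fin₁ := fin S₁ V₁ h₁ hS₁ Set.subset_union_left (res₁ W hW)
    have fin₂ := fin S₂ V₂ h₂ hS₂ Set.subset_union_right (res₂ W hW)
    have hab : (∃ z ∈ V₁ ⊓ V₂, a + b - z ∈ W) → ∃ x ∈ S₁ ∪ S₂, ∃ y ∈ S₁ ∪ S₂, ∃ z ∈ S₁ ∪ S₂,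
        (∃ r s t : F, x - (r • a + s • b + t • c) ∈ W) ∧
        (∃ r s t : F, y - (r • a + s • b + t • c) ∈ W) ∧ x + y - z ∈ W ∧ IndepMod W x y := by
      rintro ⟨z, hz, hm⟩
      refine ⟨a, ha, b, hb, z, .inl (hV₁ hz), ⟨1, 0, 0, by simp⟩, ⟨0, 1, 0, by simp⟩, hm, ?_⟩
      intro r s hrs
      have := hI r s 0 (by simpa using hrs)
      tauto
    have hac : (∃ z ∈ V₁ ⊓ V₂, a + c - z ∈ W) → ∃ x ∈ S₁ ∪ S₂, ∃ y ∈ S₁ ∪ S₂, ∃ z ∈ S₁ ∪ S₂,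
        (∃ r s t : F, x - (r • a + s • b + t • c) ∈ W) ∧
        (∃ r s t : F, y - (r • a + s • b + t • c) ∈ W) ∧ x + y - z ∈ W ∧ IndepMod W x y := by
      rintro ⟨z, hz, hm⟩
      refine ⟨a, ha, c, hc, z, .inl (hV₁ hz), ⟨1, 0, 0, by simp⟩, ⟨0, 0, 1, by simp⟩, hm, ?_⟩
      intro r s hrs
      have := hI r 0 s (by simpa using hrs)
      tauto
    have hbc : (∃ z ∈ V₁ ⊓ V₂, b + c - z ∈ W) → ∃ x ∈ S₁ ∪ S₂, ∃ y ∈ S₁ ∪ S₂, ∃ z ∈ S₁ ∪ S₂,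
        (∃ r s t : F, x - (r • a + s • b + t • c) ∈ W) ∧
        (∃ r s t : F, y - (r • a + s • b + t • c) ∈ W) ∧ x + y - z ∈ W ∧ IndepMod W x y := by
      rintro ⟨z, hz, hm⟩
      refine ⟨b, hb, c, hc, z, .inl (hV₁ hz), ⟨0, 1, 0, by simp⟩, ⟨0, 0, 1, by simp⟩, hm, ?_⟩
      intro r s hrs
      have := hI 0 r s (by simpa using hrs)
      tauto
    have hr : ∀ x : V, x - x ∈ W := fun x => by simp
    -- A lone point is moved across as before. If the four points split two and two, the sum of the
    -- pair not containing `d` agrees modulo `W` with a point of the common subspace, which gives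
    -- the collinear triple directly.
    obtain ha | ha := ha <;> obtain hb | hb := hb <;> obtain hc | hc := hc <;>
      obtain hd | hd := hd
    · exact fin₁ a ha b hb c hc d hd (hr a) (hr b) (hr c) (hr d)
    · obtain ⟨z, hz, h3, h4⟩ := meet W hW (a + b + c)
        (add_mem (add_mem (hS₁ ha) (hS₁ hb)) (hS₁ hc)) d (hS₂ hd) habc
      exact fin₁ a ha b hb c hc z (hV₁ hz) (hr a) (hr b) (hr c) h4
    · obtain ⟨z, hz, h3, h4⟩ := meet W hW (d - a - b)
        (sub_mem (sub_mem (hS₁ hd) (hS₁ ha)) (hS₁ hb)) c (hS₂ hc)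
        (by convert neg_mem habc using 1; abel)
      exact fin₁ a ha b hb z (hV₁ hz) d hd (hr a) (hr b) h4 (hr d)
    · obtain ⟨z, hz, h3, h4⟩ := meet W hW (a + b) (add_mem (hS₁ ha) (hS₁ hb)) (d - c)
        (sub_mem (hS₂ hd) (hS₂ hc)) (by convert habc using 1; abel)
      exact hab ⟨z, hz, h3⟩
    · obtain ⟨z, hz, h3, h4⟩ := meet W hW (d - a - c)
        (sub_mem (sub_mem (hS₁ hd) (hS₁ ha)) (hS₁ hc)) b (hS₂ hb)
        (by convert neg_mem habc using 1; abel)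
      exact fin₁ a ha z (hV₁ hz) c hc d hd (hr a) h4 (hr c) (hr d)
    · obtain ⟨z, hz, h3, h4⟩ := meet W hW (a + c) (add_mem (hS₁ ha) (hS₁ hc)) (d - b)
        (sub_mem (hS₂ hd) (hS₂ hb)) (by convert habc using 1; abel)
      exact hac ⟨z, hz, h3⟩
    · obtain ⟨z, hz, h3, h4⟩ := meet W hW (d - a) (sub_mem (hS₁ hd) (hS₁ ha)) (b + c)
        (add_mem (hS₂ hb) (hS₂ hc)) (by convert neg_mem habc using 1; abel)
      exact hbc ⟨z, hz, h4⟩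
    · obtain ⟨z, hz, h3, h4⟩ := meet W hW a (hS₁ ha) (d - b - c)
        (sub_mem (sub_mem (hS₂ hd) (hS₂ hb)) (hS₂ hc)) (by convert habc using 1; abel)
      exact fin₂ z (hV₂ hz) b hb c hc d hd h3 (hr b) (hr c) (hr d)
    · obtain ⟨z, hz, h3, h4⟩ := meet W hW (d - b - c)
        (sub_mem (sub_mem (hS₁ hd) (hS₁ hb)) (hS₁ hc)) a (hS₂ ha)
        (by convert neg_mem habc using 1; abel)
      exact fin₁ z (hV₁ hz) b hb c hc d hd h4 (hr b) (hr c) (hr d)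
    · obtain ⟨z, hz, h3, h4⟩ := meet W hW (b + c) (add_mem (hS₁ hb) (hS₁ hc)) (d - a)
        (sub_mem (hS₂ hd) (hS₂ ha)) (by convert habc using 1; abel)
      exact hbc ⟨z, hz, h3⟩
    · obtain ⟨z, hz, h3, h4⟩ := meet W hW (d - b) (sub_mem (hS₁ hd) (hS₁ hb)) (a + c)
        (add_mem (hS₂ ha) (hS₂ hc)) (by convert neg_mem habc using 1; abel)
      exact hac ⟨z, hz, h4⟩
    · obtain ⟨z, hz, h3, h4⟩ := meet W hW b (hS₁ hb) (d - a - c)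
        (sub_mem (sub_mem (hS₂ hd) (hS₂ ha)) (hS₂ hc)) (by convert habc using 1; abel)
      exact fin₂ a ha z (hV₂ hz) c hc d hd (hr a) h3 (hr c) (hr d)
    · obtain ⟨z, hz, h3, h4⟩ := meet W hW (d - c) (sub_mem (hS₁ hd) (hS₁ hc)) (a + b)
        (add_mem (hS₂ ha) (hS₂ hb)) (by convert neg_mem habc using 1; abel)
      exact hab ⟨z, hz, h4⟩
    · obtain ⟨z, hz, h3, h4⟩ := meet W hW c (hS₁ hc) (d - a - b)
        (sub_mem (sub_mem (hS₂ hd) (hS₂ ha)) (hS₂ hb)) (by convert habc using 1; abel)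
      exact fin₂ a ha b hb z (hV₂ hz) d hd (hr a) (hr b) h3 (hr d)
    · obtain ⟨z, hz, h3, h4⟩ := meet W hW d (hS₁ hd) (a + b + c)
        (add_mem (add_mem (hS₂ ha) (hS₂ hb)) (hS₂ hc)) (by convert neg_mem habc using 1; abel)
      exact fin₂ a ha b hb c hc z (hV₂ hz) (hr a) (hr b) (hr c) h3
    · exact fin₂ a ha b hb c hc d hd (hr a) (hr b) (hr c) (hr d)

end

end ConeGeometry

namespace Projectivization

lemma independent_mk_iff {ι K V : Type*} [Field K] [AddCommGroup V] [Module K V] (f : ι → V)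
    (hf : ∀ i, f i ≠ 0) :
    Independent (fun i => Projectivization.mk K (f i) (hf i)) ↔ LinearIndependent K f := by
  refine ⟨fun h => ?_, fun h => .mk f hf h⟩
  rw [independent_iff] at h
  choose a ha using fun i => exists_smul_eq_mk_rep K (f i) (hf i)
  rw [← LinearIndependent.units_smul_iff f a]
  convert h using 1
  ext i
  exact ha i

end Projectivization

namespace Matroid

open Submodule ConeGeometry

/-! ### The cone of a represented matroid -/

section

variable {α F V : Type*} [Field F] [AddCommGroup V] [Module F V] {M N : Matroid α} {v : α → V}

/-- `v` is a representation of `M` over `F`. -/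
def Represents (F : Type*) [Field F] [Module F V] (v : α → V) (M : Matroid α) : Prop :=
  ∀ I ⊆ M.E, M.Indep I ↔ LinearIndepOn F v I

/-- The multiples of the vectors representing elements of `E`. -/
def cone (F : Type*) [Field F] [Module F V] (v : α → V) (E : Set α) : Set V :=
  {x | x = 0 ∨ ∃ e ∈ E, ∃ t : F, x = t • v e}

lemma zero_mem_cone {E : Set α} : (0 : V) ∈ cone F v E := .inl rfl

lemma mem_cone {E : Set α} {e : α} (he : e ∈ E) : v e ∈ cone F v E := .inr ⟨e, he, 1, by simp⟩

lemma smul_mem_cone {E : Set α} {x : V} (hx : x ∈ cone F v E) (t : F) : t • x ∈ cone F v E := by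
  obtain rfl | ⟨e, he, r, rfl⟩ := hx
  · simpa using zero_mem_cone
  · exact .inr ⟨e, he, t * r, by rw [mul_smul]⟩

lemma cone_subset_iff {E : Set α} {U : Submodule F V} :
    cone F v E ⊆ U ↔ ∀ e ∈ E, v e ∈ U := by
  refine ⟨fun h e he => h (mem_cone he), fun h x hx => ?_⟩
  obtain rfl | ⟨e, he, t, rfl⟩ := hx
  · exact U.zero_mem
  · exact U.smul_mem t (h e he)

lemma cone_subset_span {E : Set α} : cone F v E ⊆ span F (v '' E) :=
  cone_subset_iff.2 fun e he => subset_span ⟨e, he, rfl⟩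

lemma cone_mono {E E' : Set α} (h : E ⊆ E') : cone F v E ⊆ cone F v E' := by
  rintro x (rfl | ⟨e, he, t, rfl⟩)
  · exact zero_mem_cone
  · exact .inr ⟨e, h he, t, rfl⟩

lemma span_cone {E : Set α} : span F (cone F v E) = span F (v '' E) :=
  le_antisymm (span_le.2 cone_subset_span)
    (span_mono (by rintro _ ⟨e, he, rfl⟩; exact mem_cone he))

lemma cone_comp {E : Set α} (f : V →ₗ[F] V) : cone F (f ∘ v) E = f '' cone F v E := by
  ext x
  constructor
  · rintro (rfl | ⟨e, he, t, rfl⟩)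
    · exact ⟨0, zero_mem_cone, map_zero f⟩
    · exact ⟨t • v e, smul_mem_cone (mem_cone he) t, by simp⟩
  · rintro ⟨_, rfl | ⟨e, he, t, rfl⟩, rfl⟩
    · simpa using zero_mem_cone
    · exact .inr ⟨e, he, t, by simp⟩

lemma cone_inter {E : Set α} (U : Submodule F V) :
    cone F v (E ∩ {e | v e ∈ U}) = cone F v E ∩ U := by
  ext x
  constructor
  · rintro (rfl | ⟨e, he, t, rfl⟩)
    · exact ⟨zero_mem_cone, U.zero_mem⟩
    · exact ⟨.inr ⟨e, he.1, t, rfl⟩, U.smul_mem t he.2⟩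
  · rintro ⟨rfl | ⟨e, he, t, rfl⟩, hU⟩
    · exact zero_mem_cone
    · obtain rfl | ht := eq_or_ne t 0
      · simpa using zero_mem_cone
      · exact .inr ⟨e, ⟨he, (U.smul_mem_iff ht).1 hU⟩, t, rfl⟩

lemma cone_union {E E' : Set α} : cone F v (E ∪ E') = cone F v E ∪ cone F v E' := by
  refine subset_antisymm ?_ (Set.union_subset (cone_mono Set.subset_union_left)
    (cone_mono Set.subset_union_right))
  rintro x (rfl | ⟨e, he, t, rfl⟩)
  · exact .inl zero_mem_cone
  · exact he.imp (fun h => .inr ⟨e, h, t, rfl⟩) (fun h => .inr ⟨e, h, t, rfl⟩)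

namespace Represents

lemma mem_closure_iff_of_indep (h : M.Represents F v) {I : Set α} (hI : M.Indep I) {e : α}
    (he : e ∈ M.E) : e ∈ M.closure I ↔ v e ∈ span F (v '' I) := by
  have hI' := (h I hI.subset_ground).1 hI
  rw [hI.mem_closure_iff', hI'.mem_span_iff, and_iff_right he,
    h _ (Set.insert_subset he hI.subset_ground)]

lemma span_eq_of_isBasis (h : M.Represents F v) {I X : Set α} (hI : M.IsBasis I X) :
    span F (v '' I) = span F (v '' X) := by
  refine le_antisymm (span_mono (Set.image_mono hI.subset)) (span_le.2 ?_)
  rintro _ ⟨x, hx, rfl⟩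
  exact (h.mem_closure_iff_of_indep hI.indep (hI.subset_ground hx)).1 (hI.subset_closure hx)

lemma mem_closure_iff (h : M.Represents F v) {X : Set α} (hX : X ⊆ M.E) {e : α}
    (he : e ∈ M.E) : e ∈ M.closure X ↔ v e ∈ span F (v '' X) := by
  obtain ⟨I, hI⟩ := M.exists_isBasis X
  rw [← hI.closure_eq_closure, h.mem_closure_iff_of_indep hI.indep he, h.span_eq_of_isBasis hI]

/-- Independence in both settings means that no element lies in the closure of the others. This form
suits matroids known through closures or flats, such as contractions and the parts of a parallel
connection. -/
lemma of_closure (h : ∀ X ⊆ M.E, ∀ e ∈ M.E, e ∈ M.closure X ↔ v e ∈ span F (v '' X)) :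
    M.Represents F v := by
  intro I hI
  rw [indep_iff_forall_notMem_closure_sdiff hI, linearIndepOn_iff_notMem_span]
  exact forall₂_congr fun e he => not_congr (h _ (Set.sdiff_subset.trans hI) e (hI he))

lemma isFlat_iff (h : M.Represents F v) {X : Set α} (hX : X ⊆ M.E) :
    M.IsFlat X ↔ ∀ e ∈ M.E, v e ∈ span F (v '' X) → e ∈ X := by
  rw [isFlat_iff_closure_eq, subset_antisymm_iff, and_iff_left (M.subset_closure X hX)]
  constructor
  · intro h' e he hv
    exact h' ((h.mem_closure_iff hX he).2 hv)
  · intro h' e he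
    have heE := mem_ground_of_mem_closure he
    exact h' e heE ((h.mem_closure_iff hX heE).1 he)

lemma isFlat_inter (h : M.Represents F v) (U : Submodule F V) :
    M.IsFlat (M.E ∩ {e | v e ∈ U}) := by
  rw [h.isFlat_iff Set.inter_subset_left]
  intro e he hv
  refine ⟨he, (span_le.2 ?_ : span F _ ≤ U) hv⟩
  rintro _ ⟨x, hx, rfl⟩
  exact hx.2

lemma eq_inter_of_isFlat (h : M.Represents F v) {X : Set α} (hX : M.IsFlat X) :
    X = M.E ∩ {e | v e ∈ span F (v '' X)} := by
  refine subset_antisymm (fun e he => ⟨hX.subset_ground he, subset_span ⟨e, he, rfl⟩⟩) ?_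
  rintro e ⟨he, hv⟩
  exact (h.isFlat_iff hX.subset_ground).1 hX e he hv

lemma restrict (h : M.Represents F v) {X : Set α} (hX : X ⊆ M.E) : (M ↾ X).Represents F v := by
  intro I hI
  rw [restrict_indep_iff, h I (hI.trans hX)]
  exact and_iff_left hI

lemma contract (h : M.Represents F v) {C : Set α} (hC : C ⊆ M.E) {f : V →ₗ[F] V}
    (hf : LinearMap.ker f = span F (v '' C)) : (M ／ C).Represents F (f ∘ v) := by
  refine of_closure fun X hX e he => ?_
  have hXE : X ⊆ M.E := hX.trans Set.sdiff_subset
  rw [contract_closure_eq, Set.mem_sdiff, and_iff_left he.2,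
    h.mem_closure_iff (Set.union_subset hXE hC) he.1, Set.image_comp, ← map_span,
    Set.image_union, span_union, ← hf]
  constructor
  · intro hx
    obtain ⟨y, hy, z, hz, hyz⟩ := mem_sup.1 hx
    refine ⟨y, hy, ?_⟩
    rw [LinearMap.mem_ker] at hz
    simp [← hyz, hz]
  · rintro ⟨y, hy, hyz⟩
    have : v e - y ∈ LinearMap.ker f := by simp [hyz]
    exact mem_sup.2 ⟨y, hy, _, this, by abel⟩

lemma eRk_eq [FiniteDimensional F V] (h : M.Represents F v) {X : Set α} (hX : X ⊆ M.E) :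
    M.eRk X = Module.finrank F (span F (v '' X)) := by
  obtain ⟨I, hI⟩ := M.exists_isBasis X
  have hI' := (h I hI.indep.subset_ground).1 hI.indep
  have hfin : Finite I := hI'.linearIndependent.finite
  have := Fintype.ofFinite I
  rw [← hI.encard_eq_eRk, ← h.span_eq_of_isBasis hI, Set.image_eq_range,
    finrank_span_eq_card hI'.linearIndependent, Set.encard_eq_coe_toFinset_card,
    Set.toFinset_card]

lemma ne_zero (h : M.Represents F v) (hM : M.IsSimple) {e : α} (he : e ∈ M.E) : v e ≠ 0 := by
  have := (h {e, e} (by simp [he])).1 (hM e he e he)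
  simpa using this

lemma eq_of_smul (h : M.Represents F v) (hM : M.IsSimple) {e f : α} (he : e ∈ M.E) (hf : f ∈ M.E)
    {t : F} (hef : v e = t • v f) : e = f := by
  by_contra hne
  have h1 := (h {e, f} (Set.insert_subset he (by simpa))).1 (hM e he f hf)
  have h2 := ((LinearIndepOn.pair_iff v hne).1 h1 1 (-t) (by rw [hef]; module)).1
  exact one_ne_zero h2

/-- A simple matroid represented by all points of a subspace is a projective geometry. -/
lemma isProjectiveGeometry [FiniteDimensional F V] (h : M.Represents F v) (hM : M.IsSimple)
    (hU : (span F (v '' M.E) : Set V) ⊆ cone F v M.E) :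
    ∃ n, M.IsProjectiveGeometry F n := by
  set U := span F (v '' M.E) with hUdef
  have L : U ≃ₗ[F] (Fin (Module.finrank F U) → F) := (Module.finBasis F U).equivFun
  have hmem : ∀ e : M.E, v e ∈ U := fun e => subset_span ⟨e, e.2, rfl⟩
  let w : M.E → (Fin (Module.finrank F U) → F) := fun e => L ⟨v e, hmem e⟩
  have hw0 : ∀ e, w e ≠ 0 := fun e => by
    simpa [w, Subtype.ext_iff] using h.ne_zero hM e.2
  refine ⟨Module.finrank F U, Equiv.ofBijective (fun e => Projectivization.mk F (w e) (hw0 e))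
    ⟨?_, ?_⟩, ?_⟩
  · intro e f hef
    obtain ⟨a, ha⟩ := (Projectivization.mk_eq_mk_iff' F _ _ (hw0 e) (hw0 f)).1 hef
    have : L (a • ⟨v f, hmem f⟩) = L ⟨v e, hmem e⟩ := by rw [map_smul]; exact ha
    have := congrArg Subtype.val (L.injective this)
    exact Subtype.ext (h.eq_of_smul hM e.2 f.2 this.symm)
  · intro p
    induction p using Projectivization.ind with
    | h x hx =>
    have hx0 : (L.symm x : V) ≠ 0 := by simpa using hx
    obtain h0 | ⟨e, he, t, het⟩ := hU (L.symm x).2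
    · exact absurd h0 hx0
    · refine ⟨⟨e, he⟩, (Projectivization.mk_eq_mk_iff' F _ _ _ _).2 ⟨t⁻¹, ?_⟩⟩
      have ht : t ≠ 0 := by rintro rfl; simp at het; exact hx het
      apply L.symm.injective
      ext
      simp [w, het, smul_smul, inv_mul_cancel₀ ht]
  · intro I
    have hI : Subtype.val '' I ⊆ M.E := by rintro _ ⟨x, -, rfl⟩; exact x.2
    rw [h _ hI]
    change _ ↔ Projectivization.Independent (fun x : I => Projectivization.mk F (w x) (hw0 x))
    rw [Projectivization.independent_mk_iff (fun x : I => w x) (fun x => hw0 x)]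
    have e1 : LinearIndepOn F v (Subtype.val '' I) ↔ LinearIndepOn F (v ∘ Subtype.val) I :=
      ⟨fun h => h.comp_of_image Subtype.val_injective.injOn, fun h => h.image_of_comp⟩
    rw [e1]
    have e2 : (fun x : I => w x) = L ∘ (fun x : I => (⟨v x, hmem x⟩ : U)) := rfl
    rw [e2]
    have e3 : LinearIndepOn F (v ∘ Subtype.val) I ↔
        LinearIndependent F (U.subtype ∘ (fun x : I => (⟨v x, hmem x⟩ : U))) := Iff.rfl
    rw [e3, LinearMap.linearIndependent_iff U.subtype (by simp)]
    exact (L.toLinearMap.linearIndependent_iff L.ker).symm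

end Represents

lemma exists_isSimplification (M : Matroid α) : ∃ N : Matroid α, N.IsSimplification M := by
  obtain ⟨S, hS, hbij⟩ := Set.exists_subset_bijOn {e | M.IsNonloop e} (fun e => M.closure {e})
  refine ⟨M ↾ S, S, fun e he => (hS he).mem_ground, rfl, fun x hx y hy => ?_, fun e he => ?_⟩
  · simp only [restrict_ground_eq] at hx hy
    rw [restrict_indep_iff]
    refine ⟨?_, Set.insert_subset hx (by simpa)⟩
    obtain rfl | hne := eq_or_ne x y
    · simpa using hS hx
    · by_contra hcon
      exact hne (hbij.injOn hx hy (((hS hx).closure_eq_closure_iff_eq_or_dep (hS hy)).2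
        (.inr hcon)))
  · obtain ⟨s, hs, hse⟩ := hbij.surjOn ⟨e, he, rfl⟩
    exact ⟨s, hs, hse⟩

lemma IsSimplification.isSimple (h : N.IsSimplification M) : N.IsSimple := by
  obtain ⟨S, -, -, h, -⟩ := h
  exact h

lemma IsSimplification.represents (h : N.IsSimplification M) (hM : M.Represents F v) :
    N.Represents F v := by
  obtain ⟨S, hS, rfl, -, -⟩ := h
  exact hM.restrict hS

/-- The cone does not see loops, which give zero vectors, or parallel elements, which give
proportional ones. Simplification therefore disappears on the level of cones. -/
lemma IsSimplification.cone_eq (h : N.IsSimplification M) (hM : M.Represents F v) :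
    cone F v N.E = cone F v M.E := by
  obtain ⟨S, hS, rfl, -, hpar⟩ := h
  refine subset_antisymm (cone_mono hS) ?_
  rintro x (rfl | ⟨e, he, t, rfl⟩)
  · exact zero_mem_cone
  by_cases hl : M.IsNonloop e
  · obtain ⟨s, hs, hse⟩ := hpar e hl
    have h1 : e ∈ M.closure {s} := hse ▸ M.mem_closure_self e
    rw [hM.mem_closure_iff (by simpa using hS hs) he, Set.image_singleton, mem_span_singleton] at h1
    obtain ⟨r, hr⟩ := h1
    exact .inr ⟨s, hs, t * r, by rw [mul_smul, hr]⟩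
  · have h1 : e ∈ M.closure ∅ := by
      by_contra hcon
      exact hl (isNonloop_of_notMem_closure hcon he)
    rw [hM.mem_closure_iff (by simp) he, Set.image_empty, span_empty, mem_bot] at h1
    simpa [h1] using zero_mem_cone

end

/-! ### Generalized parallel connections and separations of cones -/

section

variable {α F V : Type*} [Field F] [AddCommGroup V] [Module F V] {M M₁ M₂ N : Matroid α} {v : α → V}

lemma IsSimple.restrict (hM : M.IsSimple) {X : Set α} (hX : X ⊆ M.E) : (M ↾ X).IsSimple :=
  fun x hx y hy => restrict_indep_iff.2
    ⟨hM x (hX hx) y (hX hy), Set.insert_subset hx (Set.singleton_subset_iff.2 hy)⟩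

/-- A representation separated by two subspaces meeting in its cone exhibits the matroid as a
generalized parallel connection. -/
lemma Represents.isGenParallelConnection [FiniteDimensional F V] (h : M.Represents F v)
    {V₁ V₂ : Submodule F V} (hS : cone F v M.E ⊆ V₁ ∪ V₂)
    (hV : (↑(V₁ ⊓ V₂) : Set V) ⊆ cone F v M.E) :
    M.IsGenParallelConnection (M ↾ (M.E ∩ {e | v e ∈ V₁})) (M ↾ (M.E ∩ {e | v e ∈ V₂}))
      (M.E ∩ {e | v e ∈ V₁ ⊓ V₂}) := by
  set E₁ := M.E ∩ {e | v e ∈ V₁} with hE₁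
  set E₂ := M.E ∩ {e | v e ∈ V₂} with hE₂
  set T := M.E ∩ {e | v e ∈ V₁ ⊓ V₂} with hT
  have hT₁ : T ⊆ E₁ := fun e he => ⟨he.1, he.2.1⟩
  have hT₂ : T ⊆ E₂ := fun e he => ⟨he.1, he.2.2⟩
  have h₁ : (M ↾ E₁).Represents F v := h.restrict Set.inter_subset_left
  have h₂ : (M ↾ E₂).Represents F v := h.restrict Set.inter_subset_left
  have hE : ∀ e ∈ M.E, e ∈ E₁ ∨ e ∈ E₂ := fun e he =>
    (hS (mem_cone he)).imp (fun h => ⟨he, h⟩) (fun h => ⟨he, h⟩)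
  have hcT : cone F v T = (↑(V₁ ⊓ V₂) : Set V) := by
    rw [hT, cone_inter, Set.inter_eq_right.2 hV]
  have hspanT : span F (v '' T) = V₁ ⊓ V₂ := by
    rw [← span_cone, hcT, span_eq]
  -- Every vector in the span of `T` is a multiple of an element of `T`; if it also lies in the span
  -- of the flat `X`, that element belongs to `X`. Modularity of `T` is then the dimension formula.
  have hTX : ∀ X, (M ↾ E₁).IsFlat X → span F (v '' (T ∩ X)) = span F (v '' T) ⊓ span F (v '' X) := by
    intro X hX
    refine le_antisymm (le_inf (span_mono (Set.image_mono Set.inter_subset_left))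
      (span_mono (Set.image_mono Set.inter_subset_right))) ?_
    rintro x ⟨hx, hxX⟩
    have hx' : x ∈ cone F v T := by rw [hcT, ← hspanT]; exact hx
    obtain rfl | ⟨e, he, t, rfl⟩ := hx'
    · exact zero_mem _
    · obtain rfl | ht := eq_or_ne t 0
      · simp
      · refine smul_mem _ t (subset_span ⟨e, ⟨he, ?_⟩, rfl⟩)
        exact (h₁.isFlat_iff hX.subset_ground).1 hX e (hT₁ he)
          ((smul_mem_iff _ ht).1 hxX)
  -- Write `v e` as a sum over the two sides. The summand from the far side lies in `V₁ ⊓ V₂`, so it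
  -- is a multiple of an element of `T`, which the far flat contains. Hence `v e` is spanned by the
  -- near part of `X`. The sides are variables so that both orders are covered.
  have hside : ∀ E₁ E₂ : Set α, ∀ X ⊆ M.E, T ⊆ E₁ → T ⊆ E₂ → (M ↾ E₁).IsFlat (X ∩ E₁) →
      (M ↾ E₂).IsFlat (X ∩ E₂) → E₁ ⊆ M.E → E₂ ⊆ M.E → (∀ e ∈ M.E, e ∈ E₁ ∨ e ∈ E₂) →
      (∀ x ∈ span F (v '' E₁), x ∈ span F (v '' E₂) → x ∈ V₁ ⊓ V₂) → ∀ e ∈ E₁,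
      v e ∈ span F (v '' X) → e ∈ X := by
    intro E₁ E₂ X hX hT₁ hT₂ hX₁ hX₂ hE₁ hE₂ hE hinf e he hv
    have h₁ := h.restrict hE₁
    have h₂ := h.restrict hE₂
    have hX' : X = (X ∩ E₁) ∪ (X ∩ E₂) := by
      ext e
      exact ⟨fun h => (hE e (hX h)).imp (fun h' => ⟨h, h'⟩) (fun h' => ⟨h, h'⟩),
        fun h => h.elim And.left And.left⟩
    rw [hX', Set.image_union, span_union] at hv
    obtain ⟨x, hx, y, hy, hxy⟩ := mem_sup.1 hv
    have hx' : x ∈ span F (v '' E₁) := span_mono (Set.image_mono Set.inter_subset_right) hx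
    have hy' : y ∈ span F (v '' E₂) := span_mono (Set.image_mono Set.inter_subset_right) hy
    have hyT : y ∈ cone F v T := by
      rw [hcT]
      refine hinf y ?_ hy'
      rw [← add_sub_cancel_left x y, hxy]
      exact sub_mem (subset_span ⟨e, he, rfl⟩) hx'
    have key : v e ∈ span F (v '' (X ∩ E₁)) := by
      rw [← hxy]
      refine add_mem hx ?_
      obtain rfl | ⟨f, hf, t, rfl⟩ := hyT
      · exact zero_mem _
      obtain rfl | ht := eq_or_ne t 0
      · simp
      have hfX := (h₂.isFlat_iff hX₂.subset_ground).1 hX₂ f (hT₂ hf) ((smul_mem_iff _ ht).1 hy)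
      exact smul_mem _ t (subset_span ⟨f, ⟨hfX.1, hT₁ hf⟩, rfl⟩)
    exact ((h₁.isFlat_iff hX₁.subset_ground).1 hX₁ e he key).1
  have hs₁ : span F (v '' E₁) ≤ V₁ := span_le.2 (by rintro _ ⟨e, he, rfl⟩; exact he.2)
  have hs₂ : span F (v '' E₂) ≤ V₂ := span_le.2 (by rintro _ ⟨e, he, rfl⟩; exact he.2)
  refine ⟨?_, ⟨?_, fun X hX => ?_⟩, ?_, ?_, fun X hX => ⟨fun hXM => ⟨?_, ?_⟩, fun hXM => ?_⟩⟩
  · ext e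
    exact ⟨fun he => ⟨he.1.1, he.1.2, he.2.2⟩, fun he => ⟨hT₁ he, hT₂ he⟩⟩
  · have := h₁.isFlat_inter V₂
    convert this using 1
    ext e
    exact ⟨fun he => ⟨hT₁ he, he.2.2⟩, fun he => ⟨he.1.1, he.1.2, he.2⟩⟩
  · have hXE := hX.subset_ground
    rw [h₁.eRk_eq hT₁, h₁.eRk_eq hXE, h₁.eRk_eq (Set.union_subset hT₁ hXE),
      h₁.eRk_eq (Set.inter_subset_right.trans hXE), hTX X hX, Set.image_union, span_union]
    exact_mod_cast (finrank_sup_add_finrank_inf_eq _ _).symm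
  · rw [restrict_restrict_eq _ hT₁, restrict_restrict_eq _ hT₂]
  · ext e
    exact ⟨hE e, fun h => h.elim And.left And.left⟩
  · refine (h₁.isFlat_iff Set.inter_subset_right).2 fun e he hv => ⟨?_, he⟩
    exact (h.isFlat_iff hX).1 hXM e he.1 (span_mono (Set.image_mono Set.inter_subset_left) hv)
  · refine (h₂.isFlat_iff Set.inter_subset_right).2 fun e he hv => ⟨?_, he⟩
    exact (h.isFlat_iff hX).1 hXM e he.1 (span_mono (Set.image_mono Set.inter_subset_left) hv)
  · refine (h.isFlat_iff hX).2 fun e he hv => ?_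
    obtain he' | he' := hE e he
    · exact hside E₁ E₂ X hX hT₁ hT₂ hXM.1 hXM.2 Set.inter_subset_left Set.inter_subset_left hE
        (fun x hx hx' => ⟨hs₁ hx, hs₂ hx'⟩) e he' hv
    · exact hside E₂ E₁ X hX hT₂ hT₁ hXM.2 hXM.1 Set.inter_subset_left Set.inter_subset_left
        (fun e he => (hE e he).symm) (fun x hx hx' => ⟨hs₁ hx', hs₂ hx⟩) e he' hv

/-- A simple matroid whose cone is chordal is built from projective geometries. -/
theorem Represents.isBuilt [FiniteDimensional F V] (hF : ∀ t : F, ∃ u : F, u ≠ 0 ∧ u ≠ t)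
    (hfin : M.E.Finite) (hM : M.IsSimple) (h : M.Represents F v)
    (hS : IsChordalCone F (cone F v M.E)) : M.IsBuilt F := by
  obtain ⟨n, hn⟩ : ∃ n, M.E.ncard = n := ⟨_, rfl⟩
  induction n using Nat.strong_induction_on generalizing M with
  | _ n ih =>
  subst hn
  by_cases hadd : ∀ a ∈ cone F v M.E, ∀ b ∈ cone F v M.E, a + b ∈ cone F v M.E
  · obtain ⟨n, hn⟩ := h.isProjectiveGeometry hM (span_cone (F := F) (v := v) (E := M.E) ▸
      hS.span_subset hadd)
    exact .projective M n hn
  obtain ⟨V₁, V₂, hV, hV₁, hV₂, hinf⟩ := hS.exists_separation hF hadd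
  have side : ∀ U : Submodule F V, ¬ cone F v M.E ⊆ U →
      (M ↾ (M.E ∩ {e | v e ∈ U})).IsBuilt F := by
    intro U hU
    have hsub : M.E ∩ {e | v e ∈ U} ⊆ M.E := Set.inter_subset_left
    refine ih _ (Set.ncard_lt_ncard (hsub.ssubset_of_not_subset fun hcon => hU ?_) hfin)
      (hfin.subset hsub) (hM.restrict hsub) (h.restrict hsub) ?_ rfl
    · exact cone_subset_iff.2 fun e he => (hcon he).2
    · rw [restrict_ground_eq, cone_inter]
      exact hS.inter U
  have hT : M.E ∩ {e | v e ∈ V₁ ⊓ V₂} ⊆ M.E ∩ {e | v e ∈ V₁} := fun e he => ⟨he.1, he.2.1⟩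
  have hTE : M.E ∩ {e | v e ∈ V₁ ⊓ V₂} ⊆ M.E := Set.inter_subset_left
  obtain ⟨n, hn⟩ := (h.restrict hTE).isProjectiveGeometry (hM.restrict hTE) (by
    rw [restrict_ground_eq, cone_inter, Set.inter_eq_right.2 hinf]
    refine (span_le (p := V₁ ⊓ V₂)).2 ?_
    rintro _ ⟨e, he, rfl⟩
    exact he.2)
  exact .glue M _ _ _ n (side V₁ hV₁) (side V₂ hV₂) (by rwa [restrict_restrict_eq _ hT])
    (h.isGenParallelConnection hV hinf)

lemma IsProjectiveGeometry.exists_represents {n : ℕ} (hM : M.IsProjectiveGeometry F n) :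
    ∃ w : α → Fin n → F, M.Represents F w ∧ M.IsSimple := by
  classical
  obtain ⟨φ, hφ⟩ := hM
  let w : α → Fin n → F := fun e => if h : e ∈ M.E then (φ ⟨e, h⟩).rep else 0
  have hw : ∀ e : M.E, w e = (φ e).rep := fun e => by simp [w]
  have hrep : M.Represents F w := by
    intro I hI
    obtain ⟨J, rfl⟩ : ∃ J : Set M.E, I = Subtype.val '' J :=
      ⟨Subtype.val ⁻¹' I, by rw [Subtype.image_preimage_coe, Set.inter_eq_right.2 hI]⟩
    rw [hφ, Projectivization.independent_iff]
    have e1 : LinearIndepOn F w (Subtype.val '' J) ↔ LinearIndepOn F (w ∘ Subtype.val) J :=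
      ⟨fun h => h.comp_of_image Subtype.val_injective.injOn, fun h => h.image_of_comp⟩
    rw [e1]
    have e2 : w ∘ Subtype.val = fun e : M.E => (φ e).rep := funext hw
    rw [e2]
    rfl
  refine ⟨w, hrep, fun x hx y hy => ?_⟩
  rw [hrep _ (Set.insert_subset hx (by simpa))]
  obtain rfl | hne := eq_or_ne x y
  · simp [hw ⟨x, hx⟩, Projectivization.rep_nonzero]
  · refine (LinearIndepOn.pair_iff w hne).2 fun c d hcd => ?_
    have h1 : φ ⟨x, hx⟩ ≠ φ ⟨y, hy⟩ := fun h => hne (congrArg Subtype.val (φ.injective h))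
    rw [hw ⟨x, hx⟩, hw ⟨y, hy⟩] at hcd
    exact LinearIndependent.pair_iff.1 (Projectivization.linearIndependent_pair_iff_ne.2 h1) c d hcd

/-- In any representation over the same finite field, a projective geometry consists of all points
of its span. -/
lemma IsProjectiveGeometry.span_subset_cone [Finite F] [FiniteDimensional F V] {n : ℕ}
    (hM : M.IsProjectiveGeometry F n) (h : M.Represents F v) :
    (span F (v '' M.E) : Set V) ⊆ cone F v M.E := by
  obtain ⟨w, hw, hs⟩ := hM.exists_represents
  obtain ⟨φ, -⟩ := hM
  set U := span F (v '' M.E) with hU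
  have hrank : Module.finrank F U ≤ Module.finrank F (Fin n → F) := by
    have := h.eRk_eq (subset_refl M.E)
    rw [hw.eRk_eq (subset_refl M.E)] at this
    have h1 : Module.finrank F (span F (w '' M.E)) = Module.finrank F U := by exact_mod_cast this
    rw [← h1]
    exact finrank_le _
  have : Finite U := Module.finite_of_finite F
  -- The span has rank at most `n`, so it has at most as many points as `M` has elements. Distinct
  -- elements give distinct points, so all points occur.
  have hcard : Nat.card (Projectivization F U) ≤ Nat.card M.E := by
    rw [Nat.card_congr φ, Projectivization.card'', Projectivization.card'',
      Module.natCard_eq_pow_finrank (K := F) (V := U),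
      Module.natCard_eq_pow_finrank (K := F) (V := Fin n → F)]
    exact Nat.div_le_div_right (Nat.sub_le_sub_right (Nat.pow_le_pow_right Nat.card_pos hrank) 1)
  have hmem : ∀ e : M.E, v e ∈ U := fun e => subset_span ⟨e, e.2, rfl⟩
  have hne : ∀ e : M.E, (⟨v e, hmem e⟩ : U) ≠ 0 := fun e => by
    simpa [Subtype.ext_iff] using h.ne_zero hs e.2
  have hinj : Function.Injective
      (fun e : M.E => Projectivization.mk F (⟨v e, hmem e⟩ : U) (hne e)) := by
    intro e f hef
    obtain ⟨a, ha⟩ := (Projectivization.mk_eq_mk_iff' F _ _ (hne e) (hne f)).1 hef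
    exact Subtype.ext (h.eq_of_smul hs e.2 f.2 (congrArg Subtype.val ha).symm)
  have hsurj := (hinj.bijective_of_nat_card_le hcard).2
  intro x hx
  obtain rfl | hx0 := eq_or_ne x 0
  · exact zero_mem_cone
  obtain ⟨e, he⟩ := hsurj (Projectivization.mk F (⟨x, hx⟩ : U) (by simpa [Subtype.ext_iff] using hx0))
  obtain ⟨a, ha⟩ := (Projectivization.mk_eq_mk_iff' F _ _ _ _).1 he.symm
  exact .inr ⟨e, e.2, a, (congrArg Subtype.val ha).symm⟩

/-- The closure `G` of `X` in `M₁` extends to a flat of `M` with the same trace on `M₁`: add the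
closure of `G ∩ T` in `M₂`, which creates nothing new in `T` because the two matroids agree there.
The hypotheses are symmetric and omit modularity, so the lemma applies to both parts. -/
lemma closure_iff_of_flats {T : Set α} (hT : M₁.E ∩ M₂.E = T)
    (hres : M₁ ↾ T = M₂ ↾ T) (hE : M.E = M₁.E ∪ M₂.E)
    (hflat : ∀ X ⊆ M.E, M.IsFlat X ↔ M₁.IsFlat (X ∩ M₁.E) ∧ M₂.IsFlat (X ∩ M₂.E))
    {X : Set α} (hX : X ⊆ M₁.E) {e : α} (he : e ∈ M₁.E) : e ∈ M₁.closure X ↔ e ∈ M.closure X := by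
  have hXM : X ⊆ M.E := hX.trans (hE ▸ Set.subset_union_left)
  constructor
  · intro heX
    rw [mem_closure_iff_forall_mem_isFlat _ hXM]
    intro G hG hXG
    have := ((hflat G hG.subset_ground).1 hG).1
    exact ((mem_closure_iff_forall_mem_isFlat _ hX).1 heX _ this (Set.subset_inter hXG hX)).1
  · intro heX
    set G := M₁.closure X with hG
    have hGf : M₁.IsFlat G := isFlat_closure X
    have hGT : G ∩ T ⊆ M₂.E := fun x hx => (hT ▸ hx.2 : x ∈ M₁.E ∩ M₂.E).2
    set H := M₂.closure (G ∩ T) with hH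
    have hHG : H ∩ M₁.E ⊆ G := by
      rintro y ⟨hy, hy1⟩
      have hyT : y ∈ T := hT ▸ ⟨hy1, mem_ground_of_mem_closure hy⟩
      have h2 : y ∈ (M₂ ↾ T).closure (G ∩ T) := by
        rw [restrict_closure_eq _ Set.inter_subset_right (hT ▸ Set.inter_subset_right)]
        exact ⟨hy, hyT⟩
      rw [← hres, restrict_closure_eq _ Set.inter_subset_right (hT ▸ Set.inter_subset_left)] at h2
      have := M₁.closure_subset_closure (Set.inter_subset_left (s := G) (t := T)) h2.1
      rwa [hGf.closure] at this
    have e1 : (G ∪ H) ∩ M₁.E = G := by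
      rw [Set.union_inter_distrib_right, Set.inter_eq_left.2 hGf.subset_ground,
        Set.union_eq_left.2 hHG]
    have e2 : (G ∪ H) ∩ M₂.E = H := by
      rw [Set.union_inter_distrib_right, Set.inter_eq_left.2 (M₂.closure_subset_ground _),
        Set.union_eq_right]
      intro y hy
      refine M₂.subset_closure _ hGT ⟨hy.1, hT ▸ ⟨hGf.subset_ground hy.1, hy.2⟩⟩
    have hGH : G ∪ H ⊆ M.E := by
      rw [hE]
      exact Set.union_subset_union hGf.subset_ground (M₂.closure_subset_ground _)
    have hf : M.IsFlat (G ∪ H) := (hflat _ hGH).2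
      ⟨by rw [e1]; exact hGf, by rw [e2]; exact isFlat_closure _⟩
    have := (mem_closure_iff_forall_mem_isFlat _ hXM).1 heX _ hf
      ((M₁.subset_closure X hX).trans Set.subset_union_left)
    rw [← e1]
    exact ⟨this, he⟩

/-- The parts of a represented generalized parallel connection span subspaces that meet in the span
of the common part. -/
lemma IsGenParallelConnection.inf_span_le [FiniteDimensional F V] {T : Set α}
    (hM : M.IsGenParallelConnection M₁ M₂ T) (h : M.Represents F v) (h₁ : M₁.Represents F v) :
    span F (v '' M₁.E) ⊓ span F (v '' M₂.E) ≤ span F (v '' T) := by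
  rintro x ⟨hx₁, hx₂⟩
  by_contra hx
  have hT₁ : T ⊆ M₁.E := hM.inter_eq ▸ Set.inter_subset_left
  -- Take `G` maximal among subspaces spanned by elements of `M₁` that contain the span of `T` and
  -- avoid `x`. Its elements together with all of `M₂` form a flat `X` of `M`. Enlarging `G` by any
  -- further `e` captures `x`, and since `x` is spanned by `M₂`, this puts `v e` into the span of
  -- `X`, contradicting flatness.
  obtain ⟨G, ⟨hTG, hxG, hG⟩, hmax⟩ := (wellFounded_gt (α := Submodule F V)).has_min
    {G | span F (v '' T) ≤ G ∧ x ∉ G ∧ G ≤ span F (v '' (M₁.E ∩ {e | v e ∈ G}))}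
    ⟨span F (v '' T), le_rfl, hx, span_mono (Set.image_mono fun e he =>
      ⟨hT₁ he, subset_span ⟨e, he, rfl⟩⟩)⟩
  set X := (M₁.E ∩ {e | v e ∈ G}) ∪ M₂.E with hX
  have hTX : ∀ e ∈ M₁.E, e ∈ M₂.E → v e ∈ G := fun e he he' =>
    hTG (subset_span ⟨e, hM.inter_eq ▸ ⟨he, he'⟩, rfl⟩)
  have hXE : X ⊆ M.E := by
    rw [hM.ground_eq]
    exact Set.union_subset_union_left _ Set.inter_subset_left
  have hXf : M.IsFlat X := by
    rw [hM.isFlat_iff X hXE]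
    constructor
    · convert h₁.isFlat_inter G using 1
      ext e
      constructor
      · rintro ⟨he | he, he'⟩
        · exact he
        · exact ⟨he', hTX e he' he⟩
      · exact fun he => ⟨.inl he, he.1⟩
    · rw [Set.inter_eq_right.2 Set.subset_union_right]
      exact M₂.ground_isFlat
  obtain ⟨e, he, heG⟩ : ∃ e ∈ M₁.E, v e ∉ G := by
    by_contra! hcon
    refine hxG ((span_le.2 ?_ : span F (v '' M₁.E) ≤ G) hx₁)
    rintro _ ⟨e, he, rfl⟩
    exact hcon e he
  have hxe : x ∈ G ⊔ span F {v e} := by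
    by_contra hcon
    refine hmax (G ⊔ span F {v e}) ⟨hTG.trans le_sup_left, hcon, sup_le (hG.trans ?_) ?_⟩ ?_
    · exact span_mono (Set.image_mono fun f hf =>
        ⟨hf.1, (le_sup_left : G ≤ G ⊔ span F {v e}) hf.2⟩)
    · rw [span_le, Set.singleton_subset_iff]
      exact subset_span ⟨e, ⟨he, (le_sup_right : _ ≤ G ⊔ span F {v e})
        (mem_span_singleton_self _)⟩, rfl⟩
    · exact SetLike.lt_iff_le_and_exists.2 ⟨le_sup_left, v e,
        (le_sup_right : _ ≤ G ⊔ span F {v e}) (mem_span_singleton_self _), heG⟩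
  obtain ⟨g, hg, y, hy, hgy⟩ := mem_sup.1 hxe
  obtain ⟨t, rfl⟩ := mem_span_singleton.1 hy
  have ht : t ≠ 0 := by
    rintro rfl
    exact hxG (by rw [← hgy]; simpa using hg)
  have hve : v e ∈ span F (v '' X) := by
    rw [← smul_mem_iff _ ht, ← add_sub_cancel_left g (t • v e), hgy]
    exact sub_mem (span_mono (Set.image_mono Set.subset_union_right) hx₂)
      (span_mono (Set.image_mono Set.subset_union_left) (hG hg))
  obtain h4 | h4 := (h.isFlat_iff hXE).1 hXf e (hM.ground_eq ▸ .inl he) hve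
  · exact heG h4.2
  · exact heG (hTX e he h4)

/-- The cone of a represented matroid built from projective geometries is chordal. -/
theorem IsBuilt.isChordalCone [Finite F] [FiniteDimensional F V] (hM : M.IsBuilt F)
    (h : M.Represents F v) : IsChordalCone F (cone F v M.E) := by
  induction hM with
  | projective M n hM =>
    have : cone F v M.E = (span F (v '' M.E) : Set V) :=
      subset_antisymm cone_subset_span (hM.span_subset_cone h)
    rw [this]
    exact .of_submodule _
  | glue M M₁ M₂ T n _ _ hT hM ih₁ ih₂ =>
    have hE₁ : M₁.E ⊆ M.E := hM.ground_eq ▸ Set.subset_union_left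
    have hE₂ : M₂.E ⊆ M.E := hM.ground_eq ▸ Set.subset_union_right
    have h₁ : M₁.Represents F v := .of_closure fun X hX e he => by
      rw [closure_iff_of_flats hM.inter_eq hM.restrict_eq hM.ground_eq hM.isFlat_iff hX he,
        h.mem_closure_iff (hX.trans hE₁) (hE₁ he)]
    have h₂ : M₂.Represents F v := .of_closure fun X hX e he => by
      rw [closure_iff_of_flats (M := M) (M₂ := M₁) (by rw [Set.inter_comm, hM.inter_eq])
        hM.restrict_eq.symm (by rw [Set.union_comm, hM.ground_eq])
        (fun X hX => (hM.isFlat_iff X hX).trans and_comm) hX he,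
        h.mem_closure_iff (hX.trans hE₂) (hE₂ he)]
    have hT₁ : T ⊆ M₁.E := hM.inter_eq ▸ Set.inter_subset_left
    have hT₂ : T ⊆ M₂.E := hM.inter_eq ▸ Set.inter_subset_right
    have hsub : (↑(span F (v '' M₁.E) ⊓ span F (v '' M₂.E)) : Set V) ⊆ cone F v T :=
      fun x hx => hT.span_subset_cone (h₁.restrict hT₁) (hM.inf_span_le h h₁ hx)
    rw [hM.ground_eq, cone_union]
    exact (ih₁ h₁).union (ih₂ h₂) cone_subset_span cone_subset_span
      (hsub.trans (cone_mono hT₁)) (hsub.trans (cone_mono hT₂))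

end

/-! ### Induced minors of uniform matroids of rank two and three -/

section

variable {α : Type*} {M N K : Matroid α}

lemma HasInducedMinor.trans (h : M.HasInducedMinor N) (h' : N.HasInducedMinor K) :
    M.HasInducedMinor K := by
  induction h' with
  | refl => exact h
  | restrict N X _ hX ih => exact .restrict N X ih hX
  | contract N N' C _ hC hN' ih => exact .contract N N' C ih hC hN'

lemma IsSimplification.ground_subset (h : N.IsSimplification M) : N.E ⊆ M.E := by
  obtain ⟨S, hS, rfl, -, -⟩ := h
  exact hS

lemma IsSimplification.indep (h : N.IsSimplification M) {I : Set α} (hI : N.Indep I) :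
    M.Indep I := by
  obtain ⟨S, hS, rfl, -, -⟩ := h
  exact hI.of_restrict

lemma IsSimple.isNonloop (hM : M.IsSimple) {e : α} (he : e ∈ M.E) : M.IsNonloop e := by
  simpa using hM e he e he

lemma IsSimplification.eq_of_isSimple (h : N.IsSimplification M) (hM : M.IsSimple) : N = M := by
  obtain ⟨S, hS, rfl, -, hpar⟩ := h
  have : S = M.E := by
    refine hS.antisymm fun e he => ?_
    obtain ⟨s, hs, hse⟩ := hpar e (hM.isNonloop he)
    obtain rfl | hd := ((hM.isNonloop (hS hs)).closure_eq_closure_iff_eq_or_dep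
      (hM.isNonloop he)).1 hse
    · exact hs
    · exact absurd (hM s (hS hs) e he) hd
  rw [this, restrict_ground_eq_self]

lemma HasInducedMinor.ground_subset (h : M.HasInducedMinor N) : N.E ⊆ M.E := by
  induction h with
  | refl => exact subset_rfl
  | restrict N X _ hX ih => exact hX.subset_ground.trans ih
  | contract N N' C _ hC hN' ih => exact (hN'.ground_subset.trans Set.sdiff_subset).trans ih

lemma IsUniform.isSimple {r n : ℕ} (h : M.IsUniform r n) (hr : 2 ≤ r) : M.IsSimple := by
  intro x hx y hy
  rw [h.2 _ (Set.insert_subset hx (by simpa))]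
  exact (Set.encard_insert_le _ _).trans (by rw [Set.encard_singleton]; exact_mod_cast hr)

lemma IsSimple.indep_of_encard_le_two (hM : M.IsSimple) {I : Set α} (hI : I ⊆ M.E)
    (h : I.encard ≤ 2) : M.Indep I := by
  obtain h | h := h.lt_or_eq
  · obtain rfl | ⟨x, hx⟩ := I.eq_empty_or_nonempty
    · exact M.empty_indep
    have hsub : I.Subsingleton := by
      rw [← Set.encard_le_one_iff_subsingleton]
      exact Order.le_of_lt_add_one (by simpa [one_add_one_eq_two] using h)
    rw [hsub.eq_singleton_of_mem hx]
    simpa using hM.isNonloop (hI hx)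
  · obtain ⟨x, y, -, rfl⟩ := Set.encard_eq_two.1 h
    exact hM x (hI (by simp)) y (hI (by simp))

lemma IsSimple.isUniform_two (hM : M.IsSimple) {n : ℕ} (hn : M.E.encard = n)
    (h : ∀ I, M.Indep I → I.encard ≤ 2) : M.IsUniform 2 n :=
  ⟨hn, fun _ hI => ⟨fun hI' => h _ hI', hM.indep_of_encard_le_two hI⟩⟩

lemma IsUniform.eq_ground_or_encard_lt {r n : ℕ} (h : M.IsUniform r n) {X : Set α}
    (hX : M.IsFlat X) : X = M.E ∨ X.encard < r := by
  by_contra! hcon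
  obtain ⟨I, hIX, hI⟩ := Set.exists_subset_encard_eq hcon.2
  have hIi : M.Indep I := (h.2 I (hIX.trans hX.subset_ground)).2 hI.le
  refine hcon.1 (hX.subset_ground.antisymm fun e he => ?_)
  by_contra heX
  have heI : e ∉ I := fun h => heX (hIX h)
  have hcl : e ∉ M.closure I := fun hcl =>
    heX (by rw [← hX.closure]; exact M.closure_subset_closure hIX hcl)
  have hins := (hIi.notMem_closure_iff_of_notMem heI he).1 hcl
  have := (h.2 _ hins.subset_ground).1 hins
  rw [Set.encard_insert_of_notMem heI, hI] at this
  exact absurd this (by norm_cast; omega)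

lemma IsUniform.contract_singleton {r n : ℕ} (h : M.IsUniform (r + 1) (n + 1)) {c : α}
    (hc : c ∈ M.E) : (M ／ {c}).IsUniform r n := by
  have hci : M.Indep {c} := (h.2 _ (by simpa)).2 (by simp)
  refine ⟨?_, fun I hI => ?_⟩
  · rw [contract_ground]
    have := Set.encard_sdiff_singleton_add_one hc
    rw [h.1] at this
    push_cast at this
    exact WithTop.add_right_cancel ENat.one_ne_top this
  · have hcI : c ∉ I := fun hcI => (hI hcI).2 rfl
    rw [hci.contract_indep_iff, and_iff_right (by simpa using hcI), Set.union_singleton,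
      h.2 _ (Set.insert_subset hc (hI.trans Set.sdiff_subset)), Set.encard_insert_of_notMem hcI]
    push_cast
    exact ENat.add_le_add_iff_right (by simp)

/-- Contract `D` first and the rest of `C` afterwards; independence after the second step implies
independence before it. Only an independent part of `C` is needed to bound the rank of the
contraction. -/
lemma indep_union_of_contract {C D I : Set α} (hD : M.Indep D) (hDC : D ⊆ C)
    (hI : (M ／ C).Indep I) : M.Indep (I ∪ D) ∧ Disjoint I D := by
  rw [← Set.union_sdiff_cancel hDC, ← contract_contract] at hI
  have := hD.contract_indep_iff.1 hI.of_contract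
  exact ⟨this.2, this.1⟩

/-- Contracting `r - 1` elements of a uniform matroid of rank `r` leaves at most one point. -/
lemma IsUniform.subsingleton_of_contract {r n : ℕ} (h : M.IsUniform (r + 1) n) {C D : Set α}
    (hD : D.encard = r) (hDC : D ⊆ C) (hC : C ⊆ M.E) (hN : N.IsSimplification (M ／ C)) :
    N.E.Subsingleton := by
  have hDi : M.Indep D := (h.2 _ (hDC.trans hC)).2 (by rw [hD]; norm_cast; omega)
  intro x hx y hy
  by_contra hne
  obtain ⟨h1, h2⟩ := indep_union_of_contract hDi hDC (hN.indep (hN.isSimple x hx y hy))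
  have := (h.2 _ h1.subset_ground).1 h1
  rw [Set.encard_union_eq h2, hD, Set.encard_pair hne] at this
  norm_cast at this
  omega

lemma IsUniform.restrict_two {n : ℕ} (h : M.IsUniform 2 n) {X : Set α} (hX : M.IsFlat X) :
    M ↾ X = M ∨ ((M ↾ X).IsSimple ∧ (M ↾ X).E.Subsingleton) := by
  obtain rfl | hlt := h.eq_ground_or_encard_lt hX
  · exact .inl (restrict_ground_eq_self M)
  · refine .inr ⟨(h.isSimple le_rfl).restrict hX.subset_ground, ?_⟩
    rw [restrict_ground_eq, ← Set.encard_le_one_iff_subsingleton]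
    exact Order.le_of_lt_add_one (by simpa [one_add_one_eq_two] using hlt)

lemma IsUniform.contract_two {n : ℕ} (h : M.IsUniform 2 n) {C : Set α} (hC : C ⊆ M.E)
    (hN : N.IsSimplification (M ／ C)) : N = M ∨ (N.IsSimple ∧ N.E.Subsingleton) := by
  obtain rfl | ⟨c, hc⟩ := C.eq_empty_or_nonempty
  · rw [contract_empty] at hN
    exact .inl (hN.eq_of_isSimple (h.isSimple le_rfl))
  · exact .inr ⟨hN.isSimple, IsUniform.subsingleton_of_contract (r := 1) h (D := {c}) (by simp)
      (by simpa) hC hN⟩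

/-- The proper induced minors of a line have at most one point. -/
lemma IsUniform.hasInducedMinor_two {n : ℕ} (h : M.IsUniform 2 n) (hN : M.HasInducedMinor N) :
    N = M ∨ (N.IsSimple ∧ N.E.Subsingleton) := by
  induction hN with
  | refl => exact .inl rfl
  | restrict N X _ hX ih =>
    obtain rfl | ⟨hs, hE⟩ := ih
    · exact h.restrict_two hX
    · exact .inr ⟨hs.restrict hX.subset_ground, hE.anti hX.subset_ground⟩
  | contract N N' C _ hC hN' ih =>
    obtain rfl | ⟨hs, hE⟩ := ih
    · exact h.contract_two hC hN'
    · exact .inr ⟨hN'.isSimple, hE.anti (hN'.ground_subset.trans Set.sdiff_subset)⟩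

/-- The proper induced minors of a uniform matroid of rank three are lines and points. -/
lemma IsUniform.hasInducedMinor_three {n : ℕ} (h : M.IsUniform 3 (n + 1))
    (hN : M.HasInducedMinor N) :
    N = M ∨ N.IsUniform 2 2 ∨ N.IsUniform 2 n ∨ (N.IsSimple ∧ N.E.Subsingleton) := by
  induction hN with
  | refl => exact .inl rfl
  | restrict N X _ hX ih =>
    obtain rfl | h2 | h2 | ⟨hs, hE⟩ := ih
    · obtain rfl | hlt := h.eq_ground_or_encard_lt hX
      · exact .inl (restrict_ground_eq_self _)
      have hle : X.encard ≤ 2 := Order.le_of_lt_add_one (by simpa [two_add_one_eq_three] using hlt)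
      have hs := (h.isSimple (by norm_num)).restrict hX.subset_ground
      obtain hlt | heq := hle.lt_or_eq
      · refine .inr (.inr (.inr ⟨hs, ?_⟩))
        rw [restrict_ground_eq, ← Set.encard_le_one_iff_subsingleton]
        exact Order.le_of_lt_add_one (by simpa [one_add_one_eq_two] using hlt)
      · exact .inr (.inl (hs.isUniform_two (by simpa using heq) fun I hI =>
          (Set.encard_le_encard hI.subset_ground).trans heq.le))
    · obtain h3 | h3 := h2.restrict_two hX
      · exact .inr (.inl (by rw [h3]; exact h2))
      · exact .inr (.inr (.inr h3))
    · obtain h3 | h3 := h2.restrict_two hX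
      · exact .inr (.inr (.inl (by rw [h3]; exact h2)))
      · exact .inr (.inr (.inr h3))
    · exact .inr (.inr (.inr ⟨hs.restrict hX.subset_ground, hE.anti hX.subset_ground⟩))
  | contract N N' C _ hC hN' ih =>
    obtain rfl | h2 | h2 | ⟨hs, hE⟩ := ih
    · obtain rfl | ⟨c, hc⟩ := C.eq_empty_or_nonempty
      · rw [contract_empty] at hN'
        exact .inl (hN'.eq_of_isSimple (h.isSimple (by norm_num)))
      by_cases hsub : C ⊆ {c}
      · obtain rfl : C = {c} := hsub.antisymm (by simpa)
        have h2 := IsUniform.contract_singleton (r := 2) h (hC hc)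
        rw [hN'.eq_of_isSimple (h2.isSimple le_rfl)]
        exact .inr (.inr (.inl h2))
      · obtain ⟨d, hd, hdc⟩ := Set.not_subset.1 hsub
        exact .inr (.inr (.inr ⟨hN'.isSimple, IsUniform.subsingleton_of_contract (r := 2) h
          (D := {c, d}) (by rw [Set.encard_pair (Ne.symm hdc)]; rfl)
          (Set.insert_subset hc (by simpa)) hC hN'⟩))
    · obtain h3 | h3 := h2.contract_two hC hN'
      · exact .inr (.inl (by rw [h3]; exact h2))
      · exact .inr (.inr (.inr h3))
    · obtain h3 | h3 := h2.contract_two hC hN'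
      · exact .inr (.inr (.inl (by rw [h3]; exact h2)))
      · exact .inr (.inr (.inr h3))
    · exact .inr (.inr (.inr ⟨hN'.isSimple, hE.anti (hN'.ground_subset.trans Set.sdiff_subset)⟩))

end

/-! ### Induced minors of represented matroids, and counting on a line -/

section

variable {α F V : Type*} [Field F] [AddCommGroup V] [Module F V] {v : α → V} {M N : Matroid α}

lemma cone_sdiff {E C : Set α} (h : ∀ e ∈ C, v e = 0) :
    cone F v (E \ C) = cone F v E := by
  refine subset_antisymm (cone_mono Set.sdiff_subset) ?_
  rintro x (rfl | ⟨e, he, t, rfl⟩)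
  · exact zero_mem_cone
  by_cases heC : e ∈ C
  · rw [h e heC, smul_zero]
    exact zero_mem_cone
  · exact .inr ⟨e, ⟨he, heC⟩, t, rfl⟩

lemma Represents.cone_contract {C : Set α} {f : V →ₗ[F] V}
    (hf : LinearMap.ker f = span F (v '' C)) :
    cone F (f ∘ v) (M ／ C).E = f '' cone F v M.E := by
  rw [contract_ground, cone_sdiff, cone_comp]
  intro e he
  have : v e ∈ LinearMap.ker f := by
    rw [hf]
    exact subset_span ⟨e, he, rfl⟩
  exact this

/-- Induced minors of a represented matroid are represented, and a chordal cone stays chordal. -/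
lemma HasInducedMinor.exists_represents (h : M.HasInducedMinor N) (hv : M.Represents F v) :
    ∃ v' : α → V, N.Represents F v' ∧
      (IsChordalCone F (cone F v M.E) → IsChordalCone F (cone F v' N.E)) := by
  induction h with
  | refl => exact ⟨v, hv, id⟩
  | restrict N X _ hX ih =>
    obtain ⟨w, hw, hc⟩ := ih
    refine ⟨w, hw.restrict hX.subset_ground, fun h => ?_⟩
    rw [restrict_ground_eq, hw.eq_inter_of_isFlat hX, cone_inter]
    exact (hc h).inter _
  | contract N N' C _ hC hN' ih =>
    obtain ⟨w, hw, hc⟩ := ih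
    obtain ⟨f, hf⟩ := exists_ker_eq (span F (w '' C))
    refine ⟨f ∘ w, hN'.represents (hw.contract hC hf), fun h => ?_⟩
    rw [hN'.cone_eq (hw.contract hC hf), Represents.cone_contract hf]
    refine (hc h).map ?_
    intro x hx
    rw [hf] at hx
    refine span_mono ?_ hx
    rintro _ ⟨e, he, rfl⟩
    exact ⟨mem_cone (hC he), hf ▸ subset_span ⟨e, he, rfl⟩⟩

/-- A vector in the plane of `a` and `b` is a multiple of one of more than `|F|` pairwise
non-proportional vectors of this plane. -/
lemma exists_smul_eq_of_card_lt [Finite F] {X : Set α} (hX : (Nat.card F : ℕ∞) < X.encard)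
    (hv0 : ∀ x ∈ X, v x ≠ 0) (hv : ∀ x ∈ X, ∀ y ∈ X, ∀ t : F, v x = t • v y → x = y)
    {a b p : V} (hXab : ∀ x ∈ X, ∃ r s : F, v x = r • a + s • b)
    (hp : ∃ r s : F, p = r • a + s • b) : ∃ x ∈ X, ∃ r : F, p = r • v x := by
  classical
  obtain ⟨p₁, p₂, rfl⟩ := hp
  by_cases hp0 : p₁ • a + p₂ • b = 0
  · obtain ⟨x, hx⟩ : X.Nonempty := by
      rw [← Set.encard_pos]
      exact (zero_le).trans_lt hX
    exact ⟨x, hx, 0, by rw [hp0, zero_smul]⟩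
  by_contra! hcon
  choose! r s hrs using hXab
  -- coordinates of the points with respect to `p` and a second vector
  obtain ⟨c, α', β', γ', δ', ha, hb⟩ : ∃ (c : V) (α' β' γ' δ' : F),
      a = α' • (p₁ • a + p₂ • b) + β' • c ∧ b = γ' • (p₁ • a + p₂ • b) + δ' • c := by
    by_cases h1 : p₁ = 0
    · have h2 : p₂ ≠ 0 := by rintro rfl; simp [h1] at hp0
      exact ⟨a, 0, 1, p₂⁻¹, 0, by module, by simp [h1, smul_smul, h2]⟩
    · refine ⟨b, p₁⁻¹, -(p₁⁻¹ * p₂), 0, 1, ?_, by module⟩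
      rw [smul_add, smul_smul, smul_smul, inv_mul_cancel₀ h1]
      module
  set p := p₁ • a + p₂ • b
  clear_value p
  -- As no `v x` is proportional to `p`, each has a nonzero coordinate at `c` and can be normalised
  -- there. The remaining coordinate `t` determines the point, so there are at most `|F|` of them.
  have hx : ∀ x ∈ X, ∃ t u : F, u ≠ 0 ∧ v x = u • (t • p + c) := by
    intro x hx
    have e1 : v x = (r x * α' + s x * γ') • p + (r x * β' + s x * δ') • c := by
      rw [hrs x hx]
      conv_lhs => rw [ha, hb]
      module
    have hne : r x * β' + s x * δ' ≠ 0 := by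
      intro h0
      rw [h0, zero_smul, add_zero] at e1
      have hne' : r x * α' + s x * γ' ≠ 0 := by
        intro h0
        exact hv0 x hx (by rw [e1, h0, zero_smul])
      exact hcon x hx (r x * α' + s x * γ')⁻¹
        (by rw [e1, smul_smul, inv_mul_cancel₀ hne', one_smul])
    refine ⟨(r x * β' + s x * δ')⁻¹ * (r x * α' + s x * γ'), _, hne, ?_⟩
    rw [e1, smul_add, smul_smul _ _ p, ← mul_assoc, mul_inv_cancel₀ hne, one_mul]
  choose! t u hu htu using hx
  have hinj : Set.InjOn t X := by
    intro x hx y hy hxy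
    refine hv x hx y hy (u x * (u y)⁻¹) ?_
    rw [htu x hx, htu y hy, hxy, smul_smul, mul_assoc, inv_mul_cancel₀ (hu y hy), mul_one]
  have h1 := hinj.encard_image
  have h2 : (t '' X).encard ≤ Nat.card F := by
    refine (Set.encard_le_encard (Set.subset_univ _)).trans ?_
    rw [Set.encard_univ, ENat.card_eq_coe_natCard]
  exact absurd hX (not_lt.2 (h1 ▸ h2))

end

/-! ### Obstructions do not have chordal cones -/

section

variable {α F V : Type*} [Field F] [AddCommGroup V] [Module F V] {v : α → V} {M N : Matroid α}

lemma Represents.indepMod (h : M.Represents F v) {x y : α} (hxy : x ≠ y) (hi : M.Indep {x, y}) :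
    IndepMod (⊥ : Submodule F V) (v x) (v y) := fun r s hrs =>
  (LinearIndepOn.pair_iff v hxy).1 ((h _ hi.subset_ground).1 hi) r s hrs

lemma Represents.indepModThree (h : M.Represents F v) {x y z : α} (hxy : x ≠ y) (hxz : x ≠ z)
    (hyz : y ≠ z) (hi : M.Indep {x, y, z}) :
    IndepModThree (⊥ : Submodule F V) (v x) (v y) (v z) := by
  intro r s t hrst
  have h1 := (h _ hi.subset_ground).1 hi
  have h2 : LinearIndepOn F v {y, z} := h1.mono (Set.subset_insert _ _)
  have hx : v x ∉ span F (v '' {y, z}) := by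
    rw [linearIndepOn_insert (by simp [hxy, hxz])] at h1
    exact h1.2
  have hr : r = 0 := by
    by_contra hr
    refine hx ?_
    rw [Set.image_pair, mem_span_pair]
    refine ⟨-(r⁻¹ * s), -(r⁻¹ * t), ?_⟩
    have : r⁻¹ • (r • v x + s • v y + t • v z) = 0 := by rw [(mem_bot F).1 hrst, smul_zero]
    rw [smul_add, smul_add, smul_smul, inv_mul_cancel₀ hr, one_smul, smul_smul, smul_smul] at this
    rw [← sub_eq_zero, ← neg_eq_zero, ← this]
    module
  subst hr
  refine ⟨rfl, (LinearIndepOn.pair_iff v hyz).1 h2 s t ?_⟩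
  simpa using hrst

/-- Three collinear points of a simple matroid. -/
lemma Represents.exists_smul_add_smul_eq (h : M.Represents F v) (hM : M.IsSimple) {x y z : α}
    (hx : x ∈ M.E) (hy : y ∈ M.E) (hz : z ∈ M.E) (hxz : x ≠ z)
    (hyz : y ≠ z) (hd : ¬ M.Indep {x, y, z}) :
    ∃ r s : F, r ≠ 0 ∧ s ≠ 0 ∧ v z = r • v x + s • v y := by
  have h1 := (h {x, y} (Set.insert_subset hx (by simpa))).1 (hM x hx y hy)
  rw [h _ (Set.insert_subset hx (Set.insert_subset hy (by simpa)))] at hd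
  have hz' : v z ∈ span F (v '' {x, y}) := by
    by_contra hcon
    refine hd ?_
    have := h1.insert hcon
    rwa [Set.insert_comm z, Set.pair_comm z] at this
  rw [Set.image_pair, mem_span_pair] at hz'
  obtain ⟨r, s, hrs⟩ := hz'
  refine ⟨r, s, ?_, ?_, hrs.symm⟩
  · rintro rfl
    exact hyz (h.eq_of_smul hM hz hy (by rw [← hrs, zero_smul, zero_add])).symm
  · rintro rfl
    exact hxz (h.eq_of_smul hM hz hx (by rw [← hrs, zero_smul, add_zero])).symm

lemma Represents.encard_le (h : M.Represents F v) {I : Set α} (hI : M.Indep I)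
    {s : Set V} (hs : s.Finite) (hIs : ∀ e ∈ I, v e ∈ span F s) : I.encard ≤ s.encard := by
  have h1 := ((h I hI.subset_ground).1 hI)
  have := hs.fintype
  have : FiniteDimensional F (span F s) := FiniteDimensional.span_of_finite F hs
  let w : I → span F s := fun e => ⟨v e, hIs e e.2⟩
  have hw : LinearIndependent F w := by
    apply LinearIndependent.of_comp (span F s).subtype
    exact h1
  have := hw.finite
  have := Fintype.ofFinite I
  have h2 := hw.fintype_card_le_finrank.trans (finrank_span_le_card s)
  rw [Set.encard_eq_coe_toFinset_card, Set.encard_eq_coe_toFinset_card, Set.toFinset_card]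
  exact_mod_cast h2

lemma encard_pair_le (a b : α) : ({a, b} : Set α).encard ≤ 2 :=
  (Set.encard_insert_le _ _).trans (by rw [Set.encard_singleton, one_add_one_eq_two])

lemma encard_triple_le (a b c : α) : ({a, b, c} : Set α).encard ≤ 3 := by
  refine (Set.encard_insert_le _ _).trans ?_
  rw [← two_add_one_eq_three]
  gcongr
  exact encard_pair_le _ _

lemma exists_three {X : Set α} (h : 3 ≤ X.encard) :
    ∃ x ∈ X, ∃ y ∈ X, ∃ z ∈ X, x ≠ y ∧ x ≠ z ∧ y ≠ z := by
  obtain ⟨Y, hY, hY3⟩ := Set.exists_subset_encard_eq h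
  obtain ⟨x, y, z, h1, h2, h3, rfl⟩ := Set.encard_eq_three.1 hY3
  exact ⟨x, hY (by simp), y, hY (by simp), z, hY (by simp), h1, h2, h3⟩

lemma IsUniform.indep_three {r n : ℕ} (h : M.IsUniform r n) (hr : 3 ≤ r) {x y z : α}
    (hx : x ∈ M.E) (hy : y ∈ M.E) (hz : z ∈ M.E) : M.Indep {x, y, z} := by
  rw [h.2 _ (Set.insert_subset hx (Set.insert_subset hy (by simpa)))]
  exact (encard_triple_le _ _ _).trans (by exact_mod_cast hr)

lemma IsUniform.not_indep {r n : ℕ} (h : M.IsUniform r n) {I : Set α} (hI : r < I.encard) :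
    ¬ M.Indep I := fun hI' => absurd ((h.2 _ hI'.subset_ground).1 hI') (not_le.2 hI)

lemma IsUniform.exists_smul_add_smul_eq {n : ℕ} (h : M.IsUniform 2 n) (hv : M.Represents F v)
    {x y z : α} (hx : x ∈ M.E) (hy : y ∈ M.E) (hz : z ∈ M.E) (hxy : x ≠ y) (hxz : x ≠ z)
    (hyz : y ≠ z) : ∃ r s : F, r ≠ 0 ∧ s ≠ 0 ∧ v z = r • v x + s • v y := by
  refine hv.exists_smul_add_smul_eq (h.isSimple le_rfl) hx hy hz hxz hyz (h.not_indep ?_)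
  rw [Set.encard_eq_three.2 ⟨x, y, z, hxy, hxz, hyz, rfl⟩]
  norm_num

lemma IsUniform.exists_eq_smul_add_smul {n : ℕ} (h : M.IsUniform 2 n) (hv : M.Represents F v)
    {x y e : α} (hx : x ∈ M.E) (hy : y ∈ M.E) (hxy : x ≠ y) (he : e ∈ M.E) :
    ∃ r s : F, v e = r • v x + s • v y := by
  by_cases hex : x = e
  · exact ⟨1, 0, by rw [hex]; module⟩
  by_cases hey : y = e
  · exact ⟨0, 1, by rw [hey]; module⟩
  obtain ⟨r, s, -, -, h⟩ := h.exists_smul_add_smul_eq hv hx hy he hxy hex hey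
  exact ⟨r, s, h⟩

/-- A line with at least three points of a chordal matroid has all points over `F`. -/
lemma IsUniform.card_lt_of_isChordalCone [Finite F] {n : ℕ} (h : M.IsUniform 2 n) (hn : 2 < n)
    (hv : M.Represents F v) (hS : IsChordalCone F (cone F v M.E)) : Nat.card F < n := by
  have hM := h.isSimple le_rfl
  obtain ⟨x, hx, y, hy, z, hz, hxy, hxz, hyz⟩ := exists_three (X := M.E)
    (by rw [h.1]; exact_mod_cast hn)
  obtain ⟨r, s, hr, hs, hrs⟩ := h.exists_smul_add_smul_eq hv hx hy hz hxy hxz hyz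
  have hfull := hS.fullLine (mem_cone hx) (mem_cone hy) hr hs (hrs ▸ mem_cone hz)
  have hi := hv.indepMod hxy (hM x hx y hy)
  have key : ∀ t : F, ∃ e ∈ M.E, ∃ u : F, v x + t • v y = u • v e := by
    intro t
    obtain h0 | ⟨e, he, u, hu⟩ := hfull 1 t
    · exact absurd (hi 1 t ((mem_bot F).2 h0)).1 one_ne_zero
    · exact ⟨e, he, u, by rw [← hu, one_smul]⟩
  choose g hg u hu using key
  have hu0 : ∀ t, u t ≠ 0 := by
    intro t h0
    have := hu t
    rw [h0, zero_smul] at this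
    exact one_ne_zero (hi 1 t (by simpa using this)).1
  have hinj : Function.Injective g := by
    intro t t' htt
    have h1 : u t' • (v x + t • v y) = u t • (v x + t' • v y) := by
      rw [hu t, hu t', htt, smul_smul, smul_smul, mul_comm]
    have h2 := hi (u t' - u t) (u t' * t - u t * t') (by
      rw [mem_bot, ← sub_eq_zero.2 h1]; module)
    have h3 := sub_eq_zero.1 h2.1
    have h4 := h2.2
    rw [h3, ← mul_sub] at h4
    exact sub_eq_zero.1 ((mul_eq_zero.1 h4).resolve_left (hu0 t))
  -- The points of the form `v x + t • v y` number `|F|`; the element `y` is one more, which gives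
  -- the strict inequality.
  have hy' : y ∉ Set.range g := by
    rintro ⟨t, ht⟩
    have h1 := hi 1 (t - u t) (by
      have := hu t
      rw [ht] at this
      rw [mem_bot, one_smul, sub_smul, ← this]; abel)
    exact one_ne_zero h1.1
  have hsub : insert y (Set.range g) ⊆ M.E := by
    refine Set.insert_subset hy ?_
    rintro _ ⟨t, rfl⟩
    exact hg t
  have := Set.encard_le_encard hsub
  rw [Set.encard_insert_of_notMem hy', h.1, ← Set.image_univ, hinj.encard_image, Set.encard_univ,
    ENat.card_eq_coe_natCard] at this
  exact_mod_cast this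

/-- Any four elements form a circuit, so the fourth vector is a combination of the other three with
nonzero coefficients. The plane condition would then produce three collinear elements, but any three
elements are independent. -/
lemma IsUniform.not_isChordalCone {n : ℕ} (h : M.IsUniform 3 n) (hn : 3 < n)
    (hv : M.Represents F v) : ¬ IsChordalCone F (cone F v M.E) := by
  intro hS
  have hM := h.isSimple (by norm_num)
  obtain ⟨x, hx, y, hy, z, hz, hxy, hxz, hyz⟩ := exists_three (X := M.E)
    (by rw [h.1]; exact_mod_cast hn.le)
  have hI := h.indep_three le_rfl hx hy hz
  have h3 : ({x, y, z} : Set α).encard = 3 := Set.encard_eq_three.2 ⟨x, y, z, hxy, hxz, hyz, rfl⟩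
  obtain ⟨w, hw, hw'⟩ : ∃ w ∈ M.E, w ∉ ({x, y, z} : Set α) := by
    by_contra! hcon
    have := Set.encard_le_encard hcon
    rw [h.1, h3] at this
    norm_cast at this
    omega
  have hdep : ¬ M.Indep (insert w {x, y, z}) := h.not_indep (by
    rw [Set.encard_insert_of_notMem hw', h3]; norm_num)
  have hspan : v w ∈ span F (v '' {x, y, z}) := by
    by_contra hcon
    exact hdep ((hv _ (Set.insert_subset hw hI.subset_ground)).2
      (((hv _ hI.subset_ground).1 hI).insert hcon))
  simp only [Set.mem_insert_iff, Set.mem_singleton_iff, not_or] at hw'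
  rw [Set.image_insert_eq, Set.image_pair, mem_span_triple] at hspan
  obtain ⟨r, s, t, hrst⟩ := hspan
  have h1 : ∀ {e f g : α}, e ∈ M.E → f ∈ M.E → g ∈ M.E → e ≠ f → e ≠ g → f ≠ g →
      IndepModThree (⊥ : Submodule F V) (v e) (v f) (v g) := fun he hf hg hef heg hfg =>
    hv.indepModThree hef heg hfg (h.indep_three le_rfl he hf hg)
  have hr : r ≠ 0 := by
    rintro rfl
    exact one_ne_zero (h1 hw hy hz hw'.2.1 hw'.2.2 hyz 1 (-s) (-t)
      (by rw [mem_bot, ← hrst]; module)).1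
  have hs : s ≠ 0 := by
    rintro rfl
    exact one_ne_zero (h1 hw hx hz hw'.1 hw'.2.2 hxz 1 (-r) (-t)
      (by rw [mem_bot, ← hrst]; module)).1
  have ht : t ≠ 0 := by
    rintro rfl
    exact one_ne_zero (h1 hw hx hy hw'.1 hw'.2.1 hxy 1 (-r) (-s)
      (by rw [mem_bot, ← hrst]; module)).1
  obtain ⟨X, hX, Y, hY, Z, hZ, -, -, hXYZ, hXY⟩ := hS.plane ⊥ (by simp [Spanned])
    (r • v x) (smul_mem_cone (mem_cone hx) r) (s • v y) (smul_mem_cone (mem_cone hy) s)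
    (t • v z) (smul_mem_cone (mem_cone hz) t) (v w) (mem_cone hw)
    (by rw [mem_bot, ← hrst, sub_self]) (by
      intro r' s' t' h'
      rw [smul_smul, smul_smul, smul_smul] at h'
      have := h1 hx hy hz hxy hxz hyz _ _ _ h'
      simpa [hr, hs, ht] using this)
  rw [mem_bot, sub_eq_zero] at hXYZ
  obtain rfl | ⟨e, he, a, rfl⟩ := hX
  · exact one_ne_zero (hXY 1 0 (by simp)).1
  obtain rfl | ⟨f, hf, b, rfl⟩ := hY
  · exact one_ne_zero (hXY 0 1 (by simp)).2
  have ha : a ≠ 0 := by rintro rfl; exact one_ne_zero (hXY 1 0 (by simp)).1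
  have hb : b ≠ 0 := by rintro rfl; exact one_ne_zero (hXY 0 1 (by simp)).2
  have hef : e ≠ f := by
    rintro rfl
    exact hb (hXY b (-a) (by rw [mem_bot]; module)).1
  have hef' := hv.indepMod hef (hM e he f hf)
  obtain rfl | ⟨g, hg, c, rfl⟩ := hZ
  · exact ha (hef' a b ((mem_bot F).2 hXYZ)).1
  by_cases heg : e = g
  · subst heg
    exact hb (hef' (a - c) b (by rw [mem_bot, ← sub_eq_zero.2 hXYZ]; module)).2
  by_cases hfg : f = g
  · subst hfg
    exact ha (hef' a (b - c) (by rw [mem_bot, ← sub_eq_zero.2 hXYZ]; module)).1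
  exact ha (h1 he hf hg hef heg hfg a b (-c) (by
    rw [mem_bot, ← sub_eq_zero.2 hXYZ]; module)).1

lemma IsObstruction.not_isChordalCone [Finite F] (hq : 2 < Nat.card F)
    (h : M.IsObstruction (Nat.card F)) (hv : M.Represents F v) :
    ¬ IsChordalCone F (cone F v M.E) := by
  obtain ⟨k, hk, hkq, h⟩ | h := h
  · exact fun hS => absurd (h.card_lt_of_isChordalCone hk hv hS) (not_lt.2 hkq)
  · exact h.not_isChordalCone (by omega) hv

/-- A line represented over `F` has at most `|F| + 1` points. -/
lemma IsUniform.le_card_add_one [Finite F] {n : ℕ} (h : M.IsUniform 2 n)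
    (hv : M.Represents F v) : n ≤ Nat.card F + 1 := by
  by_contra! hn
  have hM := h.isSimple le_rfl
  have hq : 2 ≤ Nat.card F := Finite.one_lt_card
  obtain ⟨x, hx, y, hy, z, hz, hxy, hxz, hyz⟩ := exists_three (X := M.E)
    (by rw [h.1]; norm_cast; omega)
  have hp : ∀ e ∈ M.E, ∃ r s : F, v e = r • v x + s • v y := fun e he =>
    h.exists_eq_smul_add_smul hv hx hy hxy he
  -- Even without `z` there are more than `|F|` points, so `z` would be parallel to another one.
  obtain ⟨e, he, r, hr⟩ := exists_smul_eq_of_card_lt (F := F) (v := v) (X := M.E \ {z})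
    (a := v x) (b := v y) (p := v z) (by
      have := Set.encard_sdiff_singleton_add_one hz
      rw [h.1] at this
      have h2 : (Nat.card F : ℕ∞) + 1 < (M.E \ {z}).encard + 1 := by
        rw [this]; exact_mod_cast hn
      exact lt_of_add_lt_add_right h2)
    (fun e he => hv.ne_zero hM he.1) (fun e he f hf t => hv.eq_of_smul hM he.1 hf.1)
    (fun e he => hp e he.1) (hp z hz)
  exact he.2 (hv.eq_of_smul hM hz he.1 hr).symm

end

/-! ### Excluding the obstructions makes the cone chordal -/

section

variable {α F V : Type*} [Field F] [AddCommGroup V] [Module F V] {v : α → V} {M N : Matroid α}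

lemma IsSimple.isSimplification_self (hM : M.IsSimple) : M.IsSimplification M :=
  ⟨M.E, subset_rfl, (restrict_ground_eq_self M).symm, hM, fun e he => ⟨e, he.mem_ground, rfl⟩⟩

/-- This is the line condition modulo zero. In the nondegenerate case the flat spanned by the two
points is a line with at least three elements. It is not an obstruction, so it has more than `|F|`
elements and contains every point of its span. -/
lemma Represents.add_smul_mem_cone [Finite F] (h : M.Represents F v) (hM : M.IsSimple)
    (hfin : M.E.Finite) (hobs : ∀ N, M.HasInducedMinor N → ¬ N.IsObstruction (Nat.card F))
    {a b : V} (ha : a ∈ cone F v M.E) (hb : b ∈ cone F v M.E) (hab : a + b ∈ cone F v M.E)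
    (t : F) : a + t • b ∈ cone F v M.E := by
  obtain rfl | ⟨e, he, α', rfl⟩ := ha
  · rw [zero_add]
    exact smul_mem_cone hb t
  obtain rfl | ⟨f, hf, β', rfl⟩ := hb
  · rw [smul_zero, add_zero]
    exact smul_mem_cone (mem_cone he) _
  obtain rfl | ha0 := eq_or_ne α' 0
  · rw [zero_smul, zero_add]
    exact smul_mem_cone (smul_mem_cone (mem_cone hf) _) t
  obtain rfl | hb0 := eq_or_ne β' 0
  · rw [zero_smul, smul_zero, add_zero]
    exact smul_mem_cone (mem_cone he) _
  by_cases hef : e = f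
  · subst hef
    exact .inr ⟨e, he, α' + t * β', by module⟩
  have hi := h.indepMod hef (hM e he f hf)
  obtain h0 | ⟨g, hg, γ, hγ⟩ := hab
  · exact absurd (hi _ _ ((mem_bot F).2 h0)).1 ha0
  have hge : e ≠ g := by
    rintro rfl
    exact hb0 (hi (α' - γ) β' (by rw [mem_bot, ← sub_eq_zero.2 hγ]; module)).2
  have hgf : f ≠ g := by
    rintro rfl
    exact ha0 (hi α' (β' - γ) (by rw [mem_bot, ← sub_eq_zero.2 hγ]; module)).1
  have hγ0 : γ ≠ 0 := by
    rintro rfl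
    exact ha0 (hi α' β' (by rw [mem_bot, hγ, zero_smul])).1
  set X := M.E ∩ {x | v x ∈ span F {v e, v f}} with hXdef
  have hX : M.IsFlat X := h.isFlat_inter _
  have heX : e ∈ X := ⟨he, subset_span (by simp)⟩
  have hfX : f ∈ X := ⟨hf, subset_span (by simp)⟩
  have hgX : g ∈ X := by
    refine ⟨hg, ?_⟩
    have : v g = γ⁻¹ • (α' • v e + β' • v f) := by
      rw [hγ, smul_smul, inv_mul_cancel₀ hγ0, one_smul]
    rw [Set.mem_ofPred_eq, this]
    exact smul_mem _ _ (mem_span_pair.2 ⟨_, _, rfl⟩)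
  have hXfin : X.Finite := hfin.subset Set.inter_subset_left
  have h3 : ({e, f, g} : Set α).encard = 3 := Set.encard_eq_three.2 ⟨e, f, g, hef, hge, hgf, rfl⟩
  have hle : 3 ≤ X.ncard := by
    have := Set.encard_le_encard
      (Set.insert_subset heX (Set.insert_subset hfX (Set.singleton_subset_iff.2 hgX)))
    rw [h3, ← hXfin.cast_ncard_eq] at this
    exact_mod_cast this
  have hU : (M ↾ X).IsUniform 2 X.ncard := by
    refine (hM.restrict hX.subset_ground).isUniform_two hXfin.cast_ncard_eq.symm fun I hI => ?_
    exact ((h.restrict hX.subset_ground).encard_le hI (Set.toFinite {v e, v f})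
      fun x hx => (hI.subset_ground hx).2).trans (encard_pair_le _ _)
  have hlt : Nat.card F < X.ncard := by
    by_contra! hcon
    exact hobs _ (.restrict M X .refl hX) (.inl ⟨_, hle, hcon, hU⟩)
  obtain ⟨x, hx, r, hr⟩ := exists_smul_eq_of_card_lt (F := F) (v := v) (X := X)
    (a := v e) (b := v f) (p := α' • v e + t • β' • v f)
    (by rw [← hXfin.cast_ncard_eq]; exact_mod_cast hlt)
    (fun x hx => h.ne_zero hM hx.1) (fun x hx y hy t => h.eq_of_smul hM hx.1 hy.1)
    (fun x hx => by
      obtain ⟨r, s, hrs⟩ := mem_span_pair.1 hx.2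
      exact ⟨r, s, hrs.symm⟩) ⟨α', t * β', by module⟩
  exact .inr ⟨x, hx.1, r, hr⟩

/-- This is the plane condition modulo zero. Without three collinear elements, the flat spanned by
the circuit is `U_{3,n+1}` with `n ≥ 3`. Contracting an element gives `U_{2,n}`, where
representability yields `n ≤ |F| + 1` and excluding short lines yields `n > |F|`. So the flat is the
excluded plane. -/
lemma Represents.exists_collinear [Finite F] (h : M.Represents F v) (hM : M.IsSimple)
    (hfin : M.E.Finite) (hobs : ∀ N, M.HasInducedMinor N → ¬ N.IsObstruction (Nat.card F))
    {a b c : V} (ha : a ∈ cone F v M.E) (hb : b ∈ cone F v M.E) (hc : c ∈ cone F v M.E)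
    (habc : a + b + c ∈ cone F v M.E) (hi : IndepModThree (⊥ : Submodule F V) a b c) :
    ∃ x ∈ cone F v M.E, ∃ y ∈ cone F v M.E, x ∈ span F {a, b, c} ∧ y ∈ span F {a, b, c} ∧
      x + y ∈ cone F v M.E ∧ IndepMod (⊥ : Submodule F V) x y := by
  set X := M.E ∩ {x | v x ∈ span F {a, b, c}} with hXdef
  have hX : M.IsFlat X := h.isFlat_inter _
  have hXfin : X.Finite := hfin.subset Set.inter_subset_left
  by_cases hcol : ∃ x ∈ X, ∃ y ∈ X, ∃ z ∈ X, x ≠ y ∧ x ≠ z ∧ y ≠ z ∧ ¬ M.Indep {x, y, z}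
  · obtain ⟨x, hx, y, hy, z, hz, hxy, hxz, hyz, hd⟩ := hcol
    obtain ⟨r, s, hr, hs, hrs⟩ := h.exists_smul_add_smul_eq hM hx.1 hy.1 hz.1 hxz hyz hd
    refine ⟨r • v x, smul_mem_cone (mem_cone hx.1) r, s • v y, smul_mem_cone (mem_cone hy.1) s,
      smul_mem _ _ hx.2, smul_mem _ _ hy.2, hrs ▸ mem_cone hz.1, fun r' s' h' => ?_⟩
    have := h.indepMod hxy (hM x hx.1 y hy.1) (r' * r) (s' * s) (by
      rwa [mul_smul, mul_smul])
    simpa [hr, hs] using this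
  exfalso
  push Not at hcol
  have hU : (M ↾ X).IsUniform 3 X.ncard := by
    refine ⟨hXfin.cast_ncard_eq.symm, fun I hI => ⟨fun hI' => ?_, fun hI' => ?_⟩⟩
    · exact ((h.restrict hX.subset_ground).encard_le hI' (Set.toFinite {a, b, c})
        fun x hx => (hI hx).2).trans (encard_triple_le _ _ _)
    · obtain hlt | heq := hI'.lt_or_eq
      · refine (hM.restrict hX.subset_ground).indep_of_encard_le_two hI ?_
        exact Order.le_of_lt_add_one (by simpa [two_add_one_eq_three] using hlt)
      · obtain ⟨x, y, z, hxy, hxz, hyz, rfl⟩ := Set.encard_eq_three.1 heq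
        rw [restrict_indep_iff]
        exact ⟨hcol x (hI (by simp)) y (hI (by simp)) z (hI (by simp)) hxy hxz hyz, hI⟩
  have hle : 4 ≤ X.ncard := by
    have key : ∀ d ∈ cone F v M.E, d ∈ span F {a, b, c} → d ≠ 0 →
        ∃ e ∈ X, ∃ t : F, d = t • v e := by
      rintro _ (rfl | ⟨e, he, t, rfl⟩) hd hd0
      · exact absurd rfl hd0
      · have ht : t ≠ 0 := by rintro rfl; simp at hd0
        exact ⟨e, ⟨he, (smul_mem_iff _ ht).1 hd⟩, t, rfl⟩
    obtain ⟨e₁, he₁, t₁, rfl⟩ := key a ha (subset_span (by simp)) (by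
      rintro rfl; exact one_ne_zero (hi 1 0 0 (by simp)).1)
    obtain ⟨e₂, he₂, t₂, rfl⟩ := key b hb (subset_span (by simp)) (by
      rintro rfl; exact one_ne_zero (hi 0 1 0 (by simp)).2.1)
    obtain ⟨e₃, he₃, t₃, rfl⟩ := key c hc (subset_span (by simp)) (by
      rintro rfl; exact one_ne_zero (hi 0 0 1 (by simp)).2.2)
    obtain ⟨e₄, he₄, t₄, h₄⟩ := key _ habc (mem_span_triple.2 ⟨1, 1, 1, by module⟩) (by
      intro h0
      exact one_ne_zero (hi 1 1 1 (by rw [mem_bot, ← h0]; module)).1)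
    have ht₁ : t₁ ≠ 0 := by rintro rfl; exact one_ne_zero (hi 1 0 0 (by simp)).1
    have ht₂ : t₂ ≠ 0 := by rintro rfl; exact one_ne_zero (hi 0 1 0 (by simp)).2.1
    have ht₃ : t₃ ≠ 0 := by rintro rfl; exact one_ne_zero (hi 0 0 1 (by simp)).2.2
    have h12 : e₁ ≠ e₂ := by
      rintro rfl
      exact ht₂ (hi t₂ (-t₁) 0 (by rw [mem_bot]; module)).1
    have h13 : e₁ ≠ e₃ := by
      rintro rfl
      exact ht₃ (hi t₃ 0 (-t₁) (by rw [mem_bot]; module)).1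
    have h23 : e₂ ≠ e₃ := by
      rintro rfl
      exact ht₃ (hi 0 t₃ (-t₂) (by rw [mem_bot]; module)).2.1
    have h14 : e₁ ≠ e₄ := by
      rintro rfl
      exact ht₁ (hi (t₁ - t₄) t₁ t₁ (by
        rw [mem_bot, ← smul_zero t₁, ← sub_eq_zero.2 h₄]; module)).2.1
    have h24 : e₂ ≠ e₄ := by
      rintro rfl
      exact ht₂ (hi t₂ (t₂ - t₄) t₂ (by
        rw [mem_bot, ← smul_zero t₂, ← sub_eq_zero.2 h₄]; module)).1
    have h34 : e₃ ≠ e₄ := by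
      rintro rfl
      exact ht₃ (hi t₃ t₃ (t₃ - t₄) (by
        rw [mem_bot, ← smul_zero t₃, ← sub_eq_zero.2 h₄]; module)).1
    have h3 : ({e₁, e₂, e₃} : Set α).encard = 3 :=
      Set.encard_eq_three.2 ⟨_, _, _, h12, h13, h23, rfl⟩
    have h4 : (insert e₄ {e₁, e₂, e₃} : Set α).encard = 3 + 1 := by
      rw [Set.encard_insert_of_notMem (by simp [h14.symm, h24.symm, h34.symm]), h3]
    have := Set.encard_le_encard (Set.insert_subset he₄ (Set.insert_subset he₁
      (Set.insert_subset he₂ (Set.singleton_subset_iff.2 he₃))))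
    rw [h4, ← hXfin.cast_ncard_eq] at this
    exact_mod_cast this
  obtain ⟨n, hn⟩ : ∃ n, X.ncard = n + 1 := ⟨X.ncard - 1, by omega⟩
  rw [hn] at hU
  obtain ⟨e, he⟩ : X.Nonempty := by
    rw [← Set.ncard_pos hXfin]
    omega
  have hU' := IsUniform.contract_singleton (r := 2) hU (c := e) he
  have hsimp := (hU'.isSimple le_rfl).isSimplification_self
  have hXm : M.HasInducedMinor (M ↾ X) := .restrict M X .refl hX
  have hem : M.HasInducedMinor ((M ↾ X) ／ {e}) :=
    .contract _ _ {e} hXm (Set.singleton_subset_iff.2 he) hsimp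
  obtain ⟨f, hf⟩ := exists_ker_eq (span F (v '' {e}))
  have hle' := hU'.le_card_add_one
    ((h.restrict hX.subset_ground).contract (Set.singleton_subset_iff.2 he) hf)
  have hlt : Nat.card F < n := by
    by_contra! hcon
    exact hobs _ hem (.inl ⟨n, by omega, hcon, hU'⟩)
  obtain rfl : n = Nat.card F + 1 := by omega
  exact hobs _ hXm (.inr hU)

/-- Conditions modulo a spanned subspace `W` reduce to conditions modulo zero: contract all elements
whose vectors lie in `W`, and simplify. The result inherits the excluded induced minors. -/
lemma Represents.exists_contract [Finite F] (h : M.Represents F v)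
    (hobs : ∀ N, M.HasInducedMinor N → ¬ N.IsObstruction (Nat.card F)) (hfin : M.E.Finite)
    {W : Submodule F V} (hW : Spanned (cone F v M.E) W) :
    ∃ (f : V →ₗ[F] V) (N : Matroid α), LinearMap.ker f = W ∧ N.Represents F (f ∘ v) ∧
      N.IsSimple ∧ N.E.Finite ∧ (∀ K, N.HasInducedMinor K → ¬ K.IsObstruction (Nat.card F)) ∧
      cone F (f ∘ v) N.E = f '' cone F v M.E := by
  obtain ⟨f, hf⟩ := exists_ker_eq W
  set C := M.E ∩ {e | v e ∈ W} with hC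
  have hfC : LinearMap.ker f = span F (v '' C) := by
    rw [hf, ← span_cone, hC, cone_inter]
    exact le_antisymm hW (span_le.2 Set.inter_subset_right)
  obtain ⟨N, hN⟩ := (M ／ C).exists_isSimplification
  have hr := h.contract Set.inter_subset_left hfC
  refine ⟨f, N, hf, hN.represents hr, hN.isSimple,
    hfin.subset (hN.ground_subset.trans Set.sdiff_subset),
    fun K hK => hobs K (HasInducedMinor.trans (.contract M N C .refl Set.inter_subset_left hN) hK),
    ?_⟩
  rw [hN.cone_eq hr, Represents.cone_contract hfC]

/-- A represented matroid without obstructions has a chordal cone. -/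
lemma Represents.isChordalCone [Finite F] (h : M.Represents F v)
    (hfin : M.E.Finite) (hobs : ∀ N, M.HasInducedMinor N → ¬ N.IsObstruction (Nat.card F)) :
    IsChordalCone F (cone F v M.E) where
  zero_mem := zero_mem_cone
  smul_mem t x hx := smul_mem_cone hx t
  line W hW a ha b hb c hc habc t := by
    obtain ⟨f, N, rfl, hr, hN, hNfin, hNobs, hcone⟩ := h.exists_contract hobs hfin hW
    rw [LinearMap.mem_ker, map_sub, map_add, sub_eq_zero] at habc
    have key := hr.add_smul_mem_cone hN hNfin hNobs (a := f a) (b := f b)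
      (hcone ▸ ⟨a, ha, rfl⟩) (hcone ▸ ⟨b, hb, rfl⟩) (hcone ▸ habc ▸ ⟨c, hc, rfl⟩) t
    rw [hcone] at key
    obtain ⟨d, hd, hd'⟩ := key
    exact ⟨d, hd, by rw [LinearMap.mem_ker, map_sub, map_add, map_smul, hd', sub_self]⟩
  plane W hW a ha b hb c hc d hd habcd hi := by
    obtain ⟨f, N, rfl, hr, hN, hNfin, hNobs, hcone⟩ := h.exists_contract hobs hfin hW
    rw [LinearMap.mem_ker, map_sub, map_add, map_add, sub_eq_zero] at habcd
    obtain ⟨_, hx, _, hy, hx', hy', hxy, hxy'⟩ := hr.exists_collinear hN hNfin hNobs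
      (a := f a) (b := f b) (c := f c)
      (hcone ▸ ⟨a, ha, rfl⟩) (hcone ▸ ⟨b, hb, rfl⟩) (hcone ▸ ⟨c, hc, rfl⟩)
      (hcone ▸ habcd ▸ ⟨d, hd, rfl⟩) (fun r s t hrst => hi r s t (by
        simpa using hrst))
    rw [hcone] at hx hy hxy
    obtain ⟨x, hx, rfl⟩ := hx
    obtain ⟨y, hy, rfl⟩ := hy
    obtain ⟨z, hz, hz'⟩ := hxy
    obtain ⟨r, s, t, h1⟩ := mem_span_triple.1 hx'
    obtain ⟨r', s', t', h2⟩ := mem_span_triple.1 hy'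
    refine ⟨x, hx, y, hy, z, hz, ⟨r, s, t, ?_⟩, ⟨r', s', t', ?_⟩, ?_, fun r s hrs => ?_⟩
    · rw [LinearMap.mem_ker, map_sub, sub_eq_zero, ← h1]; simp
    · rw [LinearMap.mem_ker, map_sub, sub_eq_zero, ← h2]; simp
    · rw [LinearMap.mem_ker, map_sub, map_add, hz', sub_self]
    · exact hxy' r s (by simpa using hrs)

end

/-! ### Representability of lines and hyperovals -/

section

variable {α F V : Type*} [Field F] [AddCommGroup V] [Module F V] {v : α → V} {M N : Matroid α}

lemma IsUniform.isRepresentable {r n : ℕ} (h : M.IsUniform r n) (hrn : r ≤ n)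
    (w : α → Fin r → F) (hw : ∀ J ⊆ M.E, J.encard = r → LinearIndepOn F w J) :
    M.IsRepresentable F := by
  refine ⟨r, w, fun I hI => ?_⟩
  rw [h.2 I hI]
  refine ⟨fun hIr => ?_, fun hli => ?_⟩
  · obtain ⟨J, hIJ, hJ, hJr⟩ := Set.exists_superset_subset_encard_eq hI hIr
      (by rw [h.1]; exact_mod_cast hrn)
    exact (hw J hJ hJr).mono hIJ
  · have := hli.linearIndependent.finite
    have := Fintype.ofFinite I
    have h2 := hli.linearIndependent.fintype_card_le_finrank
    rw [Module.finrank_fin_fun] at h2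
    rw [Set.encard_eq_coe_toFinset_card, Set.toFinset_card]
    exact_mod_cast h2

lemma IsSimple.isRepresentable_of_subsingleton (hM : M.IsSimple) (hE : M.E.Subsingleton) :
    M.IsRepresentable F := by
  refine ⟨1, fun _ _ => 1, fun I hI => ?_⟩
  obtain rfl | ⟨x, hx⟩ := I.eq_empty_or_nonempty
  · simp
  rw [(hE.anti hI).eq_singleton_of_mem hx, indep_singleton,
    iff_true_intro (hM.isNonloop (hI hx)), true_iff, linearIndepOn_singleton_iff]
  exact fun h => one_ne_zero (congrFun h 0)

/-- The points of the projective line. -/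
def linePoint : Option F → Fin 2 → F
  | none => ![0, 1]
  | some t => ![1, t]

/-- The points of a conic and, in characteristic two, its nucleus. -/
def hyperovalPoint : Option (Option F) → Fin 3 → F
  | none => ![0, 1, 0]
  | some none => ![0, 0, 1]
  | some (some t) => ![1, t, t ^ 2]

lemma linePoint_indep {x y : Option F} (hxy : x ≠ y) {r s : F}
    (h : r • linePoint x + s • linePoint y = 0) : r = 0 ∧ s = 0 := by
  have h0 := congrFun h 0
  have h1 := congrFun h 1
  rcases x with _ | x <;> rcases y with _ | y <;>
    simp [linePoint] at h0 h1 hxy ⊢ <;> grind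

/-- Three affine points give a Vandermonde determinant. Characteristic two matters only for the
nucleus and two affine points, where the determinant is, up to sign, a difference of two squares and
hence the square of a difference. -/
lemma hyperovalPoint_indep (h2 : (2 : F) = 0) {x y z : Option (Option F)} (hxy : x ≠ y)
    (hxz : x ≠ z) (hyz : y ≠ z) {r s t : F}
    (h : r • hyperovalPoint x + s • hyperovalPoint y + t • hyperovalPoint z = 0) : r = 0 := by
  have h0 := congrFun h 0
  have h1 := congrFun h 1
  have h3 := congrFun h 2
  rcases x with _ | _ | x <;> rcases y with _ | _ | y <;> rcases z with _ | _ | z <;>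
    simp [hyperovalPoint] at h0 h1 h3 hxy hxz hyz ⊢ <;> grind

lemma exists_injOn {β : Type*} [Finite β] [Nonempty β] {E : Set α} (hE : E.encard ≤ Nat.card β) :
    ∃ φ : α → β, Set.InjOn φ E := by
  classical
  have hfin : E.Finite := Set.finite_of_encard_le_coe hE
  have := hfin.fintype
  have := Fintype.ofFinite β
  have hcard : Fintype.card E ≤ Fintype.card β := by
    rw [Set.encard_eq_coe_toFinset_card, Set.toFinset_card, Nat.card_eq_fintype_card] at hE
    exact_mod_cast hE
  obtain ⟨g⟩ := Function.Embedding.nonempty_of_card_le hcard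
  refine ⟨fun e => if h : e ∈ E then g ⟨e, h⟩ else Classical.arbitrary β, fun e he f hf hef => ?_⟩
  simpa [he, hf] using hef

lemma IsUniform.isRepresentable_two [Finite F] {n : ℕ} (h : M.IsUniform 2 n) (hn : 2 ≤ n)
    (hnF : n ≤ Nat.card F + 1) : M.IsRepresentable F := by
  obtain ⟨φ, hφ⟩ := exists_injOn (β := Option F) (E := M.E)
    (by rw [h.1, Finite.card_option]; exact_mod_cast hnF)
  refine h.isRepresentable hn (linePoint ∘ φ) fun J hJ hJ2 => ?_
  obtain ⟨x, y, hxy, rfl⟩ := Set.encard_eq_two.1 hJ2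
  rw [LinearIndepOn.pair_iff _ hxy]
  exact fun r s hrs => linePoint_indep (fun h => hxy (hφ (hJ (by simp)) (hJ (by simp)) h)) hrs

lemma IsUniform.isRepresentable_three [Finite F] (h : M.IsUniform 3 (Nat.card F + 2))
    (hF : Even (Nat.card F)) : M.IsRepresentable F := by
  have h2 : (2 : F) = 0 := by
    have := Fintype.ofFinite F
    have hc : ringChar F = 2 := FiniteField.even_card_iff_char_two.2
      (Nat.even_iff.1 (by rwa [Nat.card_eq_fintype_card] at hF))
    have := ringChar.Nat.cast_ringChar (R := F)
    rw [hc] at this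
    exact_mod_cast this
  obtain ⟨φ, hφ⟩ := exists_injOn (β := Option (Option F)) (E := M.E)
    (by rw [h.1, Finite.card_option, Finite.card_option])
  have := Finite.one_lt_card (α := F)
  refine h.isRepresentable (by omega) (hyperovalPoint ∘ φ) fun J hJ hJ3 => ?_
  obtain ⟨x, y, z, hxy, hxz, hyz, rfl⟩ := Set.encard_eq_three.1 hJ3
  have hne : ∀ {e f}, e ∈ ({x, y, z} : Set α) → f ∈ ({x, y, z} : Set α) → e ≠ f → φ e ≠ φ f :=
    fun he hf hef h => hef (hφ (hJ he) (hJ hf) h)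
  have hxy' := hne (e := x) (f := y) (by simp) (by simp) hxy
  have hxz' := hne (e := x) (f := z) (by simp) (by simp) hxz
  have hyz' := hne (e := y) (f := z) (by simp) (by simp) hyz
  rw [linearIndepOn_insert (by simp [hxy, hxz]), LinearIndepOn.pair_iff _ hyz]
  refine ⟨fun r s hrs => ⟨?_, ?_⟩, fun hx => ?_⟩
  · exact hyperovalPoint_indep h2 hyz' hxy'.symm hxz'.symm (s := s) (t := 0)
      (by rw [zero_smul, add_zero]; exact hrs)
  · refine hyperovalPoint_indep h2 hyz'.symm hxz'.symm hxy'.symm (s := r) (t := 0) ?_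
    rw [zero_smul, add_zero, add_comm]
    exact hrs
  · rw [Set.image_pair, mem_span_pair] at hx
    obtain ⟨r, s, hrs⟩ := hx
    refine one_ne_zero (hyperovalPoint_indep h2 hxy' hxz' hyz' (r := 1) (s := -r) (t := -s) ?_)
    rw [one_smul]
    change _ = hyperovalPoint (φ x) at hrs
    rw [← hrs]
    simp only [Function.comp_apply]
    module

lemma IsUniform.exists_smul_eq [Finite F] {n : ℕ} (h : M.IsUniform 2 n) (hn : Nat.card F < n)
    (hv : M.Represents F v) {p : V} (hp : p ∈ span F (v '' M.E)) :
    ∃ e ∈ M.E, ∃ r : F, p = r • v e := by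
  have hM := h.isSimple le_rfl
  obtain ⟨x, y, hx, hy, hxy⟩ : ∃ x y, x ∈ M.E ∧ y ∈ M.E ∧ x ≠ y := by
    rw [← Set.one_lt_encard_iff, h.1]
    have : 1 < Nat.card F := Finite.one_lt_card
    norm_cast
    omega
  have hspan : ∀ q ∈ span F (v '' M.E), ∃ r s : F, q = r • v x + s • v y := by
    have hle : span F (v '' M.E) ≤ span F {v x, v y} := by
      refine span_le.2 ?_
      rintro _ ⟨e, he, rfl⟩
      obtain ⟨r, s, hrs⟩ := h.exists_eq_smul_add_smul hv hx hy hxy he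
      exact mem_span_pair.2 ⟨r, s, hrs.symm⟩
    intro q hq
    obtain ⟨r, s, hrs⟩ := mem_span_pair.1 (hle hq)
    exact ⟨r, s, hrs.symm⟩
  exact exists_smul_eq_of_card_lt (by rw [h.1]; exact_mod_cast hn) (fun e he => hv.ne_zero hM he)
    (fun e he f hf t => hv.eq_of_smul hM he hf) (fun e he => hspan _ (subset_span ⟨e, he, rfl⟩))
    (hspan _ hp)

/-- A hyperoval exists only over a field of even order. -/
lemma IsUniform.even_card [Finite F] (h : M.IsUniform 3 (Nat.card F + 2))
    (hv : M.Represents F v) : Even (Nat.card F) := by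
  classical
  have hM := h.isSimple (by norm_num)
  have hq : 1 < Nat.card F := Finite.one_lt_card
  obtain ⟨a, ha, b, hb, -, -, hab, -, -⟩ := exists_three (X := M.E)
    (by rw [h.1]; norm_cast; omega)
  have hI : ∀ {e f g : α}, e ∈ M.E → f ∈ M.E → g ∈ M.E → e ≠ f → e ≠ g → f ≠ g →
      IndepModThree (⊥ : Submodule F V) (v e) (v f) (v g) := fun he hf hg hef heg hfg =>
    hv.indepModThree hef heg hfg (h.indep_three le_rfl he hf hg)
  have hI2 : ∀ {e f : α}, e ∈ M.E → f ∈ M.E → e ≠ f →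
      IndepMod (⊥ : Submodule F V) (v e) (v f) := fun he hf hef =>
    hv.indepMod hef (hM _ he _ hf)
  -- a point off the hyperoval
  obtain ⟨p, hp⟩ : ∃ p, p = v a + v b := ⟨_, rfl⟩
  have hpe : ∀ e ∈ M.E, ∀ r : F, p ≠ r • v e := by
    intro e he r hr
    by_cases hae : a = e
    · subst hae
      exact one_ne_zero (hI2 ha hb hab (1 - r) 1
        (by rw [mem_bot, ← sub_eq_zero.2 (hp.symm.trans hr)]; module)).2
    by_cases hbe : b = e
    · subst hbe
      exact one_ne_zero (hI2 ha hb hab 1 (1 - r)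
        (by rw [mem_bot, ← sub_eq_zero.2 (hp.symm.trans hr)]; module)).1
    exact one_ne_zero (hI ha hb he hab hae hbe 1 1 (-r)
      (by rw [mem_bot, ← sub_eq_zero.2 (hp.symm.trans hr)]; module)).1
  -- Every line through a point of the hyperoval meets it again: contracting `e` leaves `|F| + 1`
  -- points on a line, which is full, so the image of `p` is proportional to the image of some `f`.
  have hex : ∀ e ∈ M.E, ∃ f ∈ M.E, e ≠ f ∧ ∃ r s : F, r ≠ 0 ∧ s ≠ 0 ∧
      p = r • v e + s • v f := by
    intro e he
    obtain ⟨φ, hφ⟩ := exists_ker_eq (span F (v '' {e}))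
    have hφe : φ (v e) = 0 := by
      rw [← LinearMap.mem_ker, hφ]
      exact subset_span (by simp)
    have hspan : ∀ x ∈ M.E, φ (v x) ∈ span F ((φ ∘ v) '' (M ／ {e}).E) := by
      intro x hx
      by_cases hxe : x = e
      · rw [hxe, hφe]
        exact zero_mem _
      · exact subset_span ⟨x, ⟨hx, hxe⟩, rfl⟩
    obtain ⟨f, hf, s, hs⟩ := (IsUniform.contract_singleton (r := 2) h he).exists_smul_eq
      (Nat.lt_succ_self _) (hv.contract (Set.singleton_subset_iff.2 he) hφ) (p := φ p)
      (by rw [hp, map_add]; exact add_mem (hspan a ha) (hspan b hb))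
    have hker : p - s • v f ∈ LinearMap.ker φ := by
      rw [LinearMap.mem_ker, map_sub, map_smul, hs, Function.comp_apply, sub_self]
    rw [hφ, Set.image_singleton, mem_span_singleton] at hker
    obtain ⟨r, hr⟩ := hker
    have hpr : p = r • v e + s • v f := by rw [hr]; abel
    refine ⟨f, hf.1, fun hef => hf.2 hef.symm, r, s, ?_, ?_, hpr⟩
    · rintro rfl
      exact hpe f hf.1 s (by rw [hpr, zero_smul, zero_add])
    · rintro rfl
      exact hpe e he r (by rw [hpr, zero_smul, add_zero])
  have huniq : ∀ e ∈ M.E, ∀ f ∈ M.E, ∀ g ∈ M.E, e ≠ f → e ≠ g → ∀ r s r' s' : F, s ≠ 0 →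
      p = r • v e + s • v f → p = r' • v e + s' • v g → f = g := by
    intro e he f hf g hg hef heg r s r' s' hs h1 h2
    by_contra hfg
    exact hs (hI he hf hg hef heg hfg (r - r') s (-s')
      (by rw [mem_bot, ← sub_eq_zero.2 (h1.symm.trans h2)]; module)).2.1
  choose! g hg hge r s hr hs hrs using hex
  have hinv : ∀ e ∈ M.E, g (g e) = e := fun e he =>
    huniq (g e) (hg e he) _ (hg _ (hg e he)) e he (hge _ (hg e he)) (hge e he).symm _ _ (s e) (r e)
      (hs _ (hg e he)) (hrs _ (hg e he)) (by rw [add_comm]; exact hrs e he)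
  have hfin : M.E.Finite := Set.finite_of_encard_eq_coe h.1
  -- The lines through `p` pair off the elements without fixed points, so their number `|F| + 2` is
  -- zero modulo two.
  have hsum := Finset.sum_involution (s := hfin.toFinset) (f := fun _ => (1 : ZMod 2))
    (fun e _ => g e) (fun _ _ => by decide)
    (fun e he _ => (hge e (hfin.mem_toFinset.1 he)).symm)
    (fun e he => hfin.mem_toFinset.2 (hg e (hfin.mem_toFinset.1 he)))
    (fun e he => hinv e (hfin.mem_toFinset.1 he))
  rw [Finset.sum_const, nsmul_one, ZMod.natCast_eq_zero_iff, ← even_iff_two_dvd] at hsum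
  have hcard : hfin.toFinset.card = Nat.card F + 2 := by
    have := h.1
    rw [hfin.encard_eq_coe_toFinset_card] at this
    exact_mod_cast this
  rw [hcard] at hsum
  simpa [parity_simps] using hsum

end

/-! ### The characterization and minimality -/

section

variable {α F : Type*} [Field F] [Finite F] {M N : Matroid α}

lemma IsChordal.not_isObstruction (h : M.IsChordal F) (hq : 2 < Nat.card F)
    (hN : M.HasInducedMinor N) : ¬ N.IsObstruction (Nat.card F) := by
  obtain ⟨⟨n, v, hv⟩, hb⟩ := h
  obtain ⟨w, hw, hc⟩ := hN.exists_represents (F := F) (v := v) hv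
  exact fun hobs => hobs.not_isChordalCone hq hw (hc (hb.isChordalCone hv))

lemma isChordal_iff (hq : 2 < Nat.card F) (hfin : M.E.Finite) (hM : M.IsSimple) :
    M.IsChordal F ↔
      M.IsRepresentable F ∧ ∀ N, M.HasInducedMinor N → ¬ N.IsObstruction (Nat.card F) := by
  refine ⟨fun h => ⟨h.1, fun N hN => h.not_isObstruction hq hN⟩, fun ⟨hr, hobs⟩ => ⟨hr, ?_⟩⟩
  obtain ⟨n, v, hv⟩ := hr
  have hv : M.Represents F v := hv
  refine Represents.isBuilt ?_ hfin hM hv (hv.isChordalCone hfin hobs)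
  -- Were `0` and `t` the only scalars, the field would have at most two elements. This is where `2
  -- < Nat.card F` enters the structural part.
  intro t
  by_contra! hcon
  have hsub : (Set.univ : Set F) ⊆ {0, t} := fun u _ => by
    by_cases hu : u = 0
    · simp [hu]
    · simp [hcon u hu]
  have := (Set.encard_le_encard hsub).trans (encard_pair_le _ _)
  rw [Set.encard_univ, ENat.card_eq_coe_natCard] at this
  norm_cast at this
  omega

lemma not_isObstruction_of_subsingleton {q : ℕ} (hE : M.E.Subsingleton) :
    ¬ M.IsObstruction q := by
  rw [← Set.encard_le_one_iff_subsingleton] at hE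
  rintro (⟨k, hk, -, h, -⟩ | ⟨h, -⟩) <;> rw [h] at hE <;> norm_cast at hE <;> omega

lemma IsSimple.isChordal_of_subsingleton (hq : 2 < Nat.card F) (hM : M.IsSimple)
    (hE : M.E.Subsingleton) : M.IsChordal F :=
  (isChordal_iff hq hE.finite hM).2 ⟨hM.isRepresentable_of_subsingleton hE,
    fun _ hN => not_isObstruction_of_subsingleton (hE.anti hN.ground_subset)⟩

/-- These two lengths are those of the lines that occur among the induced minors of `U_{3,q+2}`;
they lie just outside the excluded range on either side. -/
lemma IsUniform.isChordal_two (hq : 2 < Nat.card F) {n : ℕ} (h : M.IsUniform 2 n)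
    (hn : n = 2 ∨ n = Nat.card F + 1) : M.IsChordal F := by
  refine (isChordal_iff hq (Set.finite_of_encard_eq_coe h.1) (h.isSimple le_rfl)).2
    ⟨h.isRepresentable_two (by omega) (by omega), fun N hN => ?_⟩
  obtain rfl | ⟨-, hE⟩ := h.hasInducedMinor_two hN
  · rintro (⟨k, hk, hkq, hk', -⟩ | ⟨h3, h3'⟩)
    · have := h.1.symm.trans hk'
      norm_cast at this
      omega
    · have := h.1.symm.trans h3
      norm_cast at this
      omega
  · exact not_isObstruction_of_subsingleton hE

lemma IsObstruction.isMinimalNonChordal (hq : 2 < Nat.card F)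
    (h : M.IsObstruction (Nat.card F)) : M.IsMinimalNonChordal F := by
  refine ⟨fun hc => hc.not_isObstruction hq .refl h, fun N hN hne => ?_⟩
  obtain ⟨k, -, -, h⟩ | h := h
  · obtain hNM | ⟨hs, hE⟩ := h.hasInducedMinor_two hN
    · exact absurd hNM hne
    · exact hs.isChordal_of_subsingleton hq hE
  · obtain hNM | h2 | h2 | ⟨hs, hE⟩ := h.hasInducedMinor_three (n := Nat.card F + 1) hN
    · exact absurd hNM hne
    · exact h2.isChordal_two hq (.inl rfl)
    · exact h2.isChordal_two hq (.inr rfl)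
    · exact hs.isChordal_of_subsingleton hq hE

end

end Matroid

theorem theorem4 {F : Type*} [Field F] [Finite F] (q : ℕ) (hF : Nat.card F = q) (hq : 2 < q)
    {α : Type*} (M : Matroid α) (hfin : M.Finite) (hM : M.IsSimple) :
    -- the induced-minor-minimal non-chordal matroids among the `F`-representable ones
    (M.IsRepresentable F ∧ M.IsMinimalNonChordal F ↔
      (∃ k, 2 < k ∧ k ≤ q ∧ M.IsUniform 2 k) ∨ (Even q ∧ M.IsUniform 3 (q + 2))) ∧
    -- every listed matroid, representable or not, is induced-minor-minimal non-chordal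
    (M.IsObstruction q → M.IsMinimalNonChordal F) ∧
    -- the class is characterized by excluding the listed matroids
    (M.IsChordal F ↔
      M.IsRepresentable F ∧ ∀ N, M.HasInducedMinor N → ¬ N.IsObstruction q) := by
  subst hF
  have hE := hfin.ground_finite
  refine ⟨⟨fun ⟨hr, hmin⟩ => ?_, ?_⟩, fun h => h.isMinimalNonChordal hq,
    Matroid.isChordal_iff hq hE hM⟩
  · have hobs : M.IsObstruction (Nat.card F) := by
      -- A representable matroid outside the class contains an obstruction. In a proper induced
      -- minor this is impossible, because that minor is chordal, so the matroid itself is the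
      -- obstruction.
      by_contra hcon
      refine hmin.1 ((Matroid.isChordal_iff hq hE hM).2 ⟨hr, fun N hN hNobs => ?_⟩)
      obtain rfl | hne := eq_or_ne N M
      · exact hcon hNobs
      · exact (hmin.2 N hN hne).not_isObstruction hq .refl hNobs
    refine hobs.imp id fun h => ⟨?_, h⟩
    obtain ⟨n, v, hv⟩ := hr
    exact h.even_card (F := F) (v := v) hv
  · rintro (⟨k, hk, hkq, h⟩ | ⟨hev, h⟩)
    · exact ⟨h.isRepresentable_two (by omega) (by omega),
        Matroid.IsObstruction.isMinimalNonChordal hq (.inl ⟨k, hk, hkq, h⟩)⟩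
    · exact ⟨h.isRepresentable_three hev,
        Matroid.IsObstruction.isMinimalNonChordal hq (.inr h)⟩
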